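/- There are an absolute constant $C$ and a single randomized oracle $\mathcal O$ (a program for a random access machine whose memory is kept between queries, and which obtains random bits by tossing fair coins) such that the following holds for all integers $d \ge 1$, $h \ge 0$ and all real $\varepsilon \in (0,1/2)$. There is a positive integer $$k \;\le\; C\cdot\frac{d^5\, h^{C h}\, \log(d/\varepsilon)}{\varepsilon^3}\qquad(\text{with } 0^0 = 1),$$ depending only on $d,h,\varepsilon$, such that for every finite simple graph $G=(V,E)$ of maximum degree at most $d$ the oracle, given $d$, $h$ and $\varepsilon$ (the latter as a fraction $p/q$ with $\varepsilon/2 \le p/q \le \varepsilon$) and query access to $G$ (a query asks either for the degree of a vertex $v$ or for the label of the $j$-th neighbour of $v$, $1\le j\le \deg(v)$), provides query access to a function $f : V \to 2^V$ with the following properties. 1. For all $v \in V$, $v \in f(v)$. 2. For all $v \in V$ and all $w \in f(v)$, $f(v) = f(w)$. 3. If the treewidth of $G$ is at most $h$, then with probability at least $9/10$ over the random bits, $|\{(v,w)\in E : f(v)\neq f(w)\}| \le \varepsilon |V|$. 4. For all $v \in V$, $|f(v)| \le k$. 5. To answer a query about any vertex $v$ (that is, to output a list of the elements of $f(v)$),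 the oracle makes at most $C\, d\, k^{4h+7}$ queries to $G$, and its running time is at most $C\, k^{4h+C} \log (Q+2)$, where $Q$ is the number of previous queries to the oracle. The running time is measured in unit-cost steps of a random access machine whose arithmetic operations are addition and truncated subtraction; a graph query or a coin toss is one step. 6. The function $f$ is determined by $G$ (given with its vertex labels and the order of its neighbour lists), the parameters given to the oracle and the oracle's random bits, and does not depend on the queries to the oracle: whatever was asked before, a query about $v$ is answered by $f(v)$ for the same $f$. Properties 1, 2, 4, 5 and 6 hold for every outcome of the random bits, and property 3 is the only one that needs the bound on the treewidth. -/

import Mathlib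

open MeasureTheory

/-! ### Tree decompositions -/

/-- A tree decomposition of a simple graph `G`: a forest on finitely many nodes, each of which
carries a set of vertices (its bag). -/
structure TreeDecomposition {V : Type*} (G : SimpleGraph V) where
  /-- number of nodes -/
  size : ℕ
  /-- the forest on the nodes -/
  forest : SimpleGraph (Fin size)
  acyclic : forest.IsAcyclic
  /-- the set of vertices attached to a node -/
  bag : Fin size → Finset V
  /-- every vertex lies in a bag -/
  covers_vertex : ∀ v : V, ∃ i, v ∈ bag i
  /-- every edge lies in a bag -/
  covers_edge : ∀ u v : V, G.Adj u v → ∃ i, u ∈ bag i ∧ v ∈ bag i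
  /-- the nodes whose bags contain a given vertex are connected in the forest -/
  connected : ∀ v : V, (forest.induce {i | v ∈ bag i}).Preconnected

/-- The width `max |bag i| - 1` (for the empty graph, truncated at `0`). -/
def TreeDecomposition.width {V : Type*} {G : SimpleGraph V} (D : TreeDecomposition G) : ℕ :=
  (Finset.univ.sup fun i => (D.bag i).card) - 1

/-- The least width of a tree decomposition. -/
noncomputable def treewidth {V : Type*} (G : SimpleGraph V) : ℕ :=
  sInf {w | ∃ D : TreeDecomposition G, D.width = w}

/-! ### Graphs in the bounded-degree model -/

/-- A graph with vertex labels `0, …, n - 1`, together with the order in which the neighbours of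
each vertex are listed; this is what neighbour queries are answered from. -/
structure GraphInput (n : ℕ) where
  graph : SimpleGraph (Fin n)
  nbrs : Fin n → List (Fin n)
  nodup : ∀ v, (nbrs v).Nodup
  mem_nbrs : ∀ v w, w ∈ nbrs v ↔ graph.Adj v w

/-- The degree of a vertex, i.e. the length of its (repetition-free) list of neighbours. -/
def GraphInput.degree {n : ℕ} (A : GraphInput n) (v : Fin n) : ℕ := (A.nbrs v).length

/-- The edges whose endpoints are sent to different sets by `f`. -/
def GraphInput.cutEdges {n : ℕ} (A : GraphInput n) (f : Fin n → Finset (Fin n)) :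
    Set (Sym2 (Fin n)) :=
  {e | e ∈ A.graph.edgeSet ∧ ∃ v w, e = s(v, w) ∧ f v ≠ f w}

/-! ### The machine model

Randomized random access machines with query access to a graph, written as structured programs.
A machine has registers and zero-initialised arrays that hold natural numbers. The only
arithmetic operations are addition and truncated subtraction; every elementary step, every test,
every graph query and every coin toss costs one unit of time. -/

/-- Programs. The registers `x`, `y`, `z` and the arrays `a` are named by numbers. -/
inductive Program : Type
  /-- `x := c` -/
  | const (x c : ℕ)
  /-- `x := y + z` -/
  | add (x y z : ℕ)
  /-- `x := y - z` (truncated) -/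
  | sub (x y z : ℕ)
  /-- `x := a[y]` -/
  | read (x a y : ℕ)
  /-- `a[y] := x` -/
  | write (a y x : ℕ)
  /-- `x :=` the degree of the vertex with label `y` -/
  | degQuery (x y : ℕ)
  /-- `x :=` the label of the `z`-th neighbour (counted from one) of the vertex with label `y` -/
  | nbrQuery (x y z : ℕ)
  /-- `x :=` the outcome of a fresh toss of a fair coin, filed under the number in `y` -/
  | toss (x y : ℕ)
  /-- first `P`, then `R` -/
  | seq (P R : Program)
  /-- if `x ≠ 0` then `P` else `R` -/
  | cond (x : ℕ) (P R : Program)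
  /-- while `x ≠ 0` do `P` -/
  | loop (x : ℕ) (P : Program)

/-- The state of a machine: the contents of the registers and of the arrays, and, for every number
`i`, how many coins have so far been tossed under `i`. -/
structure MState where
  reg : ℕ → ℕ
  arr : ℕ → ℕ → ℕ
  tossed : ℕ → ℕ

/-- Store the value `c` in register `x`. -/
def MState.set (s : MState) (x c : ℕ) : MState :=
  { s with reg := Function.update s.reg x c }

/-- Store the value `c` in entry `i` of array `a`. -/
def MState.setArr (s : MState) (a i c : ℕ) : MState :=
  { s with arr := Function.update s.arr a (Function.update (s.arr a) i c) }

/-- Record that one more coin has been tossed under the number `i`. -/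
def MState.tick (s : MState) (i : ℕ) : MState :=
  { s with tossed := Function.update s.tossed i (s.tossed i + 1) }

/-- The random bits: `ω (i, j)` is the outcome of toss number `j` under the number `i`. -/
abbrev Coins : Type := ℕ × ℕ → Bool

/-- All tosses are independent and fair. -/
noncomputable def coinMeasure : Measure Coins :=
  Measure.infinitePi fun _ : ℕ × ℕ => (PMF.uniformOfFintype Bool).toMeasure

/-- `Run A ω P s t c s'`: with query access to `A` and random bits `ω`, the program `P` started in
the state `s` halts in the state `s'` after `t` units of time and `c` graph queries.
A query about a vertex or a neighbour that does not exist gets stuck.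
Each toss consumes a bit that no earlier toss has used, so that the outcome of a toss
is available later only if the program has stored it. -/
inductive Run {n : ℕ} (A : GraphInput n) (ω : Coins) :
    Program → MState → ℕ → ℕ → MState → Prop
  | const (s : MState) (x c : ℕ) : Run A ω (.const x c) s 1 0 (s.set x c)
  | add (s : MState) (x y z : ℕ) :
      Run A ω (.add x y z) s 1 0 (s.set x (s.reg y + s.reg z))
  | sub (s : MState) (x y z : ℕ) :
      Run A ω (.sub x y z) s 1 0 (s.set x (s.reg y - s.reg z))
  | read (s : MState) (x a y : ℕ) :
      Run A ω (.read x a y) s 1 0 (s.set x (s.arr a (s.reg y)))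
  | write (s : MState) (a y x : ℕ) :
      Run A ω (.write a y x) s 1 0 (s.setArr a (s.reg y) (s.reg x))
  | degQuery (s : MState) (x y : ℕ) (v : Fin n) (hv : s.reg y = v) :
      Run A ω (.degQuery x y) s 1 1 (s.set x (A.degree v))
  | nbrQuery (s : MState) (x y z : ℕ) (v : Fin n) (hv : s.reg y = v)
      (j : ℕ) (hz : s.reg z = j + 1) (hj : j < (A.nbrs v).length) :
      Run A ω (.nbrQuery x y z) s 1 1 (s.set x ((A.nbrs v)[j] : Fin n))
  | toss (s : MState) (x y : ℕ) :
      Run A ω (.toss x y) s 1 0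
        ((s.tick (s.reg y)).set x (ω (s.reg y, s.tossed (s.reg y))).toNat)
  | seq {P R : Program} {s s' s'' : MState} {t c t' c' : ℕ}
      (h : Run A ω P s t c s') (h' : Run A ω R s' t' c' s'') :
      Run A ω (.seq P R) s (t + t') (c + c') s''
  | cond_true {P : Program} (R : Program) {s s' : MState} {t c x : ℕ}
      (hx : s.reg x ≠ 0) (h : Run A ω P s t c s') :
      Run A ω (.cond x P R) s (t + 1) c s'
  | cond_false (P : Program) {R : Program} {s s' : MState} {t c x : ℕ}
      (hx : s.reg x = 0) (h : Run A ω R s t c s') :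
      Run A ω (.cond x P R) s (t + 1) c s'
  | loop_done (P : Program) {s : MState} {x : ℕ} (hx : s.reg x = 0) :
      Run A ω (.loop x P) s 1 0 s
  | loop_step {P : Program} {s s' s'' : MState} {t c t' c' x : ℕ}
      (hx : s.reg x ≠ 0) (h : Run A ω P s t c s') (h' : Run A ω (.loop x P) s' t' c' s'') :
      Run A ω (.loop x P) s (t + t' + 1) (c + c') s''

/-! ### Oracles -/

/-- The state in which an oracle is switched on: the parameters `d`, `h` and the accuracy `p / q`
are in the registers `1`, `2`, `3`, `4`, everything else is zero, and no coin has been tossed. -/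
def startState (d h p q : ℕ) : MState where
  reg x := if x = 1 then d else if x = 2 then h else if x = 3 then p else if x = 4 then q else 0
  arr _ _ := 0
  tossed _ := 0

/-- In state `s` the machine has answered with the set `S`: register `0` holds the number of
elements of `S`, and array `0` starts with a list of their labels. -/
def MState.Answers {n : ℕ} (s : MState) (S : Finset (Fin n)) : Prop :=
  s.reg 0 = S.card ∧ ∀ v : Fin n, v ∈ S ↔ ∃ i < s.reg 0, s.arr 0 i = v

/-- `After A ω P s₀ vs s`: an oracle with program `P`, switched on in state `s₀`, is in state `s`
after it has been asked about the vertices in `vs` (the most recent one first). To ask about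
`v`, one puts the label of `v` into register `0` and runs `P`; the memory is kept between
the queries. -/
inductive After {n : ℕ} (A : GraphInput n) (ω : Coins) (P : Program) (s₀ : MState) :
    List (Fin n) → MState → Prop
  | start : After A ω P s₀ [] s₀
  | ask {vs : List (Fin n)} {s s' : MState} {t c : ℕ} (hs : After A ω P s₀ vs s) (v : Fin n)
      (h : Run A ω P (s.set 0 v) t c s') : After A ω P s₀ (v :: vs) s'

/-! The oracle is a random-priority clustering. Call a set isolated if it is linked, has at most `t
= 2 * h + 2` neighbours, has fewer than `b` vertices together with them, and has fewer than `1 / D`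
leaving edges per vertex. Each vertex `v` deterministically gets an isolated set `findSet v` through
`v`, or `[v]` if the search accepts none. Coins give every vertex a random key. A vertex `u` joins
its winner, the vertex of smallest key among those whose set contains `u`; the parts are the fibres
of the winner map. So they partition the vertices, each part lies in one set `findSet v`, and the
answers depend only on the graph and the keys.

Few vertices lack an isolated set. Merging the leaves of a tree decomposition and removing a bag
whenever too many open vertices have accumulated, or two removed bags would bound the same open
part, leaves components with few neighbours (`Piece.join`, `exists_removal_of_treewidth_le`). An
averaging argument discards the components with many leaving edges
(`exists_isolated_of_treewidth_le`).

Few edges are cut in expectation. A cut edge leaves the set of the winner of one of its endpoints,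
and a given candidate wins at `u` with probability about the reciprocal of the number of sets
covering `u`. For each `v` take a least covered vertex `a v` of its set. One must then bound, for
fixed `w`, the sum of the reciprocals of the cover numbers of `a v` over all `v` whose set contains
`w`. This is logarithmic in the largest cover number, because linked sets through `w` with at most
`t` neighbours cannot isolate `4 ^ (t + 1)` vertices from one another
(`SimpleGraph.card_lt_of_isolating`, proved by the branching argument for important separators).
Markov's inequality finishes this part.

The winner can be found locally. A breadth first search that refuses to expand at most `t` positions
of its queue finds every isolated set from any of its vertices, and there are only `b ^ t` codes for
the refused positions (`GraphInput.exists_codedSearch_eq`). Hence the searches from `u` meet every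
`v` whose set contains `u` (`GraphInput.mem_collect_of_mem_findSet`), and there are at most `b ^ t *
b` such `v`.

The rest is program verification: a small Hoare logic with time bounds shows that a concrete program
computes these parts in time `b ^ (4 * h + 10)`, with keys drawn on demand and stored. -/

/-- The vertices outside `S` that have a neighbour in `S`. -/
noncomputable def SimpleGraph.outer {V : Type*} [Fintype V] (G : SimpleGraph V) (S : Finset V) :
    Finset V := by
  classical exact Finset.univ.filter fun v => v ∉ S ∧ ∃ u ∈ S, G.Adj u v

/-- `S` has no proper nonempty part that is closed under adjacency within `S`. -/
def SimpleGraph.Linked {V : Type*} (G : SimpleGraph V) (S : Finset V) : Prop :=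
  ∀ Y : Finset V, (∃ x ∈ Y, x ∈ S) →
    (∀ x ∈ Y, x ∈ S → ∀ y ∈ S, G.Adj x y → y ∈ Y) → S ⊆ Y

/-! ### Submodular boundaries and the anti-isolation lemma -/

section Separators

variable {V : Type*} [Fintype V] (G : SimpleGraph V)

theorem SimpleGraph.mem_outer {S : Finset V} {v : V} :
    v ∈ G.outer S ↔ v ∉ S ∧ ∃ u ∈ S, G.Adj u v := by
  classical simp [SimpleGraph.outer]

variable [DecidableEq V]

/-- Submodularity of the vertex boundary with the vertices of `Z` free of charge. After rewriting
both sums as union plus intersection, the inclusions hold for the unions and for the intersections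
separately. -/
theorem SimpleGraph.card_outer_union_add_card_outer_inter_le (A B Z : Finset V) :
    (G.outer (A ∪ B) \ Z).card + (G.outer (A ∩ B) \ Z).card ≤
      (G.outer A \ Z).card + (G.outer B \ Z).card := by
  rw [← Finset.card_union_add_card_inter (G.outer (A ∪ B) \ Z),
    ← Finset.card_union_add_card_inter (G.outer A \ Z)]
  apply add_le_add <;> apply Finset.card_le_card <;> intro v <;>
    simp only [Finset.mem_union, Finset.mem_inter, Finset.mem_sdiff, SimpleGraph.mem_outer]
  · rintro (⟨⟨h, u, hu, huv⟩, hz⟩ | ⟨⟨h, u, hu, huv⟩, hz⟩)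
    · rcases hu with hu | hu
      · exact .inl ⟨⟨fun h' => h (.inl h'), u, hu, huv⟩, hz⟩
      · exact .inr ⟨⟨fun h' => h (.inr h'), u, hu, huv⟩, hz⟩
    · by_cases hA : v ∈ A
      · exact .inr ⟨⟨fun h' => h ⟨hA, h'⟩, u, hu.2, huv⟩, hz⟩
      · exact .inl ⟨⟨hA, u, hu.1, huv⟩, hz⟩
  · rintro ⟨⟨⟨h, -⟩, hz⟩, ⟨-, u, hu, huv⟩, -⟩
    exact ⟨⟨⟨fun hh => h (.inl hh), u, hu.1, huv⟩, hz⟩,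
      ⟨fun hh => h (.inr hh), u, hu.2, huv⟩, hz⟩

/-- Among the sets that contain `R` and avoid `F` there is a largest one of least cost. -/
theorem SimpleGraph.exists_maximal_minCut (R F Z X₁ : Finset V) (h₁ : R ⊆ X₁)
    (h₁' : Disjoint X₁ F) :
    ∃ X₀ : Finset V, R ⊆ X₀ ∧ Disjoint X₀ F ∧
      (∀ X, R ⊆ X → Disjoint X F → (G.outer X₀ \ Z).card ≤ (G.outer X \ Z).card) ∧
      ∀ X, X₀ ⊂ X → Disjoint X F → (G.outer X₀ \ Z).card < (G.outer X \ Z).card := by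
  classical
  obtain ⟨X₀, hX₀, hmin⟩ := Finset.exists_min_image
    (Finset.univ.filter fun X : Finset V => R ⊆ X ∧ Disjoint X F)
    -- A lexicographic order in one number: the boundary first, then the number of missing vertices,
    -- which is at most `Fintype.card V`.
    (fun X => (G.outer X \ Z).card * (Fintype.card V + 1) + (Fintype.card V - X.card))
    ⟨X₁, by simp [h₁, h₁']⟩
  simp only [Finset.mem_filter, Finset.mem_univ, true_and] at hX₀ hmin
  refine ⟨X₀, hX₀.1, hX₀.2, fun X hR hF => ?_, fun X hX hF => ?_⟩
  · have := hmin X ⟨hR, hF⟩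
    by_contra! hlt
    have h2 := Nat.mul_le_mul_right (Fintype.card V + 1) hlt
    rw [Nat.succ_mul] at h2
    omega
  · have := hmin X ⟨hX₀.1.trans hX.1, hF⟩
    have hc := Finset.card_lt_card hX
    have hc' := Finset.card_le_univ X
    by_contra! hle
    have h2 := Nat.mul_le_mul_right (Fintype.card V + 1) hle
    omega

/-- Anti-isolation, with a set `R` that all `X a` contain, a set `F` that they avoid, and deleted
vertices `Z ⊆ F`. -/
theorem SimpleGraph.card_lt_of_isolating_aux (m : ℕ) : ∀ (k l : ℕ) (R F Z J : Finset V) (w : V)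
    (X : V → Finset V), w ∈ R → Z ⊆ F → (∀ a ∈ J, a ∈ F ∧ a ∉ Z) →
    (∀ a ∈ J, R ⊆ X a ∧ Disjoint (X a) F ∧ (G.outer (X a) \ Z).card ≤ k) →
    (∀ a ∈ J, ∀ Y : Finset V, w ∈ Y →
      (∀ x ∈ Y, ∀ y, y ∈ X a ∨ y = a → G.Adj x y → y ∈ Y) → a ∈ Y) →
    (∀ X' : Finset V, R ⊆ X' → Disjoint X' F → l ≤ (G.outer X' \ Z).card) →
    2 * k ≤ m + l → J.card + 1 ≤ 2 ^ m := by
  -- Here `m` bounds the potential `2 * k - l`, where `k` bounds the boundaries of the given sets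
  -- and `l` is a lower bound for all admissible boundaries. One branches on a boundary vertex `v`
  -- of a largest minimum cut `X₀`. If `v` joins the set, maximality raises `l` above the minimum;
  -- if `v` is deleted, `k` and `l` both drop by one. Either way the potential decreases.
  induction m with
  | zero =>
    intro k l R F Z J w X hw hZF hJ hX hreach hl hm
    rcases J.eq_empty_or_nonempty with rfl | ⟨a, ha⟩
    · simp
    exfalso
    obtain ⟨hR, hF, hk⟩ := hX a ha
    have := hl _ hR hF
    have h0 : (G.outer (X a) \ Z).card = 0 := by omega
    rw [Finset.card_eq_zero, Finset.sdiff_eq_empty_iff_subset] at h0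
    have haX : a ∈ X a := by
      refine hreach a ha (X a) (hR hw) fun x hx y hy hxy => ?_
      by_contra hyX
      rcases hy with hy | rfl
      · exact hyX hy
      · exact (hJ y ha).2 (h0 ((G.mem_outer).2 ⟨hyX, x, hx, hxy⟩))
    exact Finset.disjoint_left.1 hF haX (hJ a ha).1
  | succ m ih =>
    intro k l R F Z J w X hw hZF hJ hX hreach hl hm
    rcases J.eq_empty_or_nonempty with rfl | ⟨a₁, ha₁⟩
    · simpa using Nat.one_le_two_pow
    obtain ⟨hR₁, hF₁, hk₁⟩ := hX a₁ ha₁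
    obtain ⟨X₀, hR₀, hF₀, hmin, hmax⟩ := G.exists_maximal_minCut R F Z (X a₁) hR₁ hF₁
    have hl₀ := hl X₀ hR₀ hF₀
    have hk₀ := (hmin _ hR₁ hF₁).trans hk₁
    set c := (G.outer X₀ \ Z).card with hc
    have hc0 : (G.outer X₀ \ Z).Nonempty := by
      rw [Finset.nonempty_iff_ne_empty]
      intro h0
      rw [Finset.sdiff_eq_empty_iff_subset] at h0
      have haX : a₁ ∈ X₀ := by
        refine hreach a₁ ha₁ X₀ (hR₀ hw) fun x hx y hy hxy => ?_
        by_contra hyX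
        have hyZ := h0 ((G.mem_outer).2 ⟨hyX, x, hx, hxy⟩)
        rcases hy with hy | rfl
        · exact Finset.disjoint_left.1 hF₁ hy (hZF hyZ)
        · exact (hJ y ha₁).2 hyZ
      exact Finset.disjoint_left.1 hF₀ haX (hJ a₁ ha₁).1
    have hcpos : 0 < c := Finset.card_pos.2 hc0
    obtain ⟨v, hv⟩ := hc0
    obtain ⟨hvo, hvZ⟩ := Finset.mem_sdiff.1 hv
    obtain ⟨hvX₀, u, hu, huv⟩ := G.mem_outer.1 hvo
    -- Uncrossing: by submodularity and the minimality of `X₀`, adding `X₀` to a set does not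
    -- increase its boundary, so all sets may be assumed to contain `X₀`.
    set X' : V → Finset V := fun a => X a ∪ X₀ with hX'def
    have hX' : ∀ a ∈ J, R ⊆ X' a ∧ Disjoint (X' a) F ∧ (G.outer (X' a) \ Z).card ≤ k := by
      intro a ha
      obtain ⟨hR, hF, hk⟩ := hX a ha
      refine ⟨hR.trans Finset.subset_union_left, Finset.disjoint_union_left.2 ⟨hF, hF₀⟩, ?_⟩
      have h1 := G.card_outer_union_add_card_outer_inter_le (X a) X₀ Z
      have h2 := hmin (X a ∩ X₀) (Finset.subset_inter hR hR₀)
        (Finset.disjoint_of_subset_left Finset.inter_subset_left hF)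
      simp only [hX'def]
      omega
    have hreach' : ∀ a ∈ J, ∀ Y : Finset V, w ∈ Y →
        (∀ x ∈ Y, ∀ y, y ∈ X' a ∨ y = a → G.Adj x y → y ∈ Y) → a ∈ Y := fun a ha Y hwY hY =>
      hreach a ha Y hwY fun x hx y hy =>
        hY x hx y (hy.imp_left fun h => Finset.mem_union_left _ h)
    -- the sets that contain `v`
    have hJ1 := ih k (c + 1) (insert v X₀) F Z (J.filter fun a => v ∈ X' a) w X'
      (Finset.mem_insert_of_mem (hR₀ hw)) hZF (fun a ha => hJ a (Finset.mem_of_mem_filter a ha))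
      (fun a ha => by
        rw [Finset.mem_filter] at ha
        exact ⟨Finset.insert_subset ha.2 Finset.subset_union_right, (hX' a ha.1).2⟩)
      (fun a ha => hreach' a (Finset.mem_of_mem_filter a ha))
      (fun Y hY hF => hmax Y (Finset.ssubset_of_subset_of_ssubset (Finset.Subset.refl _)
        ((Finset.ssubset_insert hvX₀).trans_subset hY)) hF) (by omega)
    -- the sets that avoid `v`
    have hJ2 := ih (k - 1) (c - 1) R (insert v F) (insert v Z)
      (J.filter fun a => v ∉ X' a ∧ a ≠ v) w X' hw (Finset.insert_subset_insert _ hZF)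
      (fun a ha => by
        rw [Finset.mem_filter] at ha
        exact ⟨Finset.mem_insert_of_mem (hJ a ha.1).1, by
          simpa [ha.2.2] using (hJ a ha.1).2⟩)
      (fun a ha => by
        rw [Finset.mem_filter] at ha
        obtain ⟨hR, hF, hk⟩ := hX' a ha.1
        refine ⟨hR, Finset.disjoint_insert_right.2 ⟨ha.2.1, hF⟩, ?_⟩
        have h3 : G.outer (X' a) \ insert v Z = (G.outer (X' a) \ Z).erase v := by
          ext; simp; tauto
        have hmem : v ∈ G.outer (X' a) \ Z := Finset.mem_sdiff.2
          ⟨G.mem_outer.2 ⟨ha.2.1, u, Finset.mem_union_right _ hu, huv⟩, hvZ⟩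
        rw [h3, Finset.card_erase_of_mem hmem]
        omega)
      (fun a ha => hreach' a (Finset.mem_of_mem_filter a ha))
      (fun Y hY hF => by
        have := hmin Y hY (Finset.disjoint_of_subset_right (Finset.subset_insert _ _) hF)
        have h3 : G.outer Y \ insert v Z = (G.outer Y \ Z).erase v := by ext; simp; tauto
        have h4 := Finset.pred_card_le_card_erase (s := G.outer Y \ Z) (a := v)
        rw [h3]
        omega) (by omega)
    -- The target `v` itself is excluded from the second branch, where `v` is deleted. This single
    -- index is the extra one in `2 * (2 ^ m - 1) + 1 = 2 ^ (m + 1) - 1`.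
    have hJ3 : (J.filter fun a => a = v).card ≤ 1 := by
      rw [Finset.card_le_one]
      intro a ha b hb
      rw [Finset.mem_filter] at ha hb
      rw [ha.2, hb.2]
    have hsub : J ⊆ ((J.filter fun a => v ∈ X' a) ∪ (J.filter fun a => v ∉ X' a ∧ a ≠ v)) ∪
        (J.filter fun a => a = v) := by
      intro a ha
      simp only [Finset.mem_union, Finset.mem_filter]
      tauto
    have := Finset.card_le_card hsub
    have h5 := Finset.card_union_le ((J.filter fun a => v ∈ X' a) ∪
      (J.filter fun a => v ∉ X' a ∧ a ≠ v)) (J.filter fun a => a = v)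
    have h6 := Finset.card_union_le (J.filter fun a => v ∈ X' a)
      (J.filter fun a => v ∉ X' a ∧ a ≠ v)
    rw [pow_succ]
    omega

/-- Linked sets through `w` with small boundaries cannot isolate many vertices from each other. -/
theorem SimpleGraph.card_lt_of_isolating {ι : Type*} (t : ℕ) (J : Finset ι) (w : V)
    (S : ι → Finset V) (a : ι → V) (hw : ∀ j ∈ J, w ∈ S j) (hS : ∀ j ∈ J, G.Linked (S j))
    (ht : ∀ j ∈ J, (G.outer (S j)).card ≤ t) (ha : ∀ j ∈ J, a j ∈ S j)
    (hne : ∀ i ∈ J, ∀ j ∈ J, i ≠ j → a i ∉ S j) : J.card < 4 ^ (t + 1) := by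
  classical
  rcases J.eq_empty_or_nonempty with rfl | ⟨j₁, hj₁⟩
  · simp
  -- If some target is `w`, it lies in all the sets and so can be isolated from none of them; then
  -- there is only one index.
  by_cases hwa : ∃ j ∈ J, a j = w
  · obtain ⟨j, hj, hjw⟩ := hwa
    have : J ⊆ {j} := by
      intro i hi
      by_contra hij
      exact hne j hj i hi (fun h => hij (by simp [h])) (hjw ▸ hw i hi)
    have := Finset.card_le_card this
    have h4 : 4 ^ 1 ≤ 4 ^ (t + 1) := Nat.pow_le_pow_right (by norm_num) (by omega)
    simp at this
    omega
  push Not at hwa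
  have hinj : Set.InjOn a J := by
    intro i hi j hj hij
    by_contra hne'
    exact hne i hi j hj hne' (hij ▸ ha j hj)
  have : Nonempty ι := ⟨j₁⟩
  choose! g hg using fun (x : V) (hx : x ∈ J.image a) => Finset.mem_image.1 hx
  -- Each set is punctured at its own target, which makes it disjoint from all targets and enlarges
  -- its boundary by at most that vertex. With boundaries at most `t + 1` and lower bound `0`, the
  -- potential is `2 * (t + 1)`.
  have key := G.card_lt_of_isolating_aux (2 * (t + 1)) (t + 1) 0 {w} (J.image a) ∅ (J.image a) w
    (fun x => (S (g x)).erase x) (by simp) (by simp) (by simp) (fun x hx => by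
      obtain ⟨hgJ, hgx⟩ := hg x hx
      refine ⟨?_, ?_, ?_⟩
      · rw [Finset.singleton_subset_iff, Finset.mem_erase]
        exact ⟨fun h => hwa _ hgJ (hgx.trans h.symm), hw _ hgJ⟩
      · rw [Finset.disjoint_left]
        intro y hy hyJ
        obtain ⟨i, hi, rfl⟩ := Finset.mem_image.1 hyJ
        rw [Finset.mem_erase] at hy
        refine hne i hi _ hgJ (fun h => hy.1 ?_) hy.2
        rw [h, hgx]
      · rw [Finset.sdiff_empty]
        refine (Finset.card_le_card (t := insert x (G.outer (S (g x)))) ?_).trans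
          ((Finset.card_insert_le _ _).trans (Nat.succ_le_succ (ht _ hgJ)))
        intro y hy
        rw [G.mem_outer] at hy
        obtain ⟨hy1, u, hu, huy⟩ := hy
        rw [Finset.mem_insert, G.mem_outer]
        by_cases hyx : y = x
        · exact .inl hyx
        · exact .inr ⟨fun h => hy1 (Finset.mem_erase.2 ⟨hyx, h⟩), u,
            Finset.mem_of_mem_erase hu, huy⟩)
    (fun x hx Y hwY hY => by
      obtain ⟨hgJ, hgx⟩ := hg x hx
      refine hS _ hgJ Y ⟨w, hwY, hw _ hgJ⟩ (fun z hz _ y hy hzy => hY z hz y ?_ hzy)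
        (by have := ha _ hgJ; rwa [hgx] at this)
      by_cases hyx : y = x
      · exact .inr hyx
      · exact .inl (Finset.mem_erase.2 ⟨hyx, hy⟩))
    (by simp) (by omega)
  rw [Finset.card_image_of_injOn hinj, pow_mul] at key
  norm_num at key
  omega

end Separators

/-! ### Leaves of forests -/

section Forests

variable {ι : Type*} (F : SimpleGraph ι)

/-- Every nonempty set of nodes of a forest contains a node with at most one neighbour in it. -/
theorem SimpleGraph.IsAcyclic.exists_leaf {F : SimpleGraph ι} (hF : F.IsAcyclic) (N : Finset ι)
    (hN : N.Nonempty) :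
    ∃ i ∈ N, ∀ j ∈ N, ∀ k ∈ N, F.Adj i j → F.Adj i k → j = k := by
  have : Nonempty (N : Set ι) := hN.to_subtype
  -- An endpoint of a longest path will do: a neighbour off the path would extend it, and a
  -- neighbour on it other than the second vertex would close a cycle.
  obtain ⟨u, v, p, hp, hmax⟩ :=
    SimpleGraph.Walk.exists_isPath_forall_isPath_length_le_length (F.induce (N : Set ι))
  have hac : (F.induce (N : Set ι)).IsAcyclic := hF.induce _
  have key : ∀ w, (F.induce (N : Set ι)).Adj u w → w = p.snd := by
    intro w hw
    refine hac.eq_snd_of_adj_start hp hw ?_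
    by_contra hws
    have := hmax _ _ (SimpleGraph.Walk.cons hw.symm p) (by simp [hp, hws])
    simp at this
  refine ⟨u, u.2, fun j hj k hk hij hik => ?_⟩
  have h1 := key ⟨j, hj⟩ hij
  have h2 := key ⟨k, hk⟩ hik
  simpa using h1.trans h2.symm

theorem SimpleGraph.Linked.of_preconnected {s : Finset ι}
    (h : (F.induce (s : Set ι)).Preconnected) : F.Linked s := by
  rintro Y ⟨x, hxY, hxs⟩ hY y hy
  obtain ⟨p⟩ := h ⟨x, hxs⟩ ⟨y, hy⟩
  suffices H : ∀ (a b : (s : Set ι)), (F.induce (s : Set ι)).Walk a b → (a : ι) ∈ Y → (b : ι) ∈ Y from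
    H _ _ p hxY
  intro a b q
  induction q with
  | nil => exact id
  | cons hab _ ih => exact fun ha => ih (hY _ ha (by simp) _ (by simp) hab)

/-- A linked set that contains a leaf and another node contains the neighbour of the leaf. -/
theorem SimpleGraph.Linked.exists_adj {s : Finset ι} (h : F.Linked s) {i j : ι} (hi : i ∈ s)
    (hj : j ∈ s) (hij : i ≠ j) : ∃ p ∈ s, F.Adj i p := by
  by_contra! hp
  have := h {i} ⟨i, by simp, hi⟩ (by
    intro x hx _ y hy hxy
    rw [Finset.mem_singleton] at hx
    subst hx
    exact absurd hxy (hp y hy)) hj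
  exact hij (Finset.mem_singleton.1 this).symm

variable [DecidableEq ι]

/-- Removing a leaf keeps a set of nodes linked. -/
theorem SimpleGraph.Linked.erase {s : Finset ι} (h : F.Linked s) {i : ι}
    (hi : ∀ j ∈ s, ∀ k ∈ s, F.Adj i j → F.Adj i k → j = k) : F.Linked (s.erase i) := by
  rintro Y ⟨x, hxY, hxs⟩ hY
  rw [Finset.mem_erase] at hxs
  -- To use linkedness of `s`, the leaf `i` is put into the test set if its neighbour is there, and
  -- taken out otherwise.
  by_cases hp : ∃ p ∈ Y, p ∈ s.erase i ∧ F.Adj i p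
  · obtain ⟨p, hpY, hps, hip⟩ := hp
    have hps' := Finset.mem_of_mem_erase hps
    have := h (insert i Y) ⟨x, Finset.mem_insert_of_mem hxY, hxs.2⟩ (by
      intro a ha has b hb hab
      rw [Finset.mem_insert] at ha ⊢
      by_cases hbi : b = i
      · exact .inl hbi
      right
      by_cases hai : a = i
      · subst hai
        exact hi p hps' b hb hip hab ▸ hpY
      · exact hY a (ha.resolve_left hai) (Finset.mem_erase.2 ⟨hai, has⟩) b
          (Finset.mem_erase.2 ⟨hbi, hb⟩) hab)
    intro y hy
    rw [Finset.mem_erase] at hy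
    exact (Finset.mem_insert.1 (this hy.2)).resolve_left hy.1
  · push Not at hp
    have := h (Y.erase i) ⟨x, Finset.mem_erase.2 ⟨hxs.1, hxY⟩, hxs.2⟩ (by
      intro a ha has b hb hab
      rw [Finset.mem_erase] at ha
      have has' := Finset.mem_erase.2 ⟨ha.1, has⟩
      have hbi : b ≠ i := by
        rintro rfl
        exact hp a ha.2 has' hab.symm
      exact Finset.mem_erase.2 ⟨hbi, hY a ha.2 has' b (Finset.mem_erase.2 ⟨hbi, hb⟩) hab⟩)
    intro y hy
    exact Finset.mem_of_mem_erase (this (Finset.mem_of_mem_erase hy))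

end Forests

/-! ### Removing few vertices of a graph of small treewidth -/

section Pieces

variable {V : Type*} [Fintype V] (G : SimpleGraph V)

/-- `v` lies in a part of `U` of size at most `K + w` with small boundary, which lies in `Z`. -/
def Finished (K w : ℕ) (Z U : Finset V) (v : V) : Prop :=
  ∃ S : Finset V, v ∈ S ∧ S ⊆ U ∧ G.outer S ⊆ Z ∧ (G.outer S).card ≤ 2 * w ∧ S.card ≤ K + w

variable {G}

theorem Finished.mono {K w : ℕ} {Z U Z' U' : Finset V} {v : V} (h : Finished G K w Z U v)
    (hZ : Z ⊆ Z') (hU : U ⊆ U') : Finished G K w Z' U' v := by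
  obtain ⟨S, h1, h2, h3, h4⟩ := h
  exact ⟨S, h1, h2.trans hU, h3.trans hZ, h4⟩

/-- The decomposition with a single bag shows that the infimum defining the treewidth is attained.
The truncated subtraction in the width only affects empty bags. -/
theorem exists_treeDecomposition_card_bag_le {h : ℕ} (hG : treewidth G ≤ h) :
    ∃ D : TreeDecomposition G, ∀ i, (D.bag i).card ≤ h + 1 := by
  have hne : {w | ∃ D : TreeDecomposition G, D.width = w}.Nonempty :=
    ⟨_, { size := 1
          forest := ⊥
          acyclic := SimpleGraph.isAcyclic_bot
          bag := fun _ => Finset.univ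
          covers_vertex := fun v => ⟨0, by simp⟩
          covers_edge := fun u v _ => ⟨0, by simp⟩
          connected := fun v => by
            intro a b
            rw [Subsingleton.elim a b] }, rfl⟩
  obtain ⟨D, hD⟩ := Nat.sInf_mem hne
  refine ⟨D, fun i => ?_⟩
  have h1 : D.width ≤ h := hD.trans_le hG
  have h2 : (D.bag i).card ≤ Finset.univ.sup fun i => (D.bag i).card :=
    Finset.le_sup (f := fun i => (D.bag i).card) (Finset.mem_univ i)
  unfold TreeDecomposition.width at h1
  omega

variable (G) [DecidableEq V]

/-- A partial solution for the part `W` of the graph that hangs below the bag `B`: the vertices in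
`Z` have been removed, those in `O` may still be connected with `B`, and `L` is the last removed
bag below `O`. -/
structure Piece (K w : ℕ) (W B : Finset V) where
  Z : Finset V
  O : Finset V
  L : Finset V
  -- `β` is `1` if the piece holds an unspent credit worth `w` removals, which it must once `L` is
  -- nonempty. In `cost` every vertex that is neither open nor in the bag pays for `2 * w / K`
  -- removals, and the credit counts as already paid.
  β : ℕ
  bag_subset : B ⊆ W
  card_bag : B.card ≤ w
  Z_subset : Z ⊆ W
  O_subset : O ⊆ W
  disj : Disjoint Z O
  bag_cover : B ⊆ Z ∪ O
  outer_O : ∀ u ∈ O, ∀ v ∈ W, G.Adj u v → v ∈ O ∨ v ∈ L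
  L_subset : L ⊆ Z
  card_L : L.card ≤ w
  L_empty : β = 0 → L = ∅
  bag_Z : ∀ v ∈ B, v ∈ Z → v ∈ L
  card_O : (O \ B).card < K
  β_le : β ≤ 1
  fin : ∀ v ∈ W, v ∉ Z → v ∉ O → Finished G K w Z (W \ (Z ∪ O)) v
  cost : K * (Z.card + β * w) ≤ 2 * w * ((W \ B) \ O).card

variable {G}

/-- The piece that consists of a single bag. -/
def Piece.single (K w : ℕ) (B : Finset V) (hB : B.card ≤ w) (hK : 0 < K) : Piece G K w B B where
  Z := ∅
  O := B
  L := ∅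
  β := 0
  bag_subset := subset_rfl
  card_bag := hB
  Z_subset := by simp
  O_subset := subset_rfl
  disj := by simp
  bag_cover := by simp
  outer_O := fun u _ v hv _ => .inl hv
  L_subset := by simp
  card_L := by simp
  L_empty := by simp
  bag_Z := by simp
  card_O := by simpa
  β_le := by simp
  fin := fun v hv _ h => absurd hv h
  cost := by simp

/-- Two pieces that overlap in their bags only and have no edges between them. -/
theorem Piece.join {K w : ℕ} {W₁ B₁ W₂ B₂ : Finset V} (P₁ : Piece G K w W₁ B₁)
    (P₂ : Piece G K w W₂ B₂) (hW : ∀ v ∈ W₁, v ∈ W₂ → v ∈ B₁ ∧ v ∈ B₂)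
    (h₁ : ∀ u ∈ W₁, u ∉ B₂ → ∀ v, G.Adj u v → v ∈ W₁)
    (h₂ : ∀ u ∈ W₂, u ∉ B₂ → ∀ v, G.Adj u v → v ∈ W₂)
    (h₁₂ : ∀ u ∈ W₁, ∀ v ∈ W₂, G.Adj u v → u ∈ W₂ ∨ v ∈ W₁) :
    Nonempty (Piece G K w (W₁ ∪ W₂) B₂) := by
  obtain ⟨Z₁, O₁, L₁, β₁, hB₁, hBc₁, hZ₁, hO₁, hd₁, hcov₁, hout₁, hL₁, hLc₁, hLe₁, hBZ₁, hOc₁, hβ₁,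
    hfin₁, hcost₁⟩ := P₁
  obtain ⟨Z₂, O₂, L₂, β₂, hB₂, hBc₂, hZ₂, hO₂, hd₂, hcov₂, hout₂, hL₂, hLc₂, hLe₂, hBZ₂, hOc₂, hβ₂,
    hfin₂, hcost₂⟩ := P₂
  simp only [Finset.subset_iff, Finset.disjoint_left, Finset.mem_union] at hB₁ hB₂ hZ₁ hZ₂ hO₁ hO₂ hd₁ hd₂ hcov₁ hcov₂ hL₁ hL₂
  have hfin₁' : ∀ v ∈ W₁, v ∉ Z₁ → v ∉ O₁ → ∃ S : Finset V, v ∈ S ∧ (∀ x ∈ S, x ∈ W₁ ∧ x ∉ Z₁ ∧ x ∉ O₁ ∧ x ∉ W₂) ∧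
      (∀ x ∈ G.outer S, x ∈ Z₁) ∧ (G.outer S).card ≤ 2 * w ∧ S.card ≤ K + w := by
    intro v h1 h2 h3
    obtain ⟨S, h4, h5, h6, h7, h8⟩ := hfin₁ v h1 h2 h3
    refine ⟨S, h4, fun x hx => ?_, fun x hx => h6 hx, h7, h8⟩
    have := h5 hx
    grind
  have hfin₂' : ∀ v ∈ W₂, v ∉ Z₂ → v ∉ O₂ → ∃ S : Finset V, v ∈ S ∧ (∀ x ∈ S, x ∈ W₂ ∧ x ∉ Z₂ ∧ x ∉ O₂ ∧ x ∉ W₁) ∧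
      (∀ x ∈ G.outer S, x ∈ Z₂) ∧ (G.outer S).card ≤ 2 * w ∧ S.card ≤ K + w := by
    intro v h1 h2 h3
    obtain ⟨S, h4, h5, h6, h7, h8⟩ := hfin₂ v h1 h2 h3
    refine ⟨S, h4, fun x hx => ?_, fun x hx => h6 hx, h7, h8⟩
    have := h5 hx
    grind
  -- The bag `B₂` is removed when the open part outside it has reached size `K`, or when both sides
  -- have a removed bag below, since otherwise the new open part could have two such bags in its
  -- boundary.
  by_cases hmark : K ≤ (((O₁ ∪ O₂) \ (Z₁ ∪ Z₂)) \ B₂).card ∨ (β₁ = 1 ∧ β₂ = 1)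
  · have hcard : (((W₁ \ B₁) \ O₁).card + ((W₂ \ B₂) \ O₂).card +
        (((O₁ ∪ O₂) \ (Z₁ ∪ Z₂)) \ B₂).card) ≤ ((W₁ ∪ W₂) \ B₂).card := by
      rw [← Finset.card_union_of_disjoint, ← Finset.card_union_of_disjoint]
      · apply Finset.card_le_card
        intro x
        simp only [Finset.mem_union, Finset.mem_sdiff]
        grind
      · rw [Finset.disjoint_left]
        intro x
        simp only [Finset.mem_union, Finset.mem_sdiff]
        grind
      · rw [Finset.disjoint_left]
        intro x
        simp only [Finset.mem_sdiff]
        grind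
    refine ⟨⟨Z₁ ∪ Z₂ ∪ B₂, ∅, B₂, 1, Finset.subset_iff.2 (by grind), hBc₂, Finset.subset_iff.2 (by grind), by simp, by simp,
      Finset.subset_iff.2 (by grind), by simp, Finset.subset_iff.2 (by grind), hBc₂, by simp, fun v hv _ => hv, ?_, le_rfl, ?_, ?_⟩⟩
    · simp; omega
    · intro v hv hvZ _
      have hS : (v ∈ W₁ ∧ v ∉ Z₁ ∧ v ∉ O₁) ∨ (v ∈ W₂ ∧ v ∉ Z₂ ∧ v ∉ O₂) ∨ v ∈ O₁ \ B₂ ∨ v ∈ O₂ \ B₂ := by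
        grind
      rcases hS with ⟨h1, h2, h3⟩ | ⟨h1, h2, h3⟩ | h | h
      · obtain ⟨S, h4, h5, h6, h7, h8⟩ := hfin₁' v h1 h2 h3
        exact ⟨S, h4, Finset.subset_iff.2 (by grind), Finset.subset_iff.2 (by grind), h7, h8⟩
      · obtain ⟨S, h4, h5, h6, h7, h8⟩ := hfin₂' v h1 h2 h3
        exact ⟨S, h4, Finset.subset_iff.2 (by grind), Finset.subset_iff.2 (by grind), h7, h8⟩
      · have hsub : ∀ x ∈ G.outer (O₁ \ B₂), x ∈ L₁ ∪ B₂ := by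
          intro x hx
          obtain ⟨hx, u, hu, hux⟩ := G.mem_outer.1 hx
          have := h₁ u (by grind) (by grind) x hux
          have := hout₁ u (by grind) x this hux
          grind
        refine ⟨_, h, Finset.subset_iff.2 (by grind), Finset.subset_iff.2 (by grind), ?_, ?_⟩
        · have := Finset.card_le_card hsub
          have := Finset.card_union_le L₁ B₂
          omega
        · have : O₁ \ B₂ ⊆ (O₁ \ B₁) ∪ B₁ := Finset.subset_iff.2 (by grind)
          have := Finset.card_le_card this
          have := Finset.card_union_le (O₁ \ B₁) B₁
          omega
      · have hsub : ∀ x ∈ G.outer (O₂ \ B₂), x ∈ L₂ ∪ B₂ := by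
          intro x hx
          obtain ⟨hx, u, hu, hux⟩ := G.mem_outer.1 hx
          have := h₂ u (by grind) (by grind) x hux
          have := hout₂ u (by grind) x this hux
          grind
        refine ⟨_, h, Finset.subset_iff.2 (by grind), Finset.subset_iff.2 (by grind), ?_, ?_⟩
        · have := Finset.card_le_card hsub
          have := Finset.card_union_le L₂ B₂
          omega
        · omega
    · have hZc : (Z₁ ∪ Z₂ ∪ B₂).card ≤ Z₁.card + Z₂.card + w := by
        have := Finset.card_union_le (Z₁ ∪ Z₂) B₂
        have := Finset.card_union_le Z₁ Z₂
        omega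
      rw [Finset.sdiff_empty]
      refine le_trans ?_ (Nat.mul_le_mul_left (2 * w) hcard)
      have h5 : K * ((Z₁ ∪ Z₂ ∪ B₂).card + 1 * w) ≤ K * (Z₁.card + Z₂.card + w + w) :=
        Nat.mul_le_mul_left _ (by omega)
      -- Removing the bag and opening a new credit costs `2 * w`. Either at least `K` vertices that
      -- cease to be open pay for it, or the two old credits do.
      rcases hmark with hm | ⟨rfl, rfl⟩
      · have := Nat.mul_le_mul_left (2 * w) hm
        nlinarith [Nat.zero_le (K * (β₁ * w)), Nat.zero_le (K * (β₂ * w))]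
      · nlinarith [Nat.zero_le (2 * w * (((O₁ ∪ O₂) \ (Z₁ ∪ Z₂)) \ B₂).card)]
  · push Not at hmark
    obtain ⟨hK, hβ⟩ := hmark
    have hcard : (((W₁ \ B₁) \ O₁).card + ((W₂ \ B₂) \ O₂).card) ≤
        (((W₁ ∪ W₂) \ B₂) \ ((O₁ ∪ O₂) \ (Z₁ ∪ Z₂))).card := by
      rw [← Finset.card_union_of_disjoint]
      · apply Finset.card_le_card
        intro x
        simp only [Finset.mem_union, Finset.mem_sdiff]
        grind
      · rw [Finset.disjoint_left]
        intro x
        simp only [Finset.mem_sdiff]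
        grind
    -- At most one side has a removed bag, so one of the two sets is empty.
    have hL : (L₁ ∪ L₂).card ≤ w := by
      by_cases h : β₁ = 0
      · rw [hLe₁ h, Finset.empty_union]; exact hLc₂
      · rw [hLe₂ (by omega), Finset.union_empty]; exact hLc₁
    -- A vertex of both bags may be removed on one side and open on the other; removal takes
    -- precedence.
    refine ⟨⟨Z₁ ∪ Z₂, (O₁ ∪ O₂) \ (Z₁ ∪ Z₂), L₁ ∪ L₂, β₁ + β₂, Finset.subset_iff.2 (by grind), hBc₂,
      Finset.subset_iff.2 (by grind), Finset.subset_iff.2 (by grind), Finset.disjoint_sdiff,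
      Finset.subset_iff.2 (by grind), ?_, Finset.subset_iff.2 (by grind), hL, ?_, ?_, hK, by omega, ?_, ?_⟩⟩
    · intro u hu v hv huv
      have hvu := huv.symm
      have a1 := h₁₂ u
      have a2 := h₁₂ v
      have b1 := hout₁ u
      have b2 := hout₂ u
      grind
    · intro h
      rw [hLe₁ (by omega), hLe₂ (by omega), Finset.union_empty]
    · grind
    · intro v hv hvZ hvO
      have hS : (v ∈ W₁ ∧ v ∉ Z₁ ∧ v ∉ O₁) ∨ (v ∈ W₂ ∧ v ∉ Z₂ ∧ v ∉ O₂) := by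
        grind
      rcases hS with ⟨h1, h2, h3⟩ | ⟨h1, h2, h3⟩
      · obtain ⟨S, h4, h5, h6, h7, h8⟩ := hfin₁' v h1 h2 h3
        exact ⟨S, h4, Finset.subset_iff.2 (by grind), Finset.subset_iff.2 (by grind), h7, h8⟩
      · obtain ⟨S, h4, h5, h6, h7, h8⟩ := hfin₂' v h1 h2 h3
        exact ⟨S, h4, Finset.subset_iff.2 (by grind), Finset.subset_iff.2 (by grind), h7, h8⟩
    · refine le_trans ?_ (Nat.mul_le_mul_left (2 * w) hcard)
      have := Finset.card_union_le Z₁ Z₂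
      have h5 : K * ((Z₁ ∪ Z₂).card + (β₁ + β₂) * w) ≤ K * (Z₁.card + Z₂.card + (β₁ + β₂) * w) :=
        Nat.mul_le_mul_left _ (by omega)
      calc _ ≤ _ := h5
        _ = K * (Z₁.card + β₁ * w) + K * (Z₂.card + β₂ * w) := by ring
        _ ≤ _ := by rw [Nat.mul_add (2 * w)]; exact add_le_add hcost₁ hcost₂

/-- Merging the leaves of a forest of pieces one after the other. -/
theorem exists_removal_of_pieces {ι : Type*} [DecidableEq ι] {F : SimpleGraph ι}
    (hF : F.IsAcyclic) {K w : ℕ} (B : ι → Finset V) (n : ℕ) : ∀ (N : Finset ι) (W : ι → Finset V),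
    N.card = n + 1 → (∀ i ∈ N, Nonempty (Piece G K w (W i) (B i))) →
    (∀ v, F.Linked (N.filter fun i => v ∈ B i)) →
    (∀ i ∈ N, ∀ j ∈ N, i ≠ j → ∀ v ∈ W i, v ∈ W j → v ∈ B i ∧ v ∈ B j) →
    (∀ u v, G.Adj u v → ∃ i ∈ N, u ∈ W i ∧ v ∈ W i) → (∀ v, ∃ i ∈ N, v ∈ W i) →
    ∃ Z : Finset V, K * Z.card ≤ 2 * w * Fintype.card V ∧
      ∀ v, v ∉ Z → Finished G K w Z (Finset.univ \ Z) v := by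
  induction n with
  | zero =>
    intro N W hN hP _ _ _ hV
    obtain ⟨i, rfl⟩ := Finset.card_eq_one.1 hN
    obtain ⟨P⟩ := hP i (by simp)
    have hWi : ∀ v, v ∈ W i := fun v => by simpa using hV v
    refine ⟨P.Z, ?_, fun v hv => ?_⟩
    · calc K * P.Z.card ≤ K * (P.Z.card + P.β * w) := Nat.mul_le_mul_left _ (by omega)
        _ ≤ _ := P.cost
        _ ≤ _ := Nat.mul_le_mul_left _ (Finset.card_le_univ _)
    · by_cases hO : v ∈ P.O
      · have hsub : G.outer P.O ⊆ P.L := by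
          intro x hx
          obtain ⟨hx, u, hu, hux⟩ := G.mem_outer.1 hx
          exact (P.outer_O u hu x (hWi x) hux).resolve_left hx
        refine ⟨P.O, hO, ?_, hsub.trans P.L_subset, ?_, ?_⟩
        · intro x hx
          simpa using Finset.disjoint_right.1 P.disj hx
        · have := Finset.card_le_card hsub
          have := P.card_L
          omega
        · have h1 := P.card_O
          have h2 := Finset.card_le_card (show P.O ⊆ (P.O \ B i) ∪ B i by
            intro x hx; by_cases h : x ∈ B i <;> simp [hx, h])
          have h3 := Finset.card_union_le (P.O \ B i) (B i)
          have := P.card_bag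
          omega
      · exact (P.fin v (hWi v) hv hO).mono subset_rfl (by
          intro x; simp only [Finset.mem_sdiff, Finset.mem_univ, Finset.mem_union]; tauto)
  | succ n ih =>
    intro N W hN hP hlink hW hE hV
    obtain ⟨i, hi, hleaf⟩ := hF.exists_leaf N (Finset.card_pos.1 (by omega))
    -- The leaf is merged into its only neighbour: by linkedness, a vertex of its bag that occurs in
    -- another remaining bag occurs in that neighbour's bag. The bag of a leaf without neighbours
    -- meets no other remaining bag, so any other node serves.
    have hp : ∃ p ∈ N, p ≠ i ∧ ∀ v ∈ B i, ∀ j ∈ N, j ≠ i → v ∈ B j → v ∈ B p := by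
      have hnb : ∀ v ∈ B i, ∀ j ∈ N, j ≠ i → v ∈ B j → ∃ p ∈ N, v ∈ B p ∧ F.Adj i p := by
        intro v hv j hj hji hvj
        obtain ⟨p, hp, hip⟩ := (hlink v).exists_adj F (Finset.mem_filter.2 ⟨hi, hv⟩)
          (Finset.mem_filter.2 ⟨hj, hvj⟩) hji.symm
        rw [Finset.mem_filter] at hp
        exact ⟨p, hp.1, hp.2, hip⟩
      by_cases h : ∃ p ∈ N, F.Adj i p
      · obtain ⟨p, hp, hip⟩ := h
        refine ⟨p, hp, hip.ne', fun v hv j hj hji hvj => ?_⟩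
        obtain ⟨p', hp', hv', hip'⟩ := hnb v hv j hj hji hvj
        rwa [hleaf p hp p' hp' hip hip']
      · obtain ⟨p, hp, hpi⟩ := Finset.exists_mem_ne (by omega : 1 < N.card) i
        refine ⟨p, hp, hpi, fun v hv j hj hji hvj => ?_⟩
        obtain ⟨p', hp', hv', hip'⟩ := hnb v hv j hj hji hvj
        exact absurd ⟨p', hp', hip'⟩ h
    obtain ⟨p, hp, hpi, hpB⟩ := hp
    obtain ⟨P₁⟩ := hP i hi
    obtain ⟨P₂⟩ := hP p hp
    have hjoin := P₁.join P₂ (hW i hi p hp hpi.symm)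
      (by
        intro u hu huB v huv
        obtain ⟨j, hj, huj, hvj⟩ := hE u v huv
        by_cases hji : j = i
        · exact hji ▸ hvj
        · obtain ⟨h1, h2⟩ := hW i hi j hj (Ne.symm hji) u hu huj
          exact absurd (hpB u h1 j hj hji h2) huB)
      (by
        intro u hu huB v huv
        obtain ⟨j, hj, huj, hvj⟩ := hE u v huv
        by_cases hjp : j = p
        · exact hjp ▸ hvj
        · exact absurd (hW p hp j hj (Ne.symm hjp) u hu huj).1 huB)
      (by
        intro u hu v hv huv
        obtain ⟨j, hj, huj, hvj⟩ := hE u v huv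
        by_cases hji : j = i
        · exact .inr (hji ▸ hvj)
        · obtain ⟨h1, h2⟩ := hW i hi j hj (Ne.symm hji) u hu huj
          exact .inl (P₂.bag_subset (hpB u h1 j hj hji h2)))
    have hmemW : ∀ j v, v ∈ Function.update W p (W i ∪ W p) j ↔ v ∈ W j ∨ (j = p ∧ v ∈ W i) := by
      intro j v
      by_cases hjp : j = p
      · subst hjp; simp [or_comm]
      · simp [hjp]
    have htrans : ∀ v, ∀ j ∈ N, v ∈ W j →
        ∃ j' ∈ N.erase i, (∀ u, u ∈ W j → u ∈ Function.update W p (W i ∪ W p) j') := by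
      intro v j hj hvj
      by_cases hji : j = i
      · exact ⟨p, by simp [hpi, hp], fun u hu => by rw [hmemW]; exact .inr ⟨rfl, hji ▸ hu⟩⟩
      · exact ⟨j, by simp [hji, hj], fun u hu => by rw [hmemW]; exact .inl hu⟩
    refine ih (N.erase i) (Function.update W p (W i ∪ W p)) (by
      rw [Finset.card_erase_of_mem hi]; omega) ?_ ?_ ?_ ?_ ?_
    · intro j hj
      rw [Finset.mem_erase] at hj
      by_cases hjp : j = p
      · subst hjp; simpa using hjoin
      · simpa [hjp] using hP j hj.2
    · intro v
      rw [Finset.filter_erase]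
      refine (hlink v).erase F fun j hj k hk => ?_
      rw [Finset.mem_filter] at hj hk
      exact hleaf j hj.1 k hk.1
    · intro j hj k hk hjk v hvj hvk
      rw [Finset.mem_erase] at hj hk
      rw [hmemW] at hvj hvk
      rcases hvj with hvj | ⟨rfl, hvj⟩ <;> rcases hvk with hvk | ⟨hkp, hvk⟩
      · exact hW j hj.2 k hk.2 hjk v hvj hvk
      · subst hkp
        obtain ⟨h1, h2⟩ := hW j hj.2 i hi hj.1 v hvj hvk
        exact ⟨h1, hpB v h2 j hj.2 hj.1 h1⟩
      · obtain ⟨h1, h2⟩ := hW i hi k hk.2 hk.1.symm v hvj hvk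
        exact ⟨hpB v h1 k hk.2 hk.1 h2, h2⟩
      · exact absurd hkp.symm hjk
    · intro u v huv
      obtain ⟨j, hj, huj, hvj⟩ := hE u v huv
      obtain ⟨j', hj', h⟩ := htrans u j hj huj
      exact ⟨j', hj', h u huj, h v hvj⟩
    · intro v
      obtain ⟨j, hj, hvj⟩ := hV v
      obtain ⟨j', hj', h⟩ := htrans v j hj hvj
      exact ⟨j', hj', h v hvj⟩

/-- In a graph of treewidth at most `h` one can remove few vertices such that all components of
the rest are small and have few neighbours. -/
theorem exists_removal_of_treewidth_le {h K : ℕ} (hG : treewidth G ≤ h) (hK : 0 < K) :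
    ∃ Z : Finset V, K * Z.card ≤ 2 * (h + 1) * Fintype.card V ∧
      ∀ v, v ∉ Z → Finished G K (h + 1) Z (Finset.univ \ Z) v := by
  obtain ⟨D, hD⟩ := exists_treeDecomposition_card_bag_le hG
  rcases Nat.eq_zero_or_pos D.size with h0 | h0
  · have : IsEmpty (Fin D.size) := by rw [h0]; infer_instance
    exact ⟨∅, by simp, fun v => (this.false (D.covers_vertex v).choose).elim⟩
  · refine exists_removal_of_pieces D.acyclic D.bag (D.size - 1) Finset.univ D.bag ?_ ?_ ?_ ?_ ?_ ?_
    · simp; omega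
    · exact fun i _ => ⟨Piece.single K (h + 1) _ (hD i) hK⟩
    · intro v
      apply SimpleGraph.Linked.of_preconnected
      have := D.connected v
      convert this using 2 <;> simp
    · exact fun i _ j _ _ v h1 h2 => ⟨h1, h2⟩
    · intro u v huv
      simpa using D.covers_edge u v huv
    · intro v
      simpa using D.covers_vertex v

end Pieces

/-! ### Components with few leaving edges -/

section Components

variable {V : Type*} [Fintype V] (G : SimpleGraph V)

/-- The number of edges that leave `S`. -/
noncomputable def SimpleGraph.cutSize (S : Finset V) : ℕ := by
  classical exact ∑ u ∈ S, (Finset.univ.filter fun v => G.Adj u v ∧ v ∉ S).card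

/-- The vertices that can be reached from `v` outside `Z`. -/
noncomputable def SimpleGraph.compAvoiding (Z : Finset V) (v : V) : Finset V := by
  classical exact Finset.univ.filter fun u =>
    Relation.ReflTransGen (fun x y => G.Adj x y ∧ x ∉ Z ∧ y ∉ Z) v u

theorem SimpleGraph.mem_compAvoiding {Z : Finset V} {v u : V} :
    u ∈ G.compAvoiding Z v ↔
      Relation.ReflTransGen (fun x y => G.Adj x y ∧ x ∉ Z ∧ y ∉ Z) v u := by
  classical simp [SimpleGraph.compAvoiding]

theorem SimpleGraph.self_mem_compAvoiding (Z : Finset V) (v : V) : v ∈ G.compAvoiding Z v :=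
  G.mem_compAvoiding.2 .refl

theorem SimpleGraph.compAvoiding_eq {Z : Finset V} {v u : V} (h : u ∈ G.compAvoiding Z v) :
    G.compAvoiding Z u = G.compAvoiding Z v := by
  have hs : Std.Symm fun x y => G.Adj x y ∧ x ∉ Z ∧ y ∉ Z :=
    ⟨fun x y h => ⟨h.1.symm, h.2.2, h.2.1⟩⟩
  rw [mem_compAvoiding] at h
  ext x
  rw [mem_compAvoiding, mem_compAvoiding]
  exact ⟨fun h' => h.trans h', fun h' => (Relation.ReflTransGen.stdSymm.symm _ _ h).trans h'⟩

theorem SimpleGraph.mem_compAvoiding_comm {Z : Finset V} {v u : V} :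
    u ∈ G.compAvoiding Z v ↔ v ∈ G.compAvoiding Z u :=
  ⟨fun h => G.compAvoiding_eq h ▸ G.self_mem_compAvoiding Z v,
    fun h => G.compAvoiding_eq h ▸ G.self_mem_compAvoiding Z u⟩

theorem SimpleGraph.notMem_of_mem_compAvoiding {Z : Finset V} {v u : V} (hv : v ∉ Z)
    (h : u ∈ G.compAvoiding Z v) : u ∉ Z := by
  rw [mem_compAvoiding] at h
  rcases Relation.ReflTransGen.cases_tail h with rfl | ⟨w, -, hw⟩
  · exact hv
  · exact hw.2.2

theorem SimpleGraph.mem_compAvoiding_of_adj {Z : Finset V} {v u x : V} (hv : v ∉ Z)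
    (h : u ∈ G.compAvoiding Z v) (hux : G.Adj u x) (hx : x ∉ Z) : x ∈ G.compAvoiding Z v :=
  G.mem_compAvoiding.2 ((G.mem_compAvoiding.1 h).tail ⟨hux, G.notMem_of_mem_compAvoiding hv h, hx⟩)

theorem SimpleGraph.linked_compAvoiding {Z : Finset V} {v : V} (hv : v ∉ Z) :
    G.Linked (G.compAvoiding Z v) := by
  rintro Y ⟨x, hxY, hx⟩ hY y hy
  rw [← G.compAvoiding_eq hx, mem_compAvoiding] at hy
  have hxZ := G.notMem_of_mem_compAvoiding hv hx
  suffices H : y ∈ Y ∧ y ∈ G.compAvoiding Z v from H.1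
  induction hy with
  | refl => exact ⟨hxY, hx⟩
  | tail _ hbc ih =>
    have := G.mem_compAvoiding_of_adj hv ih.2 hbc.1 hbc.2.2
    exact ⟨hY _ ih.1 ih.2 _ this hbc.1, this⟩

variable [DecidableEq V] {G}

/-- All neighbours of the witness lie in `Z`, so a walk that avoids `Z` cannot leave it, and the
component inherits its size bound. A neighbour of the component lies in `Z`, hence outside the
witness, and is thus a neighbour of the witness too. -/
theorem Finished.compAvoiding {K w : ℕ} {Z : Finset V} {v : V} (hv : v ∉ Z)
    (h : Finished G K w Z (Finset.univ \ Z) v) :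
    (G.outer (G.compAvoiding Z v)).card ≤ 2 * w ∧ (G.compAvoiding Z v).card ≤ K + w := by
  obtain ⟨S, hvS, hSZ, hoZ, ho, hS⟩ := h
  have hsub : G.compAvoiding Z v ⊆ S := by
    intro y hy
    rw [SimpleGraph.mem_compAvoiding] at hy
    induction hy with
    | refl => exact hvS
    | tail _ hbc ih =>
      by_contra hc
      exact hbc.2.2 (hoZ (G.mem_outer.2 ⟨hc, _, ih, hbc.1⟩))
  refine ⟨(Finset.card_le_card ?_).trans ho, (Finset.card_le_card hsub).trans hS⟩
  intro x hx
  obtain ⟨hx, u, hu, hux⟩ := G.mem_outer.1 hx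
  have hxZ : x ∈ Z := by
    by_contra hxZ
    exact hx (G.mem_compAvoiding_of_adj hv hu hux hxZ)
  refine G.mem_outer.2 ⟨fun h => ?_, u, hsub hu, hux⟩
  have := hSZ h
  simp [hxZ] at this

open Classical in
/-- In a graph of treewidth at most `h` almost all vertices lie in small linked sets with few
neighbours and few edges leaving them. -/
theorem exists_isolated_of_treewidth_le {h K d : ℕ} (D : ℕ) (hG : treewidth G ≤ h) (hK : 0 < K)
    (hd : ∀ u, (Finset.univ.filter fun v => G.Adj u v).card ≤ d) :
    ∃ Bad : Finset V, K * Bad.card ≤ (1 + D * d) * (2 * (h + 1) * Fintype.card V) ∧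
      ∀ v, v ∉ Bad → ∃ S : Finset V, v ∈ S ∧ G.Linked S ∧ (G.outer S).card ≤ 2 * (h + 1) ∧
        S.card ≤ K + (h + 1) ∧ D * G.cutSize S < S.card := by
  obtain ⟨Z, hZ, hfin⟩ := exists_removal_of_treewidth_le hG hK
  set C := G.compAvoiding Z with hC
  set B := Finset.univ.filter fun v => v ∉ Z ∧ (C v).card ≤ D * G.cutSize (C v) with hB
  have hCpos : ∀ v, (0 : ℝ) < (C v).card := fun v => by
    exact_mod_cast Finset.card_pos.2 ⟨v, G.self_mem_compAvoiding Z v⟩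
  let e : V → ℕ := fun u => (Finset.univ.filter fun v => G.Adj u v ∧ v ∈ Z).card
  have hcut : ∀ v, v ∉ Z → G.cutSize (C v) = ∑ u ∈ C v, e u := by
    intro v hv
    unfold SimpleGraph.cutSize
    refine Finset.sum_congr rfl fun u hu => ?_
    congr 1
    ext x
    simp only [Finset.mem_filter, Finset.mem_univ, true_and]
    refine and_congr_right fun hux => ⟨fun h => ?_, fun h h' => ?_⟩
    · by_contra hx
      exact h (G.mem_compAvoiding_of_adj hv hu hux hx)
    · exact G.notMem_of_mem_compAvoiding hv h' h
  have hsum : ∑ u ∈ Finset.univ \ Z, e u ≤ d * Z.card := by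
    calc ∑ u ∈ Finset.univ \ Z, e u ≤ ∑ u, e u :=
          Finset.sum_le_sum_of_subset (Finset.sdiff_subset)
      _ = ∑ u, ∑ z ∈ Z, if G.Adj u z then 1 else 0 := by
          refine Finset.sum_congr rfl fun u _ => ?_
          rw [← Finset.card_filter]
          refine congrArg Finset.card (Finset.ext fun x => ?_)
          simp [and_comm]
      _ = ∑ z ∈ Z, ∑ u, if G.Adj u z then 1 else 0 := Finset.sum_comm
      _ ≤ ∑ z ∈ Z, d := by
          refine Finset.sum_le_sum fun z _ => ?_
          rw [← Finset.card_filter]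
          simpa [G.adj_comm] using hd z
      _ = d * Z.card := by simp [mul_comm]
  -- Every vertex of `B` has a share of at least one when `D` times the number of edges leaving its
  -- component is divided evenly among the vertices of the component. All these edges end in `Z`, so
  -- there are at most `d * Z.card` of them in total.
  have hBcard : B.card ≤ D * (d * Z.card) := by
    have h1 : (B.card : ℝ) ≤ ∑ v ∈ Finset.univ \ Z, (D * G.cutSize (C v) : ℝ) / (C v).card := by
      calc (B.card : ℝ) = ∑ v ∈ B, (1 : ℝ) := by simp
        _ ≤ ∑ v ∈ B, (D * G.cutSize (C v) : ℝ) / (C v).card := by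
            refine Finset.sum_le_sum fun v hv => ?_
            rw [hB, Finset.mem_filter] at hv
            rw [le_div_iff₀ (hCpos v), one_mul]
            exact_mod_cast hv.2.2
        _ ≤ _ := by
            refine Finset.sum_le_sum_of_subset_of_nonneg ?_ fun v _ _ => by positivity
            intro v hv
            rw [hB, Finset.mem_filter] at hv
            simp [hv.2.1]
    have h2 : ∑ v ∈ Finset.univ \ Z, (D * G.cutSize (C v) : ℝ) / (C v).card =
        D * ∑ u ∈ Finset.univ \ Z, (e u : ℝ) := by
      calc _ = ∑ v ∈ Finset.univ \ Z, ∑ u ∈ C v, (D * e u : ℝ) / (C v).card := by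
            refine Finset.sum_congr rfl fun v hv => ?_
            rw [hcut v (by simpa using hv)]
            push_cast
            rw [Finset.mul_sum, Finset.sum_div]
        _ = ∑ u ∈ Finset.univ \ Z, ∑ v ∈ C u, (D * e u : ℝ) / (C v).card := by
            refine Finset.sum_comm' fun v u => ?_
            simp only [Finset.mem_sdiff, Finset.mem_univ, true_and]
            constructor
            · rintro ⟨hv, hu⟩
              exact ⟨G.mem_compAvoiding_comm.1 hu, G.notMem_of_mem_compAvoiding hv hu⟩
            · rintro ⟨hv, hu⟩
              exact ⟨G.notMem_of_mem_compAvoiding hu hv, G.mem_compAvoiding_comm.1 hv⟩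
        _ = ∑ u ∈ Finset.univ \ Z, (D * e u : ℝ) := by
            refine Finset.sum_congr rfl fun u _ => ?_
            rw [Finset.sum_congr rfl fun v hv => by rw [hC, G.compAvoiding_eq hv]]
            rw [Finset.sum_const, nsmul_eq_mul, ← hC, mul_div_cancel₀ _ (hCpos u).ne']
        _ = _ := by rw [Finset.mul_sum]
    rw [h2] at h1
    calc B.card ≤ D * ∑ u ∈ Finset.univ \ Z, e u := by exact_mod_cast h1
      _ ≤ _ := Nat.mul_le_mul_left _ hsum
  refine ⟨Z ∪ B, ?_, fun v hv => ?_⟩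
  · calc K * (Z ∪ B).card ≤ K * (Z.card + D * (d * Z.card)) :=
          Nat.mul_le_mul_left _ ((Finset.card_union_le _ _).trans (by omega))
      _ = (1 + D * d) * (K * Z.card) := by ring
      _ ≤ _ := Nat.mul_le_mul_left _ hZ
  · simp only [hB, Finset.mem_union, Finset.mem_filter, Finset.mem_univ, true_and, not_or,
      not_and, not_le] at hv
    obtain ⟨h1, h2⟩ := (hfin v hv.1).compAvoiding hv.1
    exact ⟨C v, G.self_mem_compAvoiding Z v, G.linked_compAvoiding hv.1, h1, h2, hv.2 hv.1⟩

end Components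

/-! ### Charging the leaving edges -/

section Charging

/-- A relation with bounded out-degrees has a large independent set. -/
theorem exists_independent {ι : Type*} [DecidableEq ι] (r : ι → ι → Prop) [DecidableRel r] (X : ℕ)
    (J : Finset ι) (hJ : ∀ j ∈ J, (J.filter fun i => i ≠ j ∧ r j i).card ≤ X) :
    ∃ I ⊆ J, (∀ i ∈ I, ∀ j ∈ I, i ≠ j → ¬ r i j) ∧ J.card ≤ (2 * X + 1) * I.card := by
  induction J using Finset.strongInduction with
  | H J ih =>
    rcases J.eq_empty_or_nonempty with rfl | hne
    · exact ⟨∅, by simp⟩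
    -- In-degrees and out-degrees have the same sum, so some in-degree is at most `X`. The element
    -- found conflicts with at most `2 * X` others, and the greedy choice removes only these.
    obtain ⟨j, hj, hin⟩ : ∃ j ∈ J, (J.filter fun i => i ≠ j ∧ r i j).card ≤ X := by
      by_contra! h
      have h1 : ∑ j ∈ J, (J.filter fun i => i ≠ j ∧ r i j).card =
          ∑ j ∈ J, (J.filter fun i => i ≠ j ∧ r j i).card := by
        simp only [Finset.card_filter]
        rw [Finset.sum_comm]
        simp only [ne_comm]
      have h2 := Finset.sum_lt_sum_of_nonempty hne h
      have h3 := Finset.sum_le_sum hJ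
      omega
    set A := J.filter fun i => i ≠ j ∧ r i j with hA
    set B := J.filter fun i => i ≠ j ∧ r j i with hB
    set J' := J.filter fun i => i ≠ j ∧ ¬ r i j ∧ ¬ r j i with hJ'
    have hss : J' ⊂ J := by
      refine (Finset.ssubset_iff_of_subset (Finset.filter_subset _ _)).2 ⟨j, hj, by simp⟩
    obtain ⟨I, hI, hind, hcard⟩ := ih J' hss fun i hi =>
      (Finset.card_le_card (Finset.filter_subset_filter _ hss.1)).trans (hJ i (hss.1 hi))
    have hjI : j ∉ I := fun h => by simpa [hJ'] using hI h
    have hmem : ∀ i ∈ I, i ≠ j ∧ ¬ r i j ∧ ¬ r j i := fun i hi => (Finset.mem_filter.1 (hI hi)).2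
    refine ⟨insert j I, Finset.insert_subset hj (hI.trans hss.1), ?_, ?_⟩
    · intro a ha b hb hab
      rcases Finset.mem_insert.1 ha with haj | ha' <;> rcases Finset.mem_insert.1 hb with hbj | hb'
      · exact absurd (haj.trans hbj.symm) hab
      · exact haj ▸ (hmem b hb').2.2
      · exact hbj ▸ (hmem a ha').2.1
      · exact hind a ha' b hb' hab
    · have hsub : J ⊆ insert j ((A ∪ B) ∪ J') := by
        intro i hi
        simp only [hA, hB, hJ', Finset.mem_insert, Finset.mem_union, Finset.mem_filter, hi, true_and]
        tauto
      have h1 := Finset.card_le_card hsub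
      have h2 := Finset.card_insert_le j ((A ∪ B) ∪ J')
      have h3 := Finset.card_union_le (A ∪ B) J'
      have h4 := Finset.card_union_le A B
      have h5 : B.card ≤ X := hJ j hj
      rw [Finset.card_insert_of_notMem hjI, Nat.mul_succ]
      omega

variable {V : Type*} [Fintype V] [DecidableEq V] {G : SimpleGraph V}

/-- The vertices whose set contains `a`. -/
def coveredBy (S : V → Finset V) (a : V) : Finset V := Finset.univ.filter fun v => a ∈ S v

theorem mem_coveredBy {S : V → Finset V} {a v : V} : v ∈ coveredBy S a ↔ a ∈ S v := by
  simp [coveredBy]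

/-- Let `v` point to `v'` if `a v ∈ S v'`. Each out-degree is less than `X`, since `v` itself is
among the vertices covering `a v`. An independent set for this relation is a family of sets through
`w` that isolate the vertices `a v` from each other, so anti-isolation bounds it. -/
theorem card_filter_coveredBy_le {S : V → Finset V} {T : Finset V} {t X : ℕ}
    (hS : ∀ v ∈ T, G.Linked (S v) ∧ (G.outer (S v)).card ≤ t)
    (a : V → V) (ha : ∀ v ∈ T, a v ∈ S v) (w : V) :
    (T.filter fun v => w ∈ S v ∧ (coveredBy S (a v)).card ≤ X).card ≤ 2 * X * 4 ^ (t + 1) := by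
  set J := T.filter fun v => w ∈ S v ∧ (coveredBy S (a v)).card ≤ X with hJ
  have hJT : ∀ v ∈ J, v ∈ T ∧ w ∈ S v ∧ (coveredBy S (a v)).card ≤ X := fun v hv => by
    simpa [hJ] using hv
  rcases J.eq_empty_or_nonempty with h0 | ⟨v₀, hv₀⟩
  · simp [h0]
  have hX : 0 < X := (Finset.card_pos.2 ⟨v₀, mem_coveredBy.2 (ha v₀ (hJT v₀ hv₀).1)⟩).trans_le
    (hJT v₀ hv₀).2.2
  obtain ⟨I, hIJ, hind, hcard⟩ := exists_independent (fun v v' => a v ∈ S v') (X - 1) J (by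
    intro j hj
    have h1 : (J.filter fun i => i ≠ j ∧ a j ∈ S i) ⊆ (coveredBy S (a j)).erase j := by
      intro i hi
      simp only [Finset.mem_filter] at hi
      exact Finset.mem_erase.2 ⟨hi.2.1, mem_coveredBy.2 hi.2.2⟩
    have h2 := Finset.card_le_card h1
    rw [Finset.card_erase_of_mem (mem_coveredBy.2 (ha j (hJT j hj).1))] at h2
    have := (hJT j hj).2.2
    omega)
  have hI := G.card_lt_of_isolating t I w S a (fun j hj => (hJT j (hIJ hj)).2.1)
    (fun j hj => (hS j (hJT j (hIJ hj)).1).1) (fun j hj => (hS j (hJT j (hIJ hj)).1).2)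
    (fun j hj => ha j (hJT j (hIJ hj)).1) hind
  calc J.card ≤ (2 * (X - 1) + 1) * I.card := hcard
    _ ≤ 2 * X * 4 ^ (t + 1) := Nat.mul_le_mul (by omega) hI.le

/-- Dyadic decomposition by the cover number of `a v`. The class of level `i` has at most `2 * 2 ^
(i + 1) * 4 ^ (t + 1)` members and each contributes at most `1 / 2 ^ i`, so all `Nat.log 2 M + 1`
levels have the same bound. -/
theorem sum_inv_card_coveredBy_le {S : V → Finset V} {T : Finset V} {t M : ℕ}
    (hS : ∀ v ∈ T, G.Linked (S v) ∧ (G.outer (S v)).card ≤ t)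
    (hM : ∀ u, (coveredBy S u).card ≤ M)
    (a : V → V) (ha : ∀ v ∈ T, a v ∈ S v) (w : V) :
    ∑ v ∈ T.filter (fun v => w ∈ S v), (1 : ℝ) / (coveredBy S (a v)).card ≤
      4 * 4 ^ (t + 1) * (Nat.log 2 M + 1) := by
  set J := T.filter (fun v => w ∈ S v) with hJ
  set X : V → ℕ := fun v => (coveredBy S (a v)).card with hX
  have hXpos : ∀ v ∈ J, 0 < X v := fun v hv =>
    Finset.card_pos.2 ⟨v, mem_coveredBy.2 (ha v (Finset.mem_of_mem_filter v hv))⟩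
  rw [← Finset.sum_fiberwise_of_maps_to (s := J) (t := Finset.range (Nat.log 2 M + 1))
    (g := fun v => Nat.log 2 (X v)) (fun v _ => Finset.mem_range.2
      (Nat.lt_succ_of_le (Nat.log_mono_right (hM _))))]
  calc _ ≤ ∑ i ∈ Finset.range (Nat.log 2 M + 1), (4 * 4 ^ (t + 1) : ℝ) := by
        refine Finset.sum_le_sum fun i _ => ?_
        have hc : (J.filter fun v => Nat.log 2 (X v) = i).card ≤ 2 * 2 ^ (i + 1) * 4 ^ (t + 1) := by
          refine (Finset.card_le_card ?_).trans
            (card_filter_coveredBy_le (X := 2 ^ (i + 1)) hS a ha w)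
          intro v hv
          simp only [hJ, Finset.mem_filter] at hv ⊢
          refine ⟨hv.1.1, hv.1.2, ?_⟩
          rw [← hv.2]
          exact (Nat.lt_pow_succ_log_self (by norm_num) _).le
        calc ∑ v ∈ J.filter (fun v => Nat.log 2 (X v) = i), (1 : ℝ) / (X v : ℝ)
            ≤ ∑ v ∈ J.filter (fun v => Nat.log 2 (X v) = i), (1 : ℝ) / 2 ^ i := by
              refine Finset.sum_le_sum fun v hv => ?_
              rw [Finset.mem_filter] at hv
              refine one_div_le_one_div_of_le (by positivity) ?_
              rw [← hv.2]
              exact_mod_cast Nat.pow_log_le_self 2 (hXpos v hv.1).ne'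
          _ = (J.filter fun v => Nat.log 2 (X v) = i).card * ((1 : ℝ) / 2 ^ i) := by simp
          _ ≤ ((2 * 2 ^ (i + 1) * 4 ^ (t + 1) : ℕ) : ℝ) * ((1 : ℝ) / 2 ^ i) := by
              gcongr
          _ = 4 * 4 ^ (t + 1) := by
              push_cast
              rw [pow_succ (2 : ℝ) i]
              field_simp
              ring
    _ = _ := by simp; ring

open Classical in
/-- The weighted number of edges that leave the sets `S v`, where an edge is weighted by the
reciprocal of the number of sets that contain its inner endpoint. -/
theorem sum_cut_le {S : V → Finset V} {T : Finset V} {t M D : ℕ} (hD : 0 < D) {η : ℝ} (hη : 0 ≤ η)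
    (hS : ∀ v ∈ T, G.Linked (S v) ∧ (G.outer (S v)).card ≤ t)
    (hcut : ∀ v ∈ T, D * G.cutSize (S v) ≤ (S v).card) (hself : ∀ v, v ∈ S v)
    (hM : ∀ u, (coveredBy S u).card ≤ M) :
    ∑ v ∈ T, ∑ u ∈ S v, ((Finset.univ.filter fun x => G.Adj u x ∧ x ∉ S v).card : ℝ) *
        (1 / (coveredBy S u).card + η) ≤
      Fintype.card V * ((4 * 4 ^ (t + 1) * (Nat.log 2 M + 1) + M * η) / D) := by
  have hD' : (0 : ℝ) < D := by exact_mod_cast hD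
  -- Replacing every inner endpoint by a least covered vertex only increases the weights. The sum
  -- for `v` becomes its cut size times one weight, at most `(S v).card / D` times that weight, and
  -- this is spread evenly over the members `w` of `S v` before the order of summation is exchanged.
  have hex : ∀ v, ∃ a ∈ S v, ∀ u ∈ S v, (coveredBy S a).card ≤ (coveredBy S u).card := fun v =>
    Finset.exists_min_image (S v) _ ⟨v, hself v⟩
  choose a haS hamin using hex
  have hpos : ∀ u, (0 : ℝ) < (coveredBy S u).card := fun u => by
    exact_mod_cast Finset.card_pos.2 ⟨u, mem_coveredBy.2 (hself u)⟩
  calc _ ≤ ∑ v ∈ T, ∑ w ∈ S v, (1 / D : ℝ) * (1 / (coveredBy S (a v)).card + η) := by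
        refine Finset.sum_le_sum fun v hv => ?_
        have h1 : (0 : ℝ) ≤ 1 / (coveredBy S (a v)).card + η :=
          add_nonneg (one_div_nonneg.2 (hpos _).le) hη
        calc _ ≤ ∑ u ∈ S v, ((Finset.univ.filter fun x => G.Adj u x ∧ x ∉ S v).card : ℝ) *
              (1 / (coveredBy S (a v)).card + η) := by
              refine Finset.sum_le_sum fun u hu => ?_
              refine mul_le_mul_of_nonneg_left (add_le_add_left ?_ _) (by positivity)
              exact one_div_le_one_div_of_le (hpos _) (by exact_mod_cast hamin v u hu)
          _ = (G.cutSize (S v) : ℝ) * (1 / (coveredBy S (a v)).card + η) := by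
              rw [← Finset.sum_mul]
              unfold SimpleGraph.cutSize
              push_cast
              congr!
          _ ≤ ((S v).card * (1 / D)) * (1 / (coveredBy S (a v)).card + η) := by
              refine mul_le_mul_of_nonneg_right ?_ h1
              rw [mul_one_div, le_div_iff₀ hD', mul_comm]
              exact_mod_cast hcut v hv
          _ = _ := by simp; ring
    _ = ∑ w, ∑ v ∈ T.filter (fun v => w ∈ S v),
          (1 / D : ℝ) * (1 / (coveredBy S (a v)).card + η) := by
        refine Finset.sum_comm' fun v w => ?_
        simp
    _ ≤ ∑ w : V, (4 * 4 ^ (t + 1) * (Nat.log 2 M + 1) + M * η) / D := by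
        refine Finset.sum_le_sum fun w _ => ?_
        rw [← Finset.mul_sum, Finset.sum_add_distrib, one_div_mul_eq_div]
        refine div_le_div_of_nonneg_right (add_le_add
          (sum_inv_card_coveredBy_le hS hM a (fun v _ => haS v) w) ?_) hD'.le
        rw [Finset.sum_const, nsmul_eq_mul]
        refine mul_le_mul_of_nonneg_right ?_ hη
        have : T.filter (fun v => w ∈ S v) ⊆ coveredBy S w := fun v hv =>
          mem_coveredBy.2 (Finset.mem_filter.1 hv).2
        exact_mod_cast (Finset.card_le_card this).trans (hM w)
    _ = _ := by simp

end Charging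

/-! ### Random keys -/

section Coins

/-- The number whose binary digits are the first `B` coins filed under `y`. -/
def coinKey (ω : Coins) (y : ℕ) : ℕ → ℕ
  | 0 => 0
  | B + 1 => coinKey ω y B + coinKey ω y B + (ω (y, B)).toNat

instance : IsProbabilityMeasure coinMeasure := by
  unfold coinMeasure
  infer_instance

theorem coinKey_congr {ω ω' : Coins} {y y' B : ℕ} (h : ∀ j < B, ω (y, j) = ω' (y', j)) :
    coinKey ω y B = coinKey ω' y' B := by
  induction B with
  | zero => rfl
  | succ B ih =>
    simp only [coinKey]
    rw [ih fun j hj => h j (hj.trans B.lt_succ_self), h B B.lt_succ_self]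

theorem eq_of_coinKey_eq {ω : Coins} {y y' B : ℕ} (h : coinKey ω y B = coinKey ω y' B) :
    ∀ j < B, ω (y, j) = ω (y', j) := by
  induction B with
  | zero => simp
  | succ B ih =>
    simp only [coinKey] at h
    have h1 : (ω (y, B)).toNat ≤ 1 := Bool.toNat_le _
    have h2 : (ω (y', B)).toNat ≤ 1 := Bool.toNat_le _
    intro j hj
    rcases Nat.lt_succ_iff_lt_or_eq.1 hj with hj | rfl
    · exact ih (by omega) j hj
    · have h3 : (ω (y, j)).toNat = (ω (y', j)).toNat := by omega
      cases h4 : ω (y, j) <;> cases h5 : ω (y', j) <;> simp_all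

theorem measurable_coinKey (y B : ℕ) : Measurable fun ω : Coins => coinKey ω y B := by
  induction B with
  | zero => exact measurable_const
  | succ B ih =>
    have : Measurable fun ω : Coins => (ω (y, B)).toNat :=
      (measurable_of_countable Bool.toNat).comp (measurable_pi_apply _)
    exact (ih.add ih).add this

theorem measurableSet_coinKey_le (y y' B : ℕ) :
    MeasurableSet {ω : Coins | coinKey ω y B ≤ coinKey ω y' B} :=
  measurableSet_le (measurable_coinKey y B) (measurable_coinKey y' B)

theorem measurableSet_coinKey_lt (y y' B : ℕ) :
    MeasurableSet {ω : Coins | coinKey ω y B < coinKey ω y' B} :=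
  measurableSet_lt (measurable_coinKey y B) (measurable_coinKey y' B)

/-- Renaming the coins does not change their distribution. -/
theorem coinMeasure_map_comp (e : ℕ × ℕ ≃ ℕ × ℕ) :
    coinMeasure.map (fun ω i => ω (e i)) = coinMeasure := by
  have h := Measure.infinitePi_map_piCongrLeft (X := fun _ : ℕ × ℕ => Bool)
    (fun _ : ℕ × ℕ => (PMF.uniformOfFintype Bool).toMeasure) e.symm
  unfold coinMeasure
  convert h using 2
  funext ω i
  obtain ⟨a, rfl⟩ := e.symm.surjective i
  rw [MeasurableEquiv.coe_piCongrLeft, Equiv.piCongrLeft_apply_apply, Equiv.apply_symm_apply]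

/-- Exchanging the coins filed under two numbers preserves the measure; by this symmetry all
competitors are equally likely to win. -/
theorem coinMeasure_preimage_swap (u v : ℕ) {E : Set Coins} (hE : MeasurableSet E) :
    coinMeasure {ω | (fun i : ℕ × ℕ => ω (Equiv.swap u v i.1, i.2)) ∈ E} = coinMeasure E := by
  conv_rhs => rw [← coinMeasure_map_comp ((Equiv.swap u v).prodCongr (Equiv.refl ℕ))]
  rw [Measure.map_apply (measurable_pi_lambda _ fun i => measurable_pi_apply _) hE]
  rfl

/-- Equal keys mean equal bits. For each of the `2 ^ B` possible strings, both rows equal it with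
probability `2⁻¹ ^ B * 2⁻¹ ^ B`. -/
theorem coinMeasure_coinKey_eq_le {u v : ℕ} (huv : u ≠ v) (B : ℕ) :
    coinMeasure {ω | coinKey ω u B = coinKey ω v B} ≤ (2⁻¹ : ENNReal) ^ B := by
  have hsub : {ω : Coins | coinKey ω u B = coinKey ω v B} ⊆
      ⋃ x : Fin B → Bool, Set.pi ((({u, v} : Finset ℕ) ×ˢ Finset.range B : Finset (ℕ × ℕ)) : Set (ℕ × ℕ))
        fun i => {b | ∀ h : i.2 < B, b = x ⟨i.2, h⟩} := by
    intro ω hω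
    have h := eq_of_coinKey_eq hω
    refine Set.mem_iUnion.2 ⟨fun j => ω (u, j), ?_⟩
    rintro ⟨y, j⟩ hi hj
    simp only [Finset.coe_product, Set.mem_prod, Finset.mem_coe, Finset.mem_insert,
      Finset.mem_singleton] at hi
    rcases hi.1 with rfl | rfl
    · rfl
    · exact (h j hj).symm
  refine (measure_mono hsub).trans ((measure_iUnion_le _).trans ?_)
  have hx : ∀ x : Fin B → Bool, coinMeasure (Set.pi ((({u, v} : Finset ℕ) ×ˢ Finset.range B : Finset (ℕ × ℕ)) : Set (ℕ × ℕ))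
        fun i => {b | ∀ h : i.2 < B, b = x ⟨i.2, h⟩}) = (2⁻¹ : ENNReal) ^ B * (2⁻¹ : ENNReal) ^ B := by
    intro x
    unfold coinMeasure
    rw [Measure.infinitePi_pi _ fun _ _ => MeasurableSet.of_discrete]
    rw [Finset.prod_congr rfl (g := fun _ => (2⁻¹ : ENNReal))]
    · rw [Finset.prod_const, Finset.card_product, Finset.card_pair huv, Finset.card_range, two_mul,
        pow_add]
    · rintro ⟨y, j⟩ hi
      rw [Finset.mem_product, Finset.mem_range] at hi
      have : {b : Bool | ∀ h : j < B, b = x ⟨j, h⟩} = {x ⟨j, hi.2⟩} := by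
        ext b; simp [hi.2]
      simp only [this]
      rw [PMF.toMeasure_apply_singleton _ _ (MeasurableSet.singleton _)]
      simp
  rw [tsum_fintype, Finset.sum_congr rfl fun x _ => hx x, Finset.sum_const, Finset.card_univ]
  simp only [Fintype.card_pi, Fintype.card_bool, Finset.prod_const, Finset.card_univ,
    Fintype.card_fin, nsmul_eq_mul, Nat.cast_pow, Nat.cast_ofNat]
  rw [← mul_assoc, ← mul_pow, ENNReal.mul_inv_cancel (by norm_num) (by norm_num), one_pow, one_mul]

/-- A vertex wins against a finite set `U` with probability about `1 / |U|`. -/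
theorem coinMeasure_forall_coinKey_le (U : Finset ℕ) {v : ℕ} (hv : v ∈ U) (B : ℕ) :
    coinMeasure {ω | ∀ u ∈ U, coinKey ω v B ≤ coinKey ω u B} ≤
      (U.card : ENNReal)⁻¹ + U.card * (2⁻¹ : ENNReal) ^ B := by
  -- Strict victories are disjoint and, by symmetry, equally likely, so each has probability at most
  -- `1 / U.card`. A victory that is not strict involves a tie, and the union bound over ties gives
  -- the second term.
  let E : ℕ → Set Coins := fun v => {ω | ∀ u ∈ U, u ≠ v → coinKey ω v B < coinKey ω u B}
  have hEm : ∀ v, MeasurableSet (E v) := fun v => by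
    have : E v = ⋂ u ∈ U, ⋂ _ : u ≠ v, {ω : Coins | coinKey ω v B < coinKey ω u B} := by
      ext ω; simp [E]
    rw [this]
    exact Finset.measurableSet_biInter _ fun u _ => MeasurableSet.iInter fun _ =>
      measurableSet_coinKey_lt v u B
  have hsymm : ∀ u ∈ U, coinMeasure (E u) = coinMeasure (E v) := by
    intro u hu
    rw [← coinMeasure_preimage_swap u v (hEm v)]
    congr 1
    have hkey : ∀ (ω : Coins) y, coinKey (fun i : ℕ × ℕ => ω (Equiv.swap u v i.1, i.2)) y B =
        coinKey ω (Equiv.swap u v y) B := fun ω y => coinKey_congr fun j _ => rfl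
    have hmem : ∀ x, Equiv.swap u v x ∈ U ↔ x ∈ U := by
      intro x
      rcases eq_or_ne x u with rfl | hxu
      · simp [hu, hv]
      rcases eq_or_ne x v with rfl | hxv
      · simp [hu, hv]
      rw [Equiv.swap_apply_of_ne_of_ne hxu hxv]
    ext ω
    simp only [E, Set.mem_ofPred_eq, hkey, Equiv.swap_apply_right]
    constructor
    · intro h x hx hxv
      exact h _ ((hmem x).2 hx) fun h' => hxv (by
        simpa using congrArg (Equiv.swap u v) h')
    · intro h x hx hxu
      have := h (Equiv.swap u v x) ((hmem x).2 hx) (fun h' => hxu (by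
        simpa using congrArg (Equiv.swap u v) h'))
      simpa using this
  have hdisj : Set.PairwiseDisjoint (U : Set ℕ) E := by
    intro a ha b hb hab
    rw [Function.onFun, Set.disjoint_left]
    intro ω h1 h2
    exact lt_asymm (h1 b hb hab.symm) (h2 a ha hab)
  have hcard : (U.card : ENNReal) * coinMeasure (E v) ≤ 1 := by
    rw [← nsmul_eq_mul, ← Finset.sum_const, ← Finset.sum_congr rfl hsymm,
      ← measure_biUnion_finset hdisj fun u _ => hEm u]
    exact prob_le_one
  have hU : (U.card : ENNReal) ≠ 0 := by
    exact_mod_cast (Finset.card_pos.2 ⟨v, hv⟩).ne'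
  have hsub : {ω : Coins | ∀ u ∈ U, coinKey ω v B ≤ coinKey ω u B} ⊆
      E v ∪ ⋃ u ∈ U.erase v, {ω | coinKey ω u B = coinKey ω v B} := by
    intro ω hω
    by_cases h : ∃ u ∈ U.erase v, coinKey ω u B = coinKey ω v B
    · right
      simpa using h
    · left
      push Not at h
      intro u hu huv
      exact lt_of_le_of_ne (hω u hu) (h u (Finset.mem_erase.2 ⟨huv, hu⟩)).symm
  refine (measure_mono hsub).trans ((measure_union_le _ _).trans (add_le_add ?_ ?_))
  · rw [ENNReal.le_inv_iff_mul_le, mul_comm]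
    exact hcard
  · refine (measure_biUnion_finset_le _ _).trans ((Finset.sum_le_sum fun u hu =>
      coinMeasure_coinKey_eq_le (Finset.ne_of_mem_erase hu) B).trans ?_)
    rw [Finset.sum_const, nsmul_eq_mul]
    gcongr
    exact Finset.erase_subset _ _

end Coins

/-! ### The expected number of cut edges -/

section CutProbability

variable {n : ℕ} (A : GraphInput n)

open Classical in
theorem GraphInput.card_adj_le {d : ℕ} (hd : ∀ v, A.degree v ≤ d) (u : Fin n) :
    (Finset.univ.filter fun v => A.graph.Adj u v).card ≤ d := by
  refine le_trans ?_ (hd u)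
  have : (Finset.univ.filter fun v => A.graph.Adj u v) ⊆ (A.nbrs u).toFinset := by
    intro v hv
    simpa [A.mem_nbrs] using hv
  exact (Finset.card_le_card this).trans (List.toFinset_card_le _)

open Classical in
/-- If every vertex joins the winner among the sets that contain it, only edges that leave the set
of a winner are cut. -/
theorem GraphInput.ncard_cutEdges_le (S : Fin n → Finset (Fin n)) (r : Fin n → ℕ)
    (win : Fin n → Fin n)
    (hwin : ∀ u, win u ∈ coveredBy S u ∧
      ∀ u' ∈ coveredBy S u, r (win u) < r u' ∨ (r (win u) = r u' ∧ win u ≤ u'))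
    (f : Fin n → Finset (Fin n)) (hf : ∀ u v, win u = win v → f u = f v) :
    (A.cutEdges f).ncard ≤ ∑ u, ∑ v ∈ coveredBy S u,
      if ∀ u' ∈ coveredBy S u, r v ≤ r u'
      then (Finset.univ.filter fun x => A.graph.Adj u x ∧ x ∉ S v).card else 0 := by
  let Q : Finset (Fin n × Fin n) :=
    Finset.univ.filter fun p => A.graph.Adj p.1 p.2 ∧ p.2 ∉ S (win p.1)
  have hsub : A.cutEdges f ⊆ ((Q.image fun p => s(p.1, p.2) : Finset (Sym2 (Fin n))) : Set _) := by
    rintro e ⟨he, a, b, rfl, hab⟩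
    rw [SimpleGraph.mem_edgeSet] at he
    have hne : win a ≠ win b := fun h => hab (hf a b h)
    rw [Finset.mem_coe, Finset.mem_image]
    -- If each winner's set contained the opposite endpoint as well, both winners would compete at
    -- both endpoints, and the linear order of priorities would make them equal.
    by_cases h1 : b ∈ S (win a)
    · by_cases h2 : a ∈ S (win b)
      · exfalso
        have h3 := (hwin a).2 (win b) (mem_coveredBy.2 h2)
        have h4 := (hwin b).2 (win a) (mem_coveredBy.2 h1)
        apply hne
        rcases h3 with h3 | ⟨h3, h3'⟩ <;> rcases h4 with h4 | ⟨h4, h4'⟩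
        · omega
        · omega
        · omega
        · exact le_antisymm h3' h4'
      · exact ⟨(b, a), by simp [Q, he.symm, h2], Sym2.eq_swap⟩
    · exact ⟨(a, b), by simp [Q, he, h1], rfl⟩
  calc (A.cutEdges f).ncard ≤ (Q.image fun p => s(p.1, p.2)).card := by
        rw [← Set.ncard_coe_finset]
        exact Set.ncard_le_ncard hsub (Finset.finite_toSet _)
    _ ≤ Q.card := Finset.card_image_le
    _ = ∑ u, (Finset.univ.filter fun x => A.graph.Adj u x ∧ x ∉ S (win u)).card := by
        simp only [Q, Finset.card_filter]
        rw [← Finset.univ_product_univ, Finset.sum_product]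
    _ ≤ _ := by
        refine Finset.sum_le_sum fun u _ => ?_
        refine le_trans ?_ (Finset.single_le_sum (fun v _ => Nat.zero_le _) (hwin u).1)
        rw [if_pos fun u' hu' => ?_]
        rcases (hwin u).2 u' hu' with h | h <;> omega

open Classical in
/-- Random priorities cut few edges. -/
theorem GraphInput.le_coinMeasure_cutEdges {d t M D B : ℕ} {ε : ℝ} (hε : 0 < ε) (hD : 0 < D)
    (hd : ∀ v, A.degree v ≤ d) {S : Fin n → Finset (Fin n)} {T : Finset (Fin n)}
    (hself : ∀ v, v ∈ S v) (hT : ∀ v, v ∉ T → S v = {v})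
    (hS : ∀ v ∈ T, A.graph.Linked (S v) ∧ (A.graph.outer (S v)).card ≤ t)
    (hcut : ∀ v ∈ T, D * A.graph.cutSize (S v) ≤ (S v).card)
    (hM : ∀ u, (coveredBy S u).card ≤ M)
    (hbound : (d : ℝ) * (Finset.univ \ T).card +
      n * ((4 * 4 ^ (t + 1) * (Nat.log 2 M + 1) + M * (M * 2⁻¹ ^ B)) / D) ≤ ε * n / 10)
    (win : Coins → Fin n → Fin n)
    (hwin : ∀ ω u, win ω u ∈ coveredBy S u ∧ ∀ u' ∈ coveredBy S u,
      coinKey ω (win ω u) B < coinKey ω u' B ∨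
        (coinKey ω (win ω u) B = coinKey ω u' B ∧ win ω u ≤ u'))
    (f : Coins → Fin n → Finset (Fin n)) (hf : ∀ ω u v, win ω u = win ω v → f ω u = f ω v) :
    9 / 10 ≤ coinMeasure {ω | ((A.cutEdges (f ω)).ncard : ℝ) ≤ ε * n} := by
  rcases Nat.eq_zero_or_pos n with rfl | hn
  · have : {ω | ((A.cutEdges (f ω)).ncard : ℝ) ≤ ε * (0 : ℕ)} = Set.univ := by
      ext ω
      have : A.cutEdges (f ω) = ∅ := by
        ext e
        refine ⟨?_, fun h => h.elim⟩
        rintro ⟨-, v, -⟩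
        exact v.elim0
      simp [this]
    rw [this, measure_univ]
    exact ENNReal.div_le_of_le_mul (by norm_num)
  have hn' : (0 : ℝ) < n := by exact_mod_cast hn
  let c : Fin n → Fin n → ℕ := fun u v => (Finset.univ.filter fun x => A.graph.Adj u x ∧ x ∉ S v).card
  let E : Fin n → Fin n → Set Coins := fun u v =>
    {ω | ∀ u' ∈ coveredBy S u, coinKey ω v B ≤ coinKey ω u' B}
  have hE : ∀ u v, MeasurableSet (E u v) := fun u v => by
    have : E u v = ⋂ u' ∈ coveredBy S u, {ω : Coins | coinKey ω v B ≤ coinKey ω u' B} := by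
      ext ω; simp [E]
    rw [this]
    exact Finset.measurableSet_biInter _ fun u' _ => measurableSet_coinKey_le v u' B
  have hPE : ∀ u, ∀ v ∈ coveredBy S u,
      coinMeasure.real (E u v) ≤ 1 / (coveredBy S u).card + M * 2⁻¹ ^ B := by
    intro u v hv
    have h1 := coinMeasure_forall_coinKey_le ((coveredBy S u).map Fin.valEmbedding)
      (v := v) (Finset.mem_map.2 ⟨v, hv, rfl⟩) B
    have h2 : {ω : Coins | ∀ u' ∈ (coveredBy S u).map Fin.valEmbedding,
        coinKey ω v B ≤ coinKey ω u' B} = E u v := by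
      ext ω; simp [E]
    rw [h2, Finset.card_map] at h1
    have hU : (coveredBy S u).card ≠ 0 := (Finset.card_pos.2 ⟨v, hv⟩).ne'
    have h3 := ENNReal.toReal_mono (by
      refine ENNReal.add_ne_top.2 ⟨ENNReal.inv_ne_top.2 (by exact_mod_cast hU), ?_⟩
      exact ENNReal.mul_ne_top (ENNReal.natCast_ne_top _) (ENNReal.pow_ne_top (by simp))) h1
    rw [ENNReal.toReal_add (ENNReal.inv_ne_top.2 (by exact_mod_cast hU))
      (ENNReal.mul_ne_top (ENNReal.natCast_ne_top _) (ENNReal.pow_ne_top (by simp)))] at h3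
    simp only [ENNReal.toReal_inv, ENNReal.toReal_natCast, ENNReal.toReal_mul, ENNReal.toReal_pow,
      ENNReal.toReal_ofNat] at h3
    rw [measureReal_def]
    refine h3.trans ?_
    rw [one_div]
    gcongr
    exact hM u
  -- A measurable upper bound for the number of cut edges. The number itself is never shown to be
  -- measurable.
  let g : Coins → ENNReal := fun ω =>
    ∑ u, ∑ v ∈ coveredBy S u, (c u v : ENNReal) * (E u v).indicator 1 ω
  have hgm : Measurable g := by
    refine Finset.measurable_sum _ fun u _ => Finset.measurable_sum _ fun v _ => ?_
    exact (measurable_one.indicator (hE u v)).const_mul _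
  have hint : ∫⁻ ω, g ω ∂coinMeasure =
      ENNReal.ofReal (∑ u, ∑ v ∈ coveredBy S u, (c u v : ℝ) * coinMeasure.real (E u v)) := by
    rw [lintegral_finsetSum _ fun u _ => Finset.measurable_sum _ fun v _ =>
      (measurable_one.indicator (hE u v)).const_mul _,
      ENNReal.ofReal_sum_of_nonneg fun u _ => Finset.sum_nonneg fun v _ => by positivity]
    refine Finset.sum_congr rfl fun u _ => ?_
    rw [lintegral_finsetSum _ fun v _ => (measurable_one.indicator (hE u v)).const_mul _,
      ENNReal.ofReal_sum_of_nonneg fun v _ => by positivity]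
    refine Finset.sum_congr rfl fun v _ => ?_
    rw [lintegral_const_mul _ (measurable_one.indicator (hE u v)), lintegral_indicator_one (hE u v),
      ENNReal.ofReal_mul (by positivity), ENNReal.ofReal_natCast, ofReal_measureReal]
  -- Summed by sets instead of by endpoints: a vertex outside `T` has a singleton set, which at most
  -- `d` edges leave; the sets of the vertices in `T` are handled by `sum_cut_le`, with the tie
  -- probability as `η`.
  have hsum : ∑ u, ∑ v ∈ coveredBy S u, (c u v : ℝ) * coinMeasure.real (E u v) ≤ ε * n / 10 := by
    refine le_trans ?_ hbound
    have hswap : ∑ u, ∑ v ∈ coveredBy S u, (c u v : ℝ) * coinMeasure.real (E u v) =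
        ∑ v, ∑ u ∈ S v, (c u v : ℝ) * coinMeasure.real (E u v) :=
      Finset.sum_comm' fun u v => by simp [mem_coveredBy]
    rw [hswap, ← Finset.sum_sdiff (Finset.subset_univ T)]
    refine add_le_add ?_ ?_
    · calc _ ≤ ∑ v ∈ Finset.univ \ T, (d : ℝ) := by
            refine Finset.sum_le_sum fun v hv => ?_
            rw [hT v (by simpa using hv), Finset.sum_singleton]
            have h1 : (c v v : ℝ) ≤ d := by
              exact_mod_cast (Finset.card_le_card (fun x hx => by
                simp only [Finset.mem_filter] at hx ⊢
                exact ⟨hx.1, hx.2.1⟩)).trans (A.card_adj_le hd v)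
            calc _ ≤ (d : ℝ) * 1 := mul_le_mul h1 measureReal_le_one measureReal_nonneg (by positivity)
              _ = d := mul_one _
        _ = _ := by simp [mul_comm]
    · have := sum_cut_le (T := T) hD (η := M * 2⁻¹ ^ B) (by positivity) hS hcut hself hM
      rw [Fintype.card_fin] at this
      refine le_trans (Finset.sum_le_sum fun v hv => Finset.sum_le_sum fun u hu => ?_) this
      exact mul_le_mul_of_nonneg_left (hPE u v (mem_coveredBy.2 hu)) (by positivity)
  have hcount : ∀ ω, ((A.cutEdges (f ω)).ncard : ENNReal) ≤ g ω := by
    intro ω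
    have := A.ncard_cutEdges_le S (fun u => coinKey ω u B) (win ω) (hwin ω) (f ω) (hf ω)
    refine (Nat.cast_le.2 this).trans (le_of_eq ?_)
    push_cast
    refine Finset.sum_congr rfl fun u _ => Finset.sum_congr rfl fun v _ => ?_
    by_cases h : ω ∈ E u v
    · rw [if_pos (by exact h), Set.indicator_of_mem h]; simp [c]
    · rw [if_neg (by exact h), Set.indicator_of_notMem h]; simp
  have hεn : 0 < ε * n := mul_pos hε hn'
  have hmarkov : coinMeasure {ω | ENNReal.ofReal (ε * n) ≤ g ω} ≤ 1 / 10 := by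
    refine (meas_ge_le_lintegral_div hgm.aemeasurable (by simpa using hεn) (by simp)).trans ?_
    rw [hint, ← ENNReal.ofReal_div_of_pos hεn]
    refine (ENNReal.ofReal_le_ofReal (q := 1 / 10) ?_).trans ?_
    · rw [div_le_iff₀ hεn]; linarith
    · rw [ENNReal.ofReal_div_of_pos (by norm_num)]; simp
  have hcompl : coinMeasure {ω | ((A.cutEdges (f ω)).ncard : ℝ) ≤ ε * n}ᶜ ≤ 1 / 10 := by
    refine (measure_mono ?_).trans hmarkov
    intro ω hω
    rw [Set.mem_compl_iff, Set.mem_ofPred_eq, not_le] at hω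
    refine le_trans ?_ (hcount ω)
    rw [← ENNReal.ofReal_natCast]
    exact ENNReal.ofReal_le_ofReal hω.le
  -- Subadditivity suffices here and, unlike the formula for the measure of a complement, needs no
  -- measurability.
  have huniv := measure_univ_le_add_compl (μ := coinMeasure)
    {ω | ((A.cutEdges (f ω)).ncard : ℝ) ≤ ε * n}
  rw [measure_univ] at huniv
  have h910 : (9 / 10 : ENNReal) + 1 / 10 = 1 := by
    rw [ENNReal.div_add_div_same]
    norm_num
    exact ENNReal.div_self (by norm_num) (by norm_num)
  refine ENNReal.le_of_add_le_add_right (a := 1 / 10) (by simp) ?_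
  rw [h910]
  exact huniv.trans (add_le_add_right hcompl _)

end CutProbability

/-! ### Breadth first search with blocked positions -/

section Exploration

theorem SimpleGraph.linked_singleton {V : Type*} (G : SimpleGraph V) (x : V) : G.Linked {x} := by
  rintro Y ⟨y, hy, hyx⟩ -
  rw [Finset.mem_singleton] at hyx
  exact Finset.singleton_subset_iff.2 (hyx ▸ hy)

theorem SimpleGraph.Linked.cons {V : Type*} [DecidableEq V] {G : SimpleGraph V} {S : Finset V}
    (h : G.Linked S) {u x : V} (hu : u ∈ S) (hux : G.Adj u x) : G.Linked (insert x S) := by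
  rintro Y ⟨y, hy, hyS⟩ hY
  have key : u ∈ Y → insert x S ⊆ Y := fun huY =>
    Finset.insert_subset (hY u huY (Finset.mem_insert_of_mem hu) x (Finset.mem_insert_self _ _) hux)
      (h Y ⟨u, huY, hu⟩ fun a ha haS b hb => hY a ha (Finset.mem_insert_of_mem haS) b
        (Finset.mem_insert_of_mem hb))
  rcases Finset.mem_insert.1 hyS with rfl | hyS
  · exact key (hY y hy (Finset.mem_insert_self _ _) u (Finset.mem_insert_of_mem hu) hux.symm)
  · exact key (h Y ⟨y, hy, hyS⟩ (fun a ha haS b hb => hY a ha (Finset.mem_insert_of_mem haS) b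
        (Finset.mem_insert_of_mem hb)) hu)

variable {n : ℕ} (A : GraphInput n)

/-- Append those elements of `l` to `q` that it does not contain. -/
def addNew (q : List (Fin n)) : List (Fin n) → List (Fin n)
  | [] => q
  | w :: l => addNew (if w ∈ q then q else q ++ [w]) l

theorem prefix_addNew (q l : List (Fin n)) : q <+: addNew q l := by
  induction l generalizing q with
  | nil => exact List.prefix_rfl
  | cons w l ih =>
    refine List.IsPrefix.trans ?_ (ih _)
    split_ifs
    · exact List.prefix_rfl
    · exact List.prefix_append _ _

theorem mem_addNew {q l : List (Fin n)} {x : Fin n} : x ∈ addNew q l ↔ x ∈ q ∨ x ∈ l := by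
  induction l generalizing q with
  | nil => simp [addNew]
  | cons w l ih =>
    rw [addNew, ih]
    split_ifs with h
    · rw [List.mem_cons]
      constructor
      · tauto
      · rintro (h1 | rfl | h1) <;> tauto
    · simp only [List.mem_append, List.mem_cons]
      simp
      tauto

theorem nodup_addNew {q l : List (Fin n)} (hq : q.Nodup) : (addNew q l).Nodup := by
  induction l generalizing q with
  | nil => exact hq
  | cons w l ih =>
    rw [addNew]
    refine ih ?_
    split_ifs with h
    · exact hq
    · exact List.nodup_append.2 ⟨hq, by simp, by
        intro a ha b hb
        rw [List.mem_singleton] at hb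
        rintro rfl
        exact h (hb ▸ ha)⟩

theorem length_addNew_le (q l : List (Fin n)) : (addNew q l).length ≤ q.length + l.length := by
  induction l generalizing q with
  | nil => simp [addNew]
  | cons w l ih =>
    rw [addNew]
    refine (ih _).trans ?_
    split_ifs
    · simp
    · simp; omega

/-- One step of a breadth first search with queue `p.1` and set of expanded vertices `p.2`: unless
it is blocked, the vertex at position `i` of the queue is expanded. -/
def GraphInput.searchStep (P : ℕ → Fin n → Prop) [∀ i v, Decidable (P i v)] (i : ℕ)
    (p : List (Fin n) × List (Fin n)) : List (Fin n) × List (Fin n) :=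
  if h : i < p.1.length then
    if P i p.1[i] then p else (addNew p.1 (A.nbrs p.1[i]), p.2 ++ [p.1[i]])
  else p

/-- The first `k` steps of a breadth first search from `v`. -/
def GraphInput.search (P : ℕ → Fin n → Prop) [∀ i v, Decidable (P i v)] (v : Fin n) :
    ℕ → List (Fin n) × List (Fin n)
  | 0 => ([v], [])
  | k + 1 => A.searchStep P k (GraphInput.search P v k)

section

variable (P : ℕ → Fin n → Prop) [∀ i v, Decidable (P i v)] (v : Fin n)

/-- What is true after `k` steps of a search. -/
structure GraphInput.SearchInv (k : ℕ) (p : List (Fin n) × List (Fin n)) : Prop where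
  prefix_fst : [v] <+: p.1
  nodup_fst : p.1.Nodup
  nodup_snd : p.2.Nodup
  length_snd : p.2.length ≤ k
  mem_snd : ∀ x, x ∈ p.2 ↔ ∃ i, ∃ h : i < p.1.length, i < k ∧ ¬ P i p.1[i] ∧ p.1[i] = x
  nbrs_subset : ∀ x ∈ p.2, ∀ y, A.graph.Adj x y → y ∈ p.1
  parent : ∀ x ∈ p.1, x = v ∨ ∃ u ∈ p.2, A.graph.Adj u x
  linked : p.2 ≠ [] → A.graph.Linked p.2.toFinset
  fst_of_nil : p.2 = [] → p.1 = [v]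
  self_mem : p.2 ≠ [] → v ∈ p.2

theorem GraphInput.prefix_searchStep (i : ℕ) (p : List (Fin n) × List (Fin n)) :
    p.1 <+: (A.searchStep P i p).1 := by
  unfold GraphInput.searchStep
  split_ifs
  · exact List.prefix_rfl
  · exact prefix_addNew _ _
  · exact List.prefix_rfl

theorem GraphInput.searchInv (k : ℕ) : A.SearchInv P v k (A.search P v k) := by
  induction k with
  | zero =>
    exact ⟨List.prefix_rfl, by simp [search], by simp [search], by simp [search],
      by simp [search], by simp [search], by simp [search], by simp [search], by simp [search],
      by simp [search]⟩
  | succ k ih =>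
    obtain ⟨h1, h2, h3, h4, h5, h6, h7, h8, h9, h10⟩ := ih
    rw [search]
    set p := A.search P v k with hp
    unfold searchStep
    split_ifs with hk hP
    · refine ⟨h1, h2, h3, by omega, fun x => ?_, h6, h7, h8, h9, h10⟩
      rw [h5]
      constructor
      · rintro ⟨i, hi, hik, h⟩
        exact ⟨i, hi, by omega, h⟩
      · rintro ⟨i, hi, hik, h, h'⟩
        rcases Nat.lt_succ_iff_lt_or_eq.1 hik with hik | rfl
        · exact ⟨i, hi, hik, h, h'⟩
        · exact absurd hP h
    · have hpre := prefix_addNew p.1 (A.nbrs p.1[k])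
      have hget : ∀ i (hi : i < p.1.length), (addNew p.1 (A.nbrs p.1[k]))[i]'(hi.trans_le
          hpre.length_le) = p.1[i] := fun i hi => (hpre.getElem hi).symm
      have hnew : p.1[k] ∉ p.2 := by
        rw [h5]
        rintro ⟨i, hi, hik, -, h⟩
        have := (h2.getElem_inj_iff).1 h
        omega
      refine ⟨h1.trans hpre, nodup_addNew h2, ?_, by simp; omega, fun x => ?_, ?_, ?_, ?_,
        by simp, fun _ => ?_⟩
      · rw [List.nodup_append]
        refine ⟨h3, by simp, fun a ha b hb hab => hnew ?_⟩
        rw [List.mem_singleton] at hb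
        exact hb ▸ hab ▸ ha
      · rw [List.mem_append, List.mem_singleton, h5]
        constructor
        · rintro (⟨i, hi, hik, h, h'⟩ | rfl)
          · exact ⟨i, hi.trans_le hpre.length_le, by omega, by rwa [hget i hi], by rwa [hget i hi]⟩
          · exact ⟨k, hk.trans_le hpre.length_le, by omega, by rwa [hget k hk], hget k hk⟩
        · rintro ⟨i, hi, hik, h, h'⟩
          rcases Nat.lt_succ_iff_lt_or_eq.1 hik with hik | rfl
          · rw [hget i (hik.trans hk)] at h h'
            exact .inl ⟨i, hik.trans hk, hik, h, h'⟩
          · rw [hget i hk] at h'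
            exact .inr h'.symm
      · intro x hx y hxy
        rw [mem_addNew]
        rw [List.mem_append, List.mem_singleton] at hx
        rcases hx with hx | rfl
        · exact .inl (h6 x hx y hxy)
        · exact .inr ((A.mem_nbrs _ _).2 hxy)
      · intro x hx
        rw [mem_addNew] at hx
        rcases hx with hx | hx
        · exact (h7 x hx).imp_right fun ⟨u, hu, h⟩ => ⟨u, List.mem_append_left _ hu, h⟩
        · exact .inr ⟨_, List.mem_append_right _ (List.mem_singleton_self _), (A.mem_nbrs _ _).1 hx⟩
      · intro _
        by_cases hS : p.2 = []
        · simp only [hS, List.nil_append, List.toFinset_cons, List.toFinset_nil]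
          exact A.graph.linked_singleton _
        · have hv0 : ∃ h0 : 0 < p.1.length, p.1[0] = v :=
            ⟨by omega, (h1.getElem (i := 0) (by simp)).symm⟩
          -- The start vertex occurs only at position `0`. Once something has been expanded, the
          -- current vertex is therefore a different one and was put into the queue by an expanded
          -- neighbour, which keeps the expanded set linked.
          have hkv : p.1[k] ≠ v := by
            obtain ⟨h0, hv0⟩ := hv0
            intro h
            rw [← hv0] at h
            have hk0 := (h2.getElem_inj_iff).1 h
            subst hk0
            exact hS (List.length_eq_zero_iff.1 (by omega))
          obtain ⟨u, hu, hadj⟩ := (h7 _ (List.getElem_mem hk)).resolve_left hkv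
          have := (h8 hS).cons (List.mem_toFinset.2 hu) hadj
          convert this using 1
          ext x
          simp [or_comm]
      · rw [List.mem_append, List.mem_singleton]
        by_cases hS : p.2 = []
        · right
          have := h9 hS
          simp only [this, List.length_singleton, Nat.lt_one_iff] at hk
          simp [this, hk]
        · exact .inl (h10 hS)
    · refine ⟨h1, h2, h3, by omega, fun x => ?_, h6, h7, h8, h9, h10⟩
      rw [h5]
      constructor
      · rintro ⟨i, hi, hik, h⟩
        exact ⟨i, hi, by omega, h⟩
      · rintro ⟨i, hi, hik, h, h'⟩
        exact ⟨i, hi, by omega, h, h'⟩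

theorem GraphInput.prefix_search {k l : ℕ} (hkl : k ≤ l) :
    (A.search P v k).1 <+: (A.search P v l).1 := by
  induction l, hkl using Nat.le_induction with
  | base => exact List.prefix_rfl
  | succ l _ ih => exact ih.trans (A.prefix_searchStep P l _)

theorem GraphInput.length_search_le {d : ℕ} (hd : ∀ v, A.degree v ≤ d) (k : ℕ) :
    (A.search P v k).1.length ≤ 1 + k * d := by
  induction k with
  | zero => simp [search]
  | succ k ih =>
    rw [search]
    unfold searchStep
    split_ifs with hk
    · nlinarith
    · refine (length_addNew_le _ _).trans ?_
      have := hd (A.search P v k).1[k]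
      unfold degree at this
      nlinarith
    · nlinarith

variable {P}

/-- Blocking is consulted only at positions of the queue, and earlier queues are prefixes of the
final one; so it is enough that the two rules agree on the final queue. -/
theorem GraphInput.search_congr {P' : ℕ → Fin n → Prop} [∀ i v, Decidable (P' i v)] (b : ℕ)
    (h : ∀ i (hi : i < (A.search P v b).1.length), i < b →
      (P i (A.search P v b).1[i] ↔ P' i (A.search P v b).1[i])) :
    ∀ k ≤ b, A.search P' v k = A.search P v k := by
  intro k hk
  induction k with
  | zero => rfl
  | succ k ih =>
    rw [search, search, ih (by omega)]
    unfold searchStep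
    split_ifs with h1 h2 h3 h4
    · rfl
    · exfalso
      have hpre := A.prefix_search P v (by omega : k ≤ b)
      have := h k (h1.trans_le hpre.length_le) (by omega)
      rw [← hpre.getElem h1] at this
      tauto
    · exfalso
      have hpre := A.prefix_search P v (by omega : k ≤ b)
      have := h k (h1.trans_le hpre.length_le) (by omega)
      rw [← hpre.getElem h1] at this
      tauto
    · rfl
    · rfl

end

end Exploration

/-! ### Isolated sets found by coded searches -/

section Partition

/-- The digits of `c` in base `b`, as a list of blocked positions. -/
def blockList (b t c : ℕ) : List ℕ := (List.range t).map fun j => c / b ^ j % b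

theorem exists_blockList_eq {b t : ℕ} (g : Fin t → Fin b) :
    ∃ c < b ^ t, ∀ i, i ∈ blockList b t c ↔ ∃ j, (g j : ℕ) = i := by
  refine ⟨finFunctionFinEquiv g, (finFunctionFinEquiv g).2, fun i => ?_⟩
  have hg : ∀ j : Fin t, (finFunctionFinEquiv g : ℕ) / b ^ (j : ℕ) % b = g j := fun j => by
    have := congrFun (finFunctionFinEquiv.symm_apply_apply g) j
    rw [← this]
    rfl
  simp only [blockList, List.mem_map, List.mem_range]
  constructor
  · rintro ⟨j, hj, rfl⟩
    exact ⟨⟨j, hj⟩, (hg ⟨j, hj⟩).symm⟩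
  · rintro ⟨j, rfl⟩
    exact ⟨j, j.2, hg j⟩

variable {n : ℕ} (A : GraphInput n)

/-- The number of edges that leave the vertices in a list, counted on their neighbour lists. -/
def GraphInput.cutCount (S : List (Fin n)) : ℕ :=
  (S.map fun u => ((A.nbrs u).filter fun w => w ∉ S).length).sum

theorem GraphInput.cutCount_eq {S : List (Fin n)} (hS : S.Nodup) :
    A.cutCount S = A.graph.cutSize S.toFinset := by
  classical
  unfold cutCount SimpleGraph.cutSize
  rw [List.sum_toFinset _ hS]
  congr 1
  refine List.map_congr_left fun u _ => ?_
  rw [← List.toFinset_card_of_nodup ((A.nodup u).filter _)]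
  congr 1
  ext w
  simp [A.mem_nbrs]

variable (D b t : ℕ)

/-- The search from `v` with the blocked positions that are coded by `c`. -/
abbrev GraphInput.codedSearch (v : Fin n) (c : ℕ) : List (Fin n) × List (Fin n) :=
  A.search (fun i _ => i ∈ blockList b t c) v b

/-- The search was completed and has found a set with few edges leaving it. -/
def GraphInput.Accepts (v : Fin n) (c : ℕ) : Prop :=
  (A.codedSearch b t v c).1.length < b ∧
    D * A.cutCount (A.codedSearch b t v c).2 < (A.codedSearch b t v c).2.length

instance (v : Fin n) (c : ℕ) : Decidable (A.Accepts D b t v c) := by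
  unfold GraphInput.Accepts
  infer_instance

/-- The first set that is found by a search with a code below the given number. -/
def GraphInput.findUpTo (v : Fin n) : ℕ → Option (List (Fin n))
  | 0 => none
  | c + 1 => match GraphInput.findUpTo v c with
    | some S => some S
    | none => if A.Accepts D b t v c then some (A.codedSearch b t v c).2 else none

/-- The isolated set assigned to `v`. -/
def GraphInput.findSet (v : Fin n) : List (Fin n) := (A.findUpTo D b t v (b ^ t)).getD [v]

/-- The vertices met in the completed searches with a code below the given number. -/
def GraphInput.collectUpTo (v : Fin n) : ℕ → List (Fin n)
  | 0 => []
  | c + 1 => GraphInput.collectUpTo v c ++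
      if (A.codedSearch b t v c).1.length < b then (A.codedSearch b t v c).1 else []

theorem GraphInput.exists_accepts_of_findUpTo {v : Fin n} {N : ℕ} {S : List (Fin n)}
    (h : A.findUpTo D b t v N = some S) :
    ∃ c < N, A.Accepts D b t v c ∧ S = (A.codedSearch b t v c).2 := by
  induction N with
  | zero => simp [findUpTo] at h
  | succ c ih =>
    rw [findUpTo] at h
    cases h' : A.findUpTo D b t v c with
    | some S' =>
      rw [h'] at h
      obtain ⟨c', hc', h2⟩ := ih (h'.trans h)
      exact ⟨c', by omega, h2⟩
    | none =>
      rw [h'] at h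
      by_cases hA : A.Accepts D b t v c
      · simp only [hA, if_true] at h
        exact ⟨c, by omega, hA, (Option.some.inj h).symm⟩
      · simp [hA] at h

theorem GraphInput.findUpTo_ne_none {v : Fin n} {N c : ℕ} (hc : c < N)
    (h : A.Accepts D b t v c) : A.findUpTo D b t v N ≠ none := by
  induction N with
  | zero => omega
  | succ N ih =>
    rw [findUpTo]
    cases h' : A.findUpTo D b t v N with
    | some S' => simp
    | none =>
      rcases Nat.lt_succ_iff_lt_or_eq.1 hc with hc | rfl
      · exact absurd h' (ih hc)
      · simp [h]

theorem GraphInput.mem_collectUpTo {v x : Fin n} {N : ℕ} :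
    x ∈ A.collectUpTo b t v N ↔ ∃ c < N, (A.codedSearch b t v c).1.length < b ∧
      x ∈ (A.codedSearch b t v c).1 := by
  induction N with
  | zero => simp [collectUpTo]
  | succ N ih =>
    rw [collectUpTo, List.mem_append, ih]
    constructor
    · rintro (⟨c, hc, h⟩ | h)
      · exact ⟨c, by omega, h⟩
      · split_ifs at h with h'
        · exact ⟨N, by omega, h', h⟩
        · simp at h
    · rintro ⟨c, hc, h, h'⟩
      rcases Nat.lt_succ_iff_lt_or_eq.1 hc with hc | rfl
      · exact .inl ⟨c, hc, h, h'⟩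
      · right; rw [if_pos h]; exact h'

theorem GraphInput.length_collectUpTo_le (v : Fin n) (N : ℕ) :
    (A.collectUpTo b t v N).length ≤ N * b := by
  induction N with
  | zero => simp [collectUpTo]
  | succ N ih =>
    rw [collectUpTo, List.length_append, Nat.succ_mul]
    refine add_le_add ih ?_
    split_ifs with h
    · exact h.le
    · simp

variable {A D b t}

/-- The set found by a completed search. -/
theorem GraphInput.codedSearch_spec {v : Fin n} {c : ℕ}
    (hlen : (A.codedSearch b t v c).1.length < b) (hne : (A.codedSearch b t v c).2 ≠ []) :
    v ∈ (A.codedSearch b t v c).2 ∧ A.graph.Linked (A.codedSearch b t v c).2.toFinset ∧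
    (A.graph.outer (A.codedSearch b t v c).2.toFinset).card ≤ t ∧
    (A.codedSearch b t v c).2.toFinset ∪ A.graph.outer (A.codedSearch b t v c).2.toFinset ⊆
      (A.codedSearch b t v c).1.toFinset := by
  have hinv := A.searchInv (fun i _ => i ∈ blockList b t c) v b
  set p := A.codedSearch b t v c with hp
  obtain ⟨h1, h2, h3, h4, h5, h6, h7, h8, h9, h10⟩ := hinv
  -- The queue is shorter than the number of steps, so every position has been visited and only
  -- blocked vertices remain unexpanded. The code has `t` digits, which bounds the number of
  -- neighbours.
  have hproc : ∀ i (hi : i < p.1.length), p.1[i] ∉ p.2 → i ∈ blockList b t c := by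
    intro i hi hip
    by_contra hb
    exact hip ((h5 _).2 ⟨i, hi, by omega, hb, rfl⟩)
  have hS : ∀ x ∈ p.2, x ∈ p.1 := by
    intro x hx
    obtain ⟨i, hi, -, -, rfl⟩ := (h5 x).1 hx
    exact List.getElem_mem hi
  have hv1 : v ∈ p.1 := h1.subset (by simp)
  refine ⟨h10 hne, h8 hne, ?_, ?_⟩
  · have hsub : A.graph.outer p.2.toFinset ⊆ ((blockList b t c).toFinset.filter
        (· < p.1.length)).attach.image fun i : {i // i ∈ (blockList b t c).toFinset.filter (· < p.1.length)} =>
          p.1[(i : ℕ)]'(Finset.mem_filter.1 i.2).2 := by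
      intro x hx
      obtain ⟨hx, u, hu, hux⟩ := A.graph.mem_outer.1 hx
      rw [List.mem_toFinset] at hx hu
      obtain ⟨i, hi, rfl⟩ := List.getElem_of_mem (h6 u hu x hux)
      rw [Finset.mem_image]
      exact ⟨⟨i, Finset.mem_filter.2 ⟨List.mem_toFinset.2 (hproc i hi hx), hi⟩⟩, Finset.mem_attach _ _, rfl⟩
    refine (Finset.card_le_card hsub).trans (Finset.card_image_le.trans ?_)
    rw [Finset.card_attach]
    refine (Finset.card_filter_le _ _).trans ((List.toFinset_card_le _).trans ?_)
    simp [blockList]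
  · intro x hx
    rw [List.mem_toFinset]
    rcases Finset.mem_union.1 hx with hx | hx
    · exact hS x (List.mem_toFinset.1 hx)
    · obtain ⟨-, u, hu, hux⟩ := A.graph.mem_outer.1 hx
      exact h6 u (List.mem_toFinset.1 hu) x hux

/-- Every small linked set with few neighbours is found by some search. -/
theorem GraphInput.exists_codedSearch_eq {v : Fin n} {S : Finset (Fin n)} (hv : v ∈ S)
    (hS : A.graph.Linked S) (ht : (A.graph.outer S).card ≤ t)
    (hb : (S ∪ A.graph.outer S).card < b) :
    ∃ c < b ^ t, (A.codedSearch b t v c).1.length < b ∧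
      (A.codedSearch b t v c).2.toFinset = S := by
  -- The ideal search refuses exactly the vertices outside `S`. It expands all of `S` and meets
  -- nothing but `S` and its neighbours, so the refused positions number at most `t` and can be
  -- encoded.
  have hinv := A.searchInv (fun _ x => x ∉ S) v b
  set p := A.search (fun _ x => x ∉ S) v b with hp
  obtain ⟨h1, h2, h3, h4, h5, h6, h7, -⟩ := hinv
  have hpS : ∀ x ∈ p.2, x ∈ S := by
    intro x hx
    obtain ⟨i, hi, -, h, rfl⟩ := (h5 x).1 hx
    simpa using h
  have hq : p.1.toFinset ⊆ S ∪ A.graph.outer S := by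
    intro x hx
    rw [List.mem_toFinset] at hx
    rw [Finset.mem_union, A.graph.mem_outer]
    by_cases hxS : x ∈ S
    · exact .inl hxS
    · rcases h7 x hx with rfl | ⟨u, hu, hux⟩
      · exact absurd hv hxS
      · exact .inr ⟨hxS, u, hpS u hu, hux⟩
  have hlen : p.1.length < b := by
    rw [← List.toFinset_card_of_nodup h2]
    exact (Finset.card_le_card hq).trans_lt hb
  have hv2 : v ∈ p.1 := h1.subset (by simp)
  have hin : ∀ x ∈ p.1, x ∈ S → x ∈ p.2 := by
    intro x hx hxS
    obtain ⟨i, hi, rfl⟩ := List.getElem_of_mem hx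
    exact (h5 _).2 ⟨i, hi, by omega, by simpa using hxS, rfl⟩
  have hpeq : p.2.toFinset = S := by
    apply Finset.Subset.antisymm
    · intro x hx; exact hpS x (List.mem_toFinset.1 hx)
    · refine hS _ ⟨v, List.mem_toFinset.2 (hin v hv2 hv), hv⟩ fun x hx _ y hy hxy => ?_
      rw [List.mem_toFinset] at hx ⊢
      exact hin y (h6 x hx y hxy) hy
  -- the positions of the vertices outside `S`
  let I : Finset ℕ := (Finset.range p.1.length).filter fun i => ∃ h : i < p.1.length, p.1[i] ∉ S
  have hIcard : I.card ≤ t := by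
    refine le_trans ?_ ht
    refine Finset.card_le_card_of_injOn (fun i => if h : i < p.1.length then p.1[i] else v) ?_ ?_
    · intro i hi
      obtain ⟨-, hi, hiS⟩ := Finset.mem_filter.1 hi
      simp only [hi, dite_true]
      have := hq (List.mem_toFinset.2 (List.getElem_mem hi))
      exact (Finset.mem_union.1 this).resolve_left hiS
    · intro i hi j hj hij
      obtain ⟨-, hi, -⟩ := Finset.mem_filter.1 hi
      obtain ⟨-, hj, -⟩ := Finset.mem_filter.1 hj
      simp only [hi, hj, dite_true] at hij
      exact (h2.getElem_inj_iff).1 hij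
  have hIb : ∀ i ∈ I, i < b := fun i hi => by
    have := Finset.mem_range.1 (Finset.mem_filter.1 hi).1
    omega
  obtain ⟨c, hc, hcI⟩ := exists_blockList_eq (b := b) (t := t) fun j =>
    if h : (j : ℕ) < I.card then ⟨I.orderEmbOfFin rfl ⟨j, h⟩, hIb _ (Finset.orderEmbOfFin_mem _ _ _)⟩
    -- Unused digits are padded with `b - 1`, a position that the queue, of length less than `b`,
    -- never reaches.
    else ⟨b - 1, by omega⟩
  have hrun : A.codedSearch b t v c = p := by
    refine A.search_congr (P := fun _ x => x ∉ S) v b ?_ b le_rfl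
    intro i hi hib
    rw [hcI]
    have hI : p.1[i] ∉ S ↔ i ∈ I := by
      simp only [I, Finset.mem_filter, Finset.mem_range]
      exact ⟨fun h => ⟨hi, hi, h⟩, fun ⟨_, _, h⟩ => h⟩
    refine hI.trans ⟨fun h => ?_, ?_⟩
    · have : i ∈ Set.range (I.orderEmbOfFin rfl) := by
        rw [Finset.range_orderEmbOfFin]; exact h
      obtain ⟨j, hj⟩ := this
      refine ⟨⟨j, j.2.trans_le hIcard⟩, ?_⟩
      simp [hj]
    · rintro ⟨j, hj⟩
      by_cases h : (j : ℕ) < I.card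
      · simp only [h, dite_true] at hj
        rw [← hj]
        exact Finset.orderEmbOfFin_mem _ _ _
      · simp only [h, dite_false] at hj
        change i < p.1.length at hi
        omega
  exact ⟨c, hc, by rw [hrun]; exact hlen, by rw [hrun]; exact hpeq⟩

theorem GraphInput.nodup_findSet (v : Fin n) : (A.findSet D b t v).Nodup := by
  unfold findSet
  cases h : A.findUpTo D b t v (b ^ t) with
  | none => simp
  | some S =>
    obtain ⟨c, -, -, rfl⟩ := A.exists_accepts_of_findUpTo D b t h
    exact (A.searchInv _ v b).nodup_snd

theorem GraphInput.length_findSet_le (hb : 0 < b) (v : Fin n) :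
    (A.findSet D b t v).length ≤ b := by
  unfold findSet
  cases h : A.findUpTo D b t v (b ^ t) with
  | none => simpa using Nat.succ_le_of_lt hb
  | some S =>
    obtain ⟨c, -, -, rfl⟩ := A.exists_accepts_of_findUpTo D b t h
    exact (A.searchInv _ v b).length_snd

theorem GraphInput.findSet_of_none {v : Fin n} (h : A.findUpTo D b t v (b ^ t) = none) :
    A.findSet D b t v = [v] := by
  simp [findSet, h]

theorem GraphInput.findSet_of_ne_none {v : Fin n} (h : A.findUpTo D b t v (b ^ t) ≠ none) :
    v ∈ A.findSet D b t v ∧ A.graph.Linked (A.findSet D b t v).toFinset ∧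
    (A.graph.outer (A.findSet D b t v).toFinset).card ≤ t ∧
    ((A.findSet D b t v).toFinset ∪ A.graph.outer (A.findSet D b t v).toFinset).card < b ∧
    D * A.graph.cutSize (A.findSet D b t v).toFinset < (A.findSet D b t v).toFinset.card := by
  have hnd := A.nodup_findSet (D := D) (b := b) (t := t) v
  rw [← A.cutCount_eq hnd, List.toFinset_card_of_nodup hnd]
  unfold findSet
  obtain ⟨S, hS⟩ := Option.ne_none_iff_exists'.1 h
  rw [hS]
  obtain ⟨c, -, hacc, rfl⟩ := A.exists_accepts_of_findUpTo D b t hS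
  -- The strict inequality in `Accepts` excludes the empty set.
  obtain ⟨h1, h2, h3, h4⟩ := codedSearch_spec hacc.1
    (List.ne_nil_of_length_pos (by have := hacc.2; omega))
  refine ⟨h1, h2, h3, ?_, hacc.2⟩
  exact (Finset.card_le_card h4).trans_lt ((List.toFinset_card_le _).trans_lt hacc.1)

theorem GraphInput.self_mem_findSet (v : Fin n) : v ∈ A.findSet D b t v := by
  by_cases h : A.findUpTo D b t v (b ^ t) = none
  · simp [A.findSet_of_none h]
  · exact (A.findSet_of_ne_none h).1

/-- An earlier code may be accepted first, so the set returned need not be `S`; what matters is that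
`v` is not left with the default set. -/
theorem GraphInput.findUpTo_ne_none_of_isolated {v : Fin n} {S : Finset (Fin n)} (hv : v ∈ S)
    (hS : A.graph.Linked S) (ht : (A.graph.outer S).card ≤ t)
    (hb : (S ∪ A.graph.outer S).card < b) (hD : D * A.graph.cutSize S < S.card) :
    A.findUpTo D b t v (b ^ t) ≠ none := by
  obtain ⟨c, hc, h1, rfl⟩ := A.exists_codedSearch_eq hv hS ht hb
  have hnd := (A.searchInv (fun i _ => i ∈ blockList b t c) v b).nodup_snd
  rw [← A.cutCount_eq hnd, List.toFinset_card_of_nodup hnd] at hD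
  exact A.findUpTo_ne_none D b t hc ⟨h1, hD⟩

/-- Being isolated does not depend on the starting point: the set found from `y` is also found from
each of its members `v`, under another code, and that search meets `y`. For a default set `y = v`,
and code `0`, which blocks position `0`, gives a completed search that meets just `v`. This makes
the candidates for the winner at `v` computable from `v`. -/
theorem GraphInput.mem_collect_of_mem_findSet (hb : 1 < b) (ht : 0 < t) {v y : Fin n}
    (h : v ∈ A.findSet D b t y) : y ∈ A.collectUpTo b t v (b ^ t) := by
  rw [mem_collectUpTo]
  by_cases hy : A.findUpTo D b t y (b ^ t) = none
  · rw [A.findSet_of_none hy, List.mem_singleton] at h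
    subst h
    refine ⟨0, by positivity, ?_⟩
    have h0 : ∀ k, A.search (fun i _ => i ∈ blockList b t 0) v k = ([v], []) := by
      intro k
      induction k with
      | zero => rfl
      | succ k ih =>
        rw [search, ih, searchStep]
        split_ifs with h1 h2
        · rfl
        · exfalso
          simp only [List.length_singleton, Nat.lt_one_iff] at h1
          subst h1
          exact h2 (by simpa [blockList] using ht.ne')
        · rfl
    unfold codedSearch
    rw [h0]
    simpa using hb
  · obtain ⟨h1, h2, h3, h4, -⟩ := A.findSet_of_ne_none hy
    obtain ⟨c, hc, h5, h6⟩ := A.exists_codedSearch_eq (List.mem_toFinset.2 h) h2 h3 h4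
    refine ⟨c, hc, h5, ?_⟩
    have : y ∈ (A.codedSearch b t v c).2 := by
      rw [← List.mem_toFinset, h6, List.mem_toFinset]; exact h1
    obtain ⟨i, hi, -, -, rfl⟩ := ((A.searchInv _ v b).mem_snd y).1 this
    exact List.getElem_mem hi

/-! ### Winners and parts -/

section Winner

variable (A D b t) (ω : Coins) (B : ℕ)

/-- `y` has a higher priority than `z`. -/
def Beats (y z : Fin n) : Prop :=
  coinKey ω y B < coinKey ω z B ∨ (coinKey ω y B = coinKey ω z B ∧ y < z)

instance (y z : Fin n) : Decidable (Beats ω B y z) := by unfold Beats; infer_instance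

/-- The vertex of the highest priority among those in a list whose set contains `x`. -/
def GraphInput.best (x z : Fin n) : List (Fin n) → Fin n
  | [] => z
  | y :: l => GraphInput.best x (if x ∈ A.findSet D b t y ∧ Beats ω B y z then y else z) l

/-- The vertex of the highest priority among those whose set contains `x`. -/
def GraphInput.winner (x : Fin n) : Fin n :=
  A.best D b t ω B x x (A.collectUpTo b t x (b ^ t))

/-- The part of `v`. -/
def GraphInput.partList (v : Fin n) : List (Fin n) :=
  (A.findSet D b t (A.winner D b t ω B v)).filter
    fun x => A.winner D b t ω B x = A.winner D b t ω B v

variable {A D b t ω B}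

theorem Beats.trans {x y z : Fin n} (h : Beats ω B x y) (h' : Beats ω B y z) : Beats ω B x z := by
  unfold Beats at *
  omega

theorem Beats.irrefl (x : Fin n) : ¬ Beats ω B x x := by
  unfold Beats
  omega

theorem Beats.total {x y : Fin n} (h : x ≠ y) : Beats ω B x y ∨ Beats ω B y x := by
  unfold Beats
  omega

theorem GraphInput.best_spec (x : Fin n) (l : List (Fin n)) : ∀ z, x ∈ A.findSet D b t z →
    x ∈ A.findSet D b t (A.best D b t ω B x z l) ∧
    ¬ Beats ω B z (A.best D b t ω B x z l) ∧
    ∀ y ∈ l, x ∈ A.findSet D b t y → ¬ Beats ω B y (A.best D b t ω B x z l) := by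
  induction l with
  | nil => exact fun z hz => ⟨hz, Beats.irrefl z, by simp⟩
  | cons y l ih =>
    intro z hz
    rw [best]
    split_ifs with h
    · obtain ⟨h1, h2, h3⟩ := ih y h.1
      refine ⟨h1, fun hz' => h2 (h.2.trans hz'), fun u hu hxu => ?_⟩
      rcases List.mem_cons.1 hu with rfl | hu
      · exact h2
      · exact h3 u hu hxu
    · obtain ⟨h1, h2, h3⟩ := ih z hz
      refine ⟨h1, h2, fun u hu hxu => ?_⟩
      rcases List.mem_cons.1 hu with rfl | hu
      · intro hu'
        have hzu : ¬ Beats ω B u z := fun h' => h ⟨hxu, h'⟩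
        by_cases huz : u = z
        · exact h2 (huz ▸ hu')
        · exact h2 (((Beats.total huz).resolve_left hzu).trans hu')
      · exact h3 u hu hxu

/-- Only collected vertices are compared, but every vertex whose set contains `x` has been
collected, so the local winner is the global one. -/
theorem GraphInput.winner_spec (hb : 1 < b) (ht : 0 < t) (x : Fin n) :
    x ∈ A.findSet D b t (A.winner D b t ω B x) ∧
    ∀ y, x ∈ A.findSet D b t y → ¬ Beats ω B y (A.winner D b t ω B x) := by
  obtain ⟨h1, -, h3⟩ := A.best_spec (ω := ω) (B := B) x (A.collectUpTo b t x (b ^ t)) x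
    (A.self_mem_findSet x)
  exact ⟨h1, fun y hy => h3 y (A.mem_collect_of_mem_findSet hb ht hy) hy⟩

/-- Every `x` lies in the set of its own winner, so filtering the set of one winner loses nothing
and the parts are exactly the fibres of the winner map. -/
theorem GraphInput.mem_partList (hb : 1 < b) (ht : 0 < t) {v x : Fin n} :
    x ∈ A.partList D b t ω B v ↔ A.winner D b t ω B x = A.winner D b t ω B v := by
  unfold partList
  rw [List.mem_filter, decide_eq_true_iff]
  exact ⟨fun h => h.2, fun h => ⟨h ▸ (A.winner_spec hb ht x).1, h⟩⟩

theorem GraphInput.card_coveredBy_findSet_le (hb : 1 < b) (ht : 0 < t) (u : Fin n) :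
    (coveredBy (fun v => (A.findSet D b t v).toFinset) u).card ≤ b ^ t * b := by
  refine le_trans (Finset.card_le_card (t := (A.collectUpTo b t u (b ^ t)).toFinset) ?_)
    ((List.toFinset_card_le _).trans (A.length_collectUpTo_le b t u _))
  intro y hy
  rw [mem_coveredBy, List.mem_toFinset] at hy
  exact List.mem_toFinset.2 (A.mem_collect_of_mem_findSet hb ht hy)

end Winner

end Partition

/-! ### Choice of the parameters -/

section Parameters

/-- The number of steps after which `1, 2, 4, …` has exceeded `x`. -/
def logParam (x : ℕ) : ℕ := Nat.clog 2 x + 1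

/-- The bound on the number of vertices met in a search. -/
def sizeParam (d h m : ℕ) : ℕ := 2 ^ (40 * (h + 1)) * logParam (d * m) * d * d * m * m

/-- The reciprocal of the fraction of edges that may leave an isolated set. -/
def cutParam (d h m : ℕ) : ℕ := 2 ^ (25 * (h + 1)) * logParam (d * m) * m

theorem le_two_pow_logParam (x : ℕ) : x ≤ 2 ^ (logParam x - 1) :=
  Nat.le_pow_clog (by norm_num) x

theorem one_le_logParam (x : ℕ) : 1 ≤ logParam x := by unfold logParam; omega

theorem two_pow_le_sizeParam {d h m : ℕ} (hd : 1 ≤ d) (hm : 1 ≤ m) :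
    2 ^ (40 * (h + 1)) ≤ sizeParam d h m := by
  unfold sizeParam
  have h1 := one_le_logParam (d * m)
  calc 2 ^ (40 * (h + 1)) = 2 ^ (40 * (h + 1)) * 1 * 1 * 1 * 1 * 1 := by ring
    _ ≤ _ := by gcongr

/-- With `L = logParam (d * m)`, the factors `L`, `d * m` and `d * m` are at most `2 ^ L` each. -/
theorem sizeParam_le_two_pow (d h m : ℕ) :
    sizeParam d h m ≤ 2 ^ (43 * (h + 1) * logParam (d * m)) := by
  unfold sizeParam
  have h1 := one_le_logParam (d * m)
  have h2 := le_two_pow_logParam (d * m)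
  set L := logParam (d * m)
  have h3 : L ≤ 2 ^ L := Nat.lt_two_pow_self.le
  have h4 : d * m ≤ 2 ^ L := h2.trans (Nat.pow_le_pow_right (by norm_num) (by omega))
  calc 2 ^ (40 * (h + 1)) * L * d * d * m * m = 2 ^ (40 * (h + 1)) * L * (d * m) * (d * m) := by ring
    _ ≤ 2 ^ (40 * (h + 1)) * 2 ^ L * 2 ^ L * 2 ^ L := by gcongr
    _ = 2 ^ (40 * (h + 1) + L + L + L) := by rw [pow_add, pow_add, pow_add]
    _ ≤ _ := Nat.pow_le_pow_right (by norm_num) (by nlinarith [Nat.zero_le h])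

theorem succ_le_two_pow (h : ℕ) : h + 1 ≤ 2 ^ (h + 1) := Nat.lt_two_pow_self.le

/-- The logarithm of the cover bound depends on `d` and `m` only through `logParam (d * m)`. Thus
`cutParam` can be fixed without reference to `sizeParam`, and `sizeParam` afterwards. -/
theorem log_coverParam_le (d h m : ℕ) :
    Nat.log 2 (sizeParam d h m ^ (2 * h + 2) * sizeParam d h m) + 1 ≤
      130 * (h + 1) ^ 2 * logParam (d * m) := by
  have h1 := one_le_logParam (d * m)
  have hb := sizeParam_le_two_pow d h m
  set L := logParam (d * m)
  set b := sizeParam d h m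
  have h2 : b ^ (2 * h + 2) * b ≤ 2 ^ (43 * (h + 1) * L * (2 * h + 3)) := by
    rw [← pow_succ, pow_mul]
    exact Nat.pow_le_pow_left hb _
  have h3 : Nat.log 2 (b ^ (2 * h + 2) * b) ≤ 43 * (h + 1) * L * (2 * h + 3) := by
    generalize 43 * (h + 1) * L * (2 * h + 3) = e at h2
    have := Nat.log_mono_right (b := 2) h2
    rwa [Nat.log_pow (by norm_num)] at this
  generalize Nat.log 2 (b ^ (2 * h + 2) * b) = l at h3
  have h4 : 43 * (h + 1) * L * (2 * h + 3) ≤ 43 * (h + 1) * L * (3 * (h + 1)) :=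
    Nat.mul_le_mul_left _ (by omega)
  have h5 : 1 * 1 ≤ (h + 1) ^ 2 * L := Nat.mul_le_mul (Nat.one_le_pow _ _ (by omega)) h1
  calc l + 1 ≤ 43 * (h + 1) * L * (3 * (h + 1)) + 1 := Nat.succ_le_succ (h3.trans h4)
    _ = 129 * ((h + 1) ^ 2 * L) + 1 := by ring
    _ ≤ 130 * ((h + 1) ^ 2 * L) := by omega
    _ = _ := by ring

/-- Makes the charging bound, with the tie term counted as one, at most a `1 / (20 * m)` fraction of
`D`. -/
theorem cutParam_bound (d h m : ℕ) :
    20 * m * (4 * 4 ^ (2 * h + 2 + 1) *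
      (Nat.log 2 (sizeParam d h m ^ (2 * h + 2) * sizeParam d h m) + 1) + 1) ≤ cutParam d h m := by
  have h1 := one_le_logParam (d * m)
  have h2 := log_coverParam_le d h m
  unfold cutParam
  set L := logParam (d * m)
  have h3 := succ_le_two_pow h
  have h5 : 1 * 1 ≤ (h + 1) ^ 2 * L := Nat.mul_le_mul (Nat.one_le_pow _ _ (by omega)) h1
  have h4 : (4 * 4 ^ (2 * h + 2 + 1) : ℕ) = 16 * 2 ^ (4 * (h + 1)) := by
    rw [show (4 : ℕ) = 2 ^ 2 by norm_num, ← pow_mul]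
    ring
  rw [h4]
  have h7 : 1 ≤ 2 ^ (4 * (h + 1)) := Nat.one_le_two_pow
  calc 20 * m * (16 * 2 ^ (4 * (h + 1)) * _ + 1)
      ≤ 20 * m * (16 * 2 ^ (4 * (h + 1)) * (130 * (h + 1) ^ 2 * L) +
          2 ^ (4 * (h + 1)) * ((h + 1) ^ 2 * L)) := by
        gcongr
        exact Nat.mul_pos h7 h5
    _ = 41620 * (2 ^ (4 * (h + 1)) * (h + 1) ^ 2) * L * m := by ring
    _ ≤ 2 ^ (19 * (h + 1)) * (2 ^ (4 * (h + 1)) * (2 ^ (h + 1)) ^ 2) * L * m := by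
        gcongr
        calc 41620 ≤ 2 ^ 19 := by norm_num
          _ ≤ _ := Nat.pow_le_pow_right (by norm_num) (by omega)
    _ = 2 ^ (25 * (h + 1)) * L * m := by
        rw [← pow_mul, ← pow_add, ← pow_add]
        congr 3
        ring

/-- Makes the edges at vertices without an isolated set at most `n / (20 * m)`; the last factor `2`
allows for the use of `K = b / 2`. -/
theorem sizeParam_bound {d h m : ℕ} (hd : 1 ≤ d) (hm : 1 ≤ m) :
    20 * m * (d * ((1 + cutParam d h m * d) * (2 * (h + 1)))) * 2 ≤ sizeParam d h m := by
  have h1 := one_le_logParam (d * m)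
  unfold cutParam sizeParam
  set L := logParam (d * m)
  have h3 := succ_le_two_pow h
  have h6 : 1 ≤ 2 ^ (25 * (h + 1)) * L * m * d := by
    have : 1 ≤ 2 ^ (25 * (h + 1)) := Nat.one_le_two_pow
    exact Nat.mul_pos (Nat.mul_pos (Nat.mul_pos this h1) hm) hd
  calc _ ≤ 20 * m * (d * ((2 ^ (25 * (h + 1)) * L * m * d + 2 ^ (25 * (h + 1)) * L * m * d) * (2 * (h + 1)))) * 2 := by
        gcongr
    _ = 160 * (2 ^ (25 * (h + 1)) * (h + 1)) * L * d * d * m * m := by ring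
    _ ≤ 2 ^ (14 * (h + 1)) * (2 ^ (25 * (h + 1)) * 2 ^ (h + 1)) * L * d * d * m * m := by
        gcongr
        calc 160 ≤ 2 ^ 14 := by norm_num
          _ ≤ _ := Nat.pow_le_pow_right (by norm_num) (by omega)
    _ = _ := by
        rw [← pow_add, ← pow_add]
        congr 6
        ring

theorem mul_le_sizeParam {d h m : ℕ} (hd : 1 ≤ d) (hm : 1 ≤ m) :
    2 ^ 30 * (h + 1) ≤ sizeParam d h m := by
  refine le_trans ?_ (two_pow_le_sizeParam hd hm)
  calc 2 ^ 30 * (h + 1) ≤ 2 ^ (30 * (h + 1)) * 2 ^ (h + 1) :=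
        Nat.mul_le_mul (Nat.pow_le_pow_right (by norm_num) (by omega)) (succ_le_two_pow h)
    _ = 2 ^ (31 * (h + 1)) := by rw [← pow_add]; congr 1; ring
    _ ≤ _ := Nat.pow_le_pow_right (by norm_num) (by omega)

/-- Keys of `b * b` bits make the contribution of ties, the square of the cover bound times `2⁻¹ ^
(b * b)`, at most one. -/
theorem coverParam_sq_le {b t : ℕ} (ht : 2 * t + 2 ≤ b) :
    (b ^ t * b) * (b ^ t * b) ≤ 2 ^ (b * b) := by
  calc (b ^ t * b) * (b ^ t * b) = b ^ (2 * t + 2) := by ring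
    _ ≤ (2 ^ b) ^ (2 * t + 2) := Nat.pow_le_pow_left Nat.lt_two_pow_self.le _
    _ = 2 ^ (b * (2 * t + 2)) := by rw [← pow_mul]
    _ ≤ _ := Nat.pow_le_pow_right (by norm_num) (Nat.mul_le_mul_left _ ht)

/-- The parts have few edges between them. -/
theorem GraphInput.le_coinMeasure_cutEdges_partList {n : ℕ} (A : GraphInput n) {d h m : ℕ} {ε : ℝ}
    (hd1 : 1 ≤ d) (hm : 1 ≤ m) (hmε : 1 / (m : ℝ) ≤ ε) (hd : ∀ v, A.degree v ≤ d)
    (hA : treewidth A.graph ≤ h) :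
    9 / 10 ≤ coinMeasure {ω | ((A.cutEdges fun v =>
      (A.partList (cutParam d h m) (sizeParam d h m) (2 * h + 2) ω
        (sizeParam d h m * sizeParam d h m) v).toFinset).ncard : ℝ) ≤ ε * n} := by
  classical
  have hb30 := mul_le_sizeParam (h := h) hd1 hm
  have hDb := cutParam_bound d h m
  have hbb := sizeParam_bound (h := h) hd1 hm
  set b := sizeParam d h m with hb
  set D := cutParam d h m with hDdef
  have hb1 : 1 < b := by omega
  have ht : 0 < 2 * h + 2 := by omega
  have hD : 0 < D := lt_of_lt_of_le (by positivity) hDb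
  have hmR : (0 : ℝ) < m := by exact_mod_cast hm
  have hε : 0 < ε := lt_of_lt_of_le (by positivity) hmε
  let T : Finset (Fin n) := Finset.univ.filter fun v => A.findUpTo D b (2 * h + 2) v (b ^ (2 * h + 2)) ≠ none
  refine A.le_coinMeasure_cutEdges (t := 2 * h + 2) (M := b ^ (2 * h + 2) * b) (D := D) (B := b * b)
    (S := fun v => (A.findSet D b (2 * h + 2) v).toFinset) (T := T) hε hD hd ?_ ?_ ?_ ?_ ?_ ?_
    (fun ω => A.winner D b (2 * h + 2) ω (b * b)) ?_ _ ?_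
  · exact fun v => List.mem_toFinset.2 (A.self_mem_findSet v)
  · intro v hv
    simp only [T, Finset.mem_filter, Finset.mem_univ, true_and, not_not] at hv
    simp [A.findSet_of_none hv]
  · intro v hv
    simp only [T, Finset.mem_filter, Finset.mem_univ, true_and] at hv
    obtain ⟨-, h1, h2, -⟩ := A.findSet_of_ne_none hv
    exact ⟨h1, h2⟩
  · intro v hv
    simp only [T, Finset.mem_filter, Finset.mem_univ, true_and] at hv
    exact (A.findSet_of_ne_none hv).2.2.2.2.le
  · exact A.card_coveredBy_findSet_le hb1 ht
  -- The budget `ε * n / 10` is split evenly between the vertices outside `T` and the charging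
  -- bound. With `K = b / 2`, an isolated set and its neighbours have at most `b / 2 + 3 * (h + 1)`
  -- vertices, which is less than `b`.
  · obtain ⟨Bad, hBad, hgood⟩ := exists_isolated_of_treewidth_le (K := b / 2) D hA (by omega)
      (A.card_adj_le hd)
    have hsub : Finset.univ \ T ⊆ Bad := by
      intro v hv
      by_contra hvB
      simp only [T, Finset.mem_sdiff, Finset.mem_filter, Finset.mem_univ, true_and, not_not] at hv
      obtain ⟨S, h1, h2, h3, h4, h5⟩ := hgood v hvB
      refine A.findUpTo_ne_none_of_isolated (t := 2 * h + 2) h1 h2 (by omega) ?_ h5 hv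
      have := Finset.card_union_le S (A.graph.outer S)
      omega
    rw [Fintype.card_fin] at hBad
    have hbad : 20 * m * (d * (Finset.univ \ T).card) ≤ n := by
      have h1 := Finset.card_le_card hsub
      have hK : 20 * m * (d * ((1 + D * d) * (2 * (h + 1)))) ≤ b / 2 := by omega
      have hK0 : 0 < b / 2 := by omega
      refine Nat.le_of_mul_le_mul_left ?_ hK0
      calc b / 2 * (20 * m * (d * (Finset.univ \ T).card))
          ≤ b / 2 * (20 * m * (d * Bad.card)) := by gcongr
        _ = 20 * m * d * (b / 2 * Bad.card) := by ring
        _ ≤ 20 * m * d * ((1 + D * d) * (2 * (h + 1) * n)) := Nat.mul_le_mul_left _ hBad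
        _ = 20 * m * (d * ((1 + D * d) * (2 * (h + 1)))) * n := by ring
        _ ≤ _ := Nat.mul_le_mul_right _ hK
    have hfirst : (d : ℝ) * (Finset.univ \ T).card ≤ ε * n / 20 := by
      have h1 : (20 * m * (d * (Finset.univ \ T).card) : ℝ) ≤ n := by exact_mod_cast hbad
      have h2 : (n : ℝ) / m ≤ ε * n := by
        rw [div_eq_mul_one_div, mul_comm]
        exact mul_le_mul_of_nonneg_right hmε (by positivity)
      have h3 : (20 * (d * (Finset.univ \ T).card) : ℝ) ≤ n / m := by
        rw [le_div_iff₀ hmR]; linarith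
      linarith
    have hsecond : ((4 * 4 ^ (2 * h + 2 + 1) * (Nat.log 2 (b ^ (2 * h + 2) * b) + 1) +
        (b ^ (2 * h + 2) * b : ℕ) * ((b ^ (2 * h + 2) * b : ℕ) * 2⁻¹ ^ (b * b))) / D : ℝ) ≤ ε / 20 := by
      have h1 : (((b ^ (2 * h + 2) * b : ℕ) : ℝ) * ((b ^ (2 * h + 2) * b : ℕ) * 2⁻¹ ^ (b * b))) ≤ 1 := by
        rw [← mul_assoc, inv_pow, ← div_eq_mul_inv, div_le_one (by positivity)]
        exact_mod_cast coverParam_sq_le (b := b) (t := 2 * h + 2) (by omega)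
      have h2 : (20 * m * (4 * 4 ^ (2 * h + 2 + 1) *
          (Nat.log 2 (b ^ (2 * h + 2) * b) + 1) + 1) : ℝ) ≤ D := by exact_mod_cast hDb
      have hD' : (0 : ℝ) < D := by exact_mod_cast hD
      rw [div_le_iff₀ hD']
      have h3 : 1 ≤ ε * m := by rwa [div_le_iff₀ hmR] at hmε
      set Y := (4 * 4 ^ (2 * h + 2 + 1) * (Nat.log 2 (b ^ (2 * h + 2) * b) + 1) : ℝ)
      have hY : (0 : ℝ) ≤ Y := by positivity
      have h4 : 20 * (Y + 1) ≤ ε * D := by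
        calc 20 * (Y + 1) = 1 * (20 * (Y + 1)) := by ring
          _ ≤ ε * m * (20 * (Y + 1)) := mul_le_mul_of_nonneg_right h3 (by positivity)
          _ = ε * (20 * m * (Y + 1)) := by ring
          _ ≤ _ := mul_le_mul_of_nonneg_left h2 hε.le
      linarith
    have hn0 : (0 : ℝ) ≤ n := Nat.cast_nonneg n
    have := mul_le_mul_of_nonneg_left hsecond hn0
    linarith
  · intro ω u
    obtain ⟨h1, h2⟩ := A.winner_spec (D := D) (ω := ω) (B := b * b) hb1 ht u
    refine ⟨mem_coveredBy.2 (List.mem_toFinset.2 h1), fun u' hu' => ?_⟩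
    have := h2 u' (List.mem_toFinset.1 (mem_coveredBy.1 hu'))
    unfold Beats at this
    rw [Fin.le_def]
    omega
  · intro ω u v huv
    ext x
    simp only [List.mem_toFinset]
    rw [A.mem_partList hb1 ht, A.mem_partList hb1 ht]
    rw [huv]

end Parameters

/-! ### A Hoare logic with time bounds -/

section Logic

/-- `P` may store something in register `r`. -/
def Program.wr : Program → ℕ → Bool
  | .const x _, r => r == x
  | .add x _ _, r => r == x
  | .sub x _ _, r => r == x
  | .read x _ _, r => r == x
  | .write _ _ _, _ => false
  | .degQuery x _, r => r == x
  | .nbrQuery x _ _, r => r == x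
  | .toss x _, r => r == x
  | .seq P R, r => P.wr r || R.wr r
  | .cond _ P R, r => P.wr r || R.wr r
  | .loop _ P, r => P.wr r

/-- `P` may store something in array `a`. -/
def Program.wa : Program → ℕ → Bool
  | .write b _ _, a => a == b
  | .seq P R, a => P.wa a || R.wa a
  | .cond _ P R, a => P.wa a || R.wa a
  | .loop _ P, a => P.wa a
  | _, _ => false

/-- `P` may toss coins. -/
def Program.wt : Program → Bool
  | .toss _ _ => true
  | .seq P R => P.wt || R.wt
  | .cond _ P R => P.wt || R.wt
  | .loop _ P => P.wt
  | _ => false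

/-- `s'` agrees with `s` outside what `P` may change. -/
structure Frame (P : Program) (s s' : MState) : Prop where
  reg : ∀ r, P.wr r = false → s'.reg r = s.reg r
  arr : ∀ a, P.wa a = false → s'.arr a = s.arr a
  tossed : P.wt = false → s'.tossed = s.tossed

theorem Frame.refl (P : Program) (s : MState) : Frame P s s :=
  ⟨fun _ _ => rfl, fun _ _ => rfl, fun _ => rfl⟩

theorem Frame.trans {P : Program} {s s' s'' : MState} (h : Frame P s s') (h' : Frame P s' s'') :
    Frame P s s'' :=
  ⟨fun r hr => (h'.reg r hr).trans (h.reg r hr), fun a ha => (h'.arr a ha).trans (h.arr a ha),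
    fun ht => (h'.tossed ht).trans (h.tossed ht)⟩

theorem Frame.mono {P R : Program} {s s' : MState} (h : Frame P s s')
    (hr : ∀ r, R.wr r = false → P.wr r = false) (ha : ∀ a, R.wa a = false → P.wa a = false)
    (ht : R.wt = false → P.wt = false) : Frame R s s' :=
  ⟨fun r h' => h.reg r (hr r h'), fun a h' => h.arr a (ha a h'), fun h' => h.tossed (ht h')⟩

theorem MState.set_reg (s : MState) (x c r : ℕ) :
    (s.set x c).reg r = if r = x then c else s.reg r := by
  simp [MState.set, Function.update_apply]

theorem MState.set_arr (s : MState) (x c : ℕ) : (s.set x c).arr = s.arr := rfl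

theorem MState.set_tossed (s : MState) (x c : ℕ) : (s.set x c).tossed = s.tossed := rfl

theorem MState.setArr_reg (s : MState) (a i c : ℕ) : (s.setArr a i c).reg = s.reg := rfl

theorem MState.setArr_tossed (s : MState) (a i c : ℕ) : (s.setArr a i c).tossed = s.tossed := rfl

theorem MState.setArr_arr (s : MState) (a i c a' i' : ℕ) :
    (s.setArr a i c).arr a' i' = if a' = a then (if i' = i then c else s.arr a' i')
      else s.arr a' i' := by
  by_cases h : a' = a
  · subst h; simp [MState.setArr, Function.update_apply]
  · simp [MState.setArr, h]

theorem MState.tick_reg (s : MState) (i : ℕ) : (s.tick i).reg = s.reg := rfl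

theorem MState.tick_tossed (s : MState) (i j : ℕ) :
    (s.tick i).tossed j = if j = i then s.tossed i + 1 else s.tossed j := by
  simp [MState.tick, Function.update_apply]

variable {n : ℕ} {A : GraphInput n} {ω : Coins}

/-- What a program may change is read off its syntax by a Boolean function, so preservation of
registers and arrays can mostly be checked by `rfl`. -/
theorem Run.frame {P : Program} {s s' : MState} {t c : ℕ} (h : Run A ω P s t c s') :
    Frame P s s' := by
  induction h with
  | const | add | sub | read | degQuery | nbrQuery =>
    refine ⟨fun r hr => ?_, fun _ _ => rfl, fun _ => rfl⟩
    rw [MState.set_reg, if_neg (by simpa [Program.wr] using hr)]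
  | write s a y x =>
    refine ⟨fun _ _ => rfl, fun b hb => ?_, fun _ => rfl⟩
    have : b ≠ a := by simpa [Program.wa] using hb
    simp [MState.setArr, this]
  | toss s x y =>
    refine ⟨fun r hr => ?_, fun _ _ => rfl, fun h => by simp [Program.wt] at h⟩
    rw [MState.set_reg, if_neg (by simpa [Program.wr] using hr)]
    rfl
  | seq _ _ ih ih' =>
    refine (ih.mono ?_ ?_ ?_).trans (ih'.mono ?_ ?_ ?_) <;>
      simp +contextual [Program.wr, Program.wa, Program.wt]
  | cond_true _ _ _ ih =>
    refine ih.mono ?_ ?_ ?_ <;> simp +contextual [Program.wr, Program.wa, Program.wt]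
  | cond_false _ _ _ ih =>
    refine ih.mono ?_ ?_ ?_ <;> simp +contextual [Program.wr, Program.wa, Program.wt]
  | loop_done _ _ => exact Frame.refl _ _
  | loop_step _ _ _ ih ih' =>
    refine Frame.trans ?_ ih'
    exact ih.mono (fun _ h => h) (fun _ h => h) (fun h => h)

/-- A query takes one unit of time, so bounds on the running time also bound the number of queries.
-/
theorem Run.queries_le {P : Program} {s s' : MState} {t c : ℕ} (h : Run A ω P s t c s') :
    c ≤ t := by
  induction h <;> omega

/-- With the coins fixed the machine is deterministic. Hence the runs supplied by `After` reach the
same states as the runs constructed here. -/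
theorem Run.unique {P : Program} {s s₁ : MState} {t c : ℕ} (h : Run A ω P s t c s₁) :
    ∀ {s₂ : MState} {t' c' : ℕ}, Run A ω P s t' c' s₂ → s₁ = s₂ := by
  induction h with
  | const | add | sub | read | write | toss => intro s₂ t' c' h'; cases h'; rfl
  | degQuery s x y v hv =>
    intro s₂ t' c' h'
    cases h' with
    | degQuery _ _ _ v' hv' =>
      have : v = v' := Fin.ext (hv.symm.trans hv')
      rw [this]
  | nbrQuery s x y z v hv j hz hj =>
    intro s₂ t' c' h'
    cases h' with
    | nbrQuery _ _ _ _ v' hv' j' hz' hj' =>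
      have h1 : v = v' := Fin.ext (hv.symm.trans hv')
      have h2 : j = j' := by omega
      subst h1 h2
      rfl
  | seq _ _ ih ih' =>
    intro s₂ t' c' h'
    cases h' with
    | seq h1 h2 =>
      have := ih h1
      subst this
      exact ih' h2
  | cond_true R hx _ ih =>
    intro s₂ t' c' h'
    cases h' with
    | cond_true _ _ h1 => exact ih h1
    | cond_false _ hx' _ => exact absurd hx' hx
  | cond_false P hx _ ih =>
    intro s₂ t' c' h'
    cases h' with
    | cond_true _ hx' _ => exact absurd hx hx'
    | cond_false _ _ h1 => exact ih h1
  | loop_done P hx =>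
    intro s₂ t' c' h'
    cases h' with
    | loop_done => rfl
    | loop_step hx' _ _ => exact absurd hx hx'
  | loop_step hx _ _ ih ih' =>
    intro s₂ t' c' h'
    cases h' with
    | loop_done _ hx' => exact absurd hx' hx
    | loop_step _ h1 h2 =>
      have := ih h1
      subst this
      exact ih' h2

variable (A ω) in
/-- Started in `s`, the program `P` halts within time `T` in a state with property `Q`. -/
def Ends (P : Program) (s : MState) (T : ℕ) (Q : MState → Prop) : Prop :=
  ∃ t c s', Run A ω P s t c s' ∧ t ≤ T ∧ Q s'

theorem Ends.mono {P : Program} {s : MState} {T T' : ℕ} {Q Q' : MState → Prop}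
    (h : Ends A ω P s T Q) (hT : T ≤ T') (hQ : ∀ s', Frame P s s' → Q s' → Q' s') :
    Ends A ω P s T' Q' := by
  obtain ⟨t, c, s', hr, ht, hs⟩ := h
  exact ⟨t, c, s', hr, ht.trans hT, hQ _ hr.frame hs⟩

theorem Ends.le {P : Program} {s : MState} {T T' : ℕ} {Q : MState → Prop}
    (h : Ends A ω P s T Q) (hT : T ≤ T') : Ends A ω P s T' Q :=
  h.mono hT fun _ _ h => h

theorem Ends.seq {P R : Program} {s : MState} {T T' : ℕ} {Q Q' : MState → Prop}
    (h : Ends A ω P s T Q) (h' : ∀ s', Frame P s s' → Q s' → Ends A ω R s' T' Q') :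
    Ends A ω (.seq P R) s (T + T') Q' := by
  obtain ⟨t, c, s', hr, ht, hs⟩ := h
  obtain ⟨t', c', s'', hr', ht', hs'⟩ := h' s' hr.frame hs
  exact ⟨_, _, s'', .seq hr hr', add_le_add ht ht', hs'⟩

theorem Ends.then {P R : Program} {s : MState} {T T' T'' : ℕ} {Q Q' : MState → Prop}
    (h : Ends A ω P s T Q) (hT : T + T' ≤ T'')
    (h' : ∀ s', Frame P s s' → Q s' → Ends A ω R s' T' Q') : Ends A ω (.seq P R) s T'' Q' :=
  (h.seq h').le hT

section Basic

variable {s : MState} {Q : MState → Prop} {T : ℕ} {R : Program}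

theorem Ends.const {x c : ℕ} (h : Q (s.set x c)) : Ends A ω (.const x c) s (T + 1) Q :=
  ⟨1, 0, _, .const s x c, by omega, h⟩

theorem Ends.add {x y z : ℕ} (h : Q (s.set x (s.reg y + s.reg z))) :
    Ends A ω (.add x y z) s (T + 1) Q := ⟨1, 0, _, .add s x y z, by omega, h⟩

theorem Ends.sub {x y z : ℕ} (h : Q (s.set x (s.reg y - s.reg z))) :
    Ends A ω (.sub x y z) s (T + 1) Q := ⟨1, 0, _, .sub s x y z, by omega, h⟩

theorem Ends.write {a y x : ℕ} (h : Q (s.setArr a (s.reg y) (s.reg x))) :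
    Ends A ω (.write a y x) s (T + 1) Q := ⟨1, 0, _, .write s a y x, by omega, h⟩

theorem Run.seq_ends {P : Program} {s' : MState} {c : ℕ} (h : Run A ω P s 1 c s')
    (h' : Ends A ω R s' T Q) : Ends A ω (.seq P R) s (T + 1) Q := by
  obtain ⟨t', c', s'', hr', ht', hs'⟩ := h'
  exact ⟨_, _, s'', .seq h hr', by omega, hs'⟩

theorem Ends.const_seq {x c : ℕ} (h : Ends A ω R (s.set x c) T Q) :
    Ends A ω (.seq (.const x c) R) s (T + 1) Q := (Run.const s x c).seq_ends h

theorem Ends.add_seq {x y z : ℕ} (h : Ends A ω R (s.set x (s.reg y + s.reg z)) T Q) :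
    Ends A ω (.seq (.add x y z) R) s (T + 1) Q := (Run.add s x y z).seq_ends h

theorem Ends.sub_seq {x y z : ℕ} (h : Ends A ω R (s.set x (s.reg y - s.reg z)) T Q) :
    Ends A ω (.seq (.sub x y z) R) s (T + 1) Q := (Run.sub s x y z).seq_ends h

theorem Ends.read_seq {x a y : ℕ} (h : Ends A ω R (s.set x (s.arr a (s.reg y))) T Q) :
    Ends A ω (.seq (.read x a y) R) s (T + 1) Q := (Run.read s x a y).seq_ends h

theorem Ends.write_seq {a y x : ℕ} (h : Ends A ω R (s.setArr a (s.reg y) (s.reg x)) T Q) :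
    Ends A ω (.seq (.write a y x) R) s (T + 1) Q := (Run.write s a y x).seq_ends h

theorem Ends.degQuery_seq {x y : ℕ} {v : Fin n} (hv : s.reg y = v)
    (h : Ends A ω R (s.set x (A.degree v)) T Q) :
    Ends A ω (.seq (.degQuery x y) R) s (T + 1) Q := (Run.degQuery s x y v hv).seq_ends h

theorem Ends.nbrQuery_seq {x y z : ℕ} {v : Fin n} (hv : s.reg y = v) {j : ℕ}
    (hz : s.reg z = j + 1) (hj : j < (A.nbrs v).length)
    (h : Ends A ω R (s.set x ((A.nbrs v)[j] : Fin n)) T Q) :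
    Ends A ω (.seq (.nbrQuery x y z) R) s (T + 1) Q :=
  (Run.nbrQuery s x y z v hv j hz hj).seq_ends h

theorem Ends.toss_seq {x y : ℕ} (h : Ends A ω R ((s.tick (s.reg y)).set x
    (ω (s.reg y, s.tossed (s.reg y))).toNat) T Q) :
    Ends A ω (.seq (.toss x y) R) s (T + 1) Q := (Run.toss s x y).seq_ends h

theorem Ends.cond {x : ℕ} {P R : Program} (h₁ : s.reg x ≠ 0 → Ends A ω P s T Q)
    (h₂ : s.reg x = 0 → Ends A ω R s T Q) : Ends A ω (.cond x P R) s (T + 1) Q := by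
  by_cases hx : s.reg x = 0
  · obtain ⟨t, c, s', hr, ht, hs⟩ := h₂ hx
    exact ⟨_, _, s', .cond_false P hx hr, by omega, hs⟩
  · obtain ⟨t, c, s', hr, ht, hs⟩ := h₁ hx
    exact ⟨_, _, s', .cond_true R hx hr, by omega, hs⟩

/-- A loop whose invariant counts the remaining rounds. -/
theorem Ends.loop {x : ℕ} {P : Program} (I : ℕ → MState → Prop) (hI : ∀ m s, I m s → (s.reg x = 0 ↔ m = 0))
    (hP : ∀ m s, I (m + 1) s → Ends A ω P s T (I m)) (m : ℕ) :
    ∀ s, I m s → Ends A ω (.loop x P) s (m * (T + 1) + 1) (I 0) := by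
  induction m with
  | zero => exact fun s hs => ⟨1, 0, s, .loop_done P ((hI 0 s hs).2 rfl), by simp, hs⟩
  | succ m ih =>
    intro s hs
    obtain ⟨t, c, s', hr, ht, hs'⟩ := hP m s hs
    obtain ⟨t', c', s'', hr', ht', hs''⟩ := ih s' hs'
    refine ⟨_, _, s'', .loop_step (fun h => ?_) hr hr', ?_, hs''⟩
    · have := (hI _ s hs).1 h
      omega
    · rw [Nat.succ_mul]
      omega

end Basic

/-- For `i = 0, …, n - 1` do `P`; the registers `5` and `6` have to hold zero and one. -/
def Program.for (i r n : ℕ) (P : Program) : Program :=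
  .seq (.const i 0) (.seq (.add r n 5)
    (.loop r (.seq P (.seq (.add i i 6) (.sub r r 6)))))

/-- The invariant must not depend on the two counters `i` and `r`, which the loop itself updates. A
round costs `T` plus two updates and a test; the remaining `3` are the two initialisations and the
last test. -/
theorem Ends.for {i r k : ℕ} {P : Program} {s : MState} {T N : ℕ} (I : ℕ → MState → Prop)
    (h5 : s.reg 5 = 0) (h6 : s.reg 6 = 1) (hk : s.reg k = N) (hki : k ≠ i)
    (hir : i ≠ r) (hi5 : i ≠ 5) (hi6 : i ≠ 6) (hr5 : r ≠ 5) (hr6 : r ≠ 6)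
    (hP5 : P.wr 5 = false) (hP6 : P.wr 6 = false) (hPi : P.wr i = false) (hPr : P.wr r = false)
    (hI : ∀ j s x, (I j s → I j (s.set i x)) ∧ (I j s → I j (s.set r x)))
    (h0 : I 0 s)
    (hstep : ∀ j < N, ∀ s', Frame (.for i r k P) s s' → I j s' → s'.reg i = j →
      Ends A ω P s' T (I (j + 1))) :
    Ends A ω (.for i r k P) s (N * (T + 3) + 3) (I N) := by
  set F : Program := .for i r k P with hF
  have hFwr : ∀ x, F.wr x = false → x ≠ i ∧ x ≠ r ∧ P.wr x = false := by
    intro x hx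
    simp only [hF, Program.for, Program.wr, Bool.or_eq_false_iff, beq_eq_false_iff_ne] at hx
    tauto
  have hset : ∀ s₁ x, Frame F s s₁ → Frame F s (s₁.set i x) ∧ Frame F s (s₁.set r x) := by
    intro s₁ x h
    refine ⟨⟨fun y hy => ?_, h.arr, h.tossed⟩, ⟨fun y hy => ?_, h.arr, h.tossed⟩⟩
    · rw [MState.set_reg, if_neg (hFwr y hy).1, h.reg y hy]
    · rw [MState.set_reg, if_neg (hFwr y hy).2.1, h.reg y hy]
  have hF5 : F.wr 5 = false := by
    simp [hF, Program.for, Program.wr, hP5, hi5.symm, hr5.symm]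
  have hF6 : F.wr 6 = false := by
    simp [hF, Program.for, Program.wr, hP6, hi6.symm, hr6.symm]
  have hloop := Ends.loop (A := A) (ω := ω) (x := r) (P := .seq P (.seq (.add i i 6) (.sub r r 6)))
    (T := T + (0 + 1 + (0 + 1)))
    (fun m s' => m ≤ N ∧ s'.reg r = m ∧ s'.reg i = N - m ∧ I (N - m) s' ∧ Frame F s s')
    (fun m s' h => by rw [h.2.1])
    (by
      rintro m s' ⟨hm, hr, hi, hI', hfr⟩
      refine (hstep (N - (m + 1)) (by omega) s' hfr hI' hi).seq fun s₁ hfr₁ hI₁ => ?_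
      have hr₁ := hfr₁.reg r hPr
      have hi₁ := hfr₁.reg i hPi
      have h6₁ : s₁.reg 6 = 1 := (hfr₁.reg 6 hP6).trans ((hfr.reg 6 hF6).trans h6)
      have hF₁ : Frame F s s₁ := hfr.trans (hfr₁.mono (fun x hx => (hFwr x hx).2.2)
        (fun a ha => by
          simpa [hF, Program.for, Program.wa] using ha)
        (fun ht => by simpa [hF, Program.for, Program.wt] using ht))
      refine Ends.seq (Q := fun s₂ => s₂ = s₁.set i (N - m)) (Ends.add ?_) fun s₂ _ hs₂ =>
        Ends.sub ?_
      · rw [hi₁, hi, h6₁]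
        congr 1
        omega
      · subst hs₂
        have hval : (s₁.set i (N - m)).reg r - (s₁.set i (N - m)).reg 6 = m := by
          rw [MState.set_reg, MState.set_reg, if_neg hir.symm, if_neg hi6.symm, hr₁, hr, h6₁]
          omega
        rw [hval]
        refine ⟨by omega, by simp [MState.set_reg], ?_, ?_, (hset _ _ (hset _ _ hF₁).1).2⟩
        · rw [MState.set_reg, if_neg hir, MState.set_reg, if_pos rfl]
        · refine (hI _ _ _).2 ((hI _ _ _).1 ?_)
          convert hI₁ using 1
          omega) N
  refine Ends.le (T := 0 + 1 + (0 + 1 + (N * (T + (0 + 1 + (0 + 1)) + 1) + 1))) ?_ (by ring_nf; omega)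
  refine Ends.seq (Q := fun s₂ => s₂ = s.set i 0) (Ends.const rfl) fun s₂ _ hs₂ => ?_
  subst hs₂
  refine Ends.seq (Q := fun s₂ => s₂ = (s.set i 0).set r N) (Ends.add ?_) fun s₂ _ hs₂ => ?_
  · rw [MState.set_reg, MState.set_reg, if_neg hki, if_neg hi5.symm, hk, h5]
    rfl
  · subst hs₂
    refine (hloop _ ⟨le_rfl, by simp [MState.set_reg], ?_, ?_, ?_⟩).mono le_rfl
      fun s' _ h => h.2.2.2.1
    · simp [MState.set_reg, hir]
    · rw [Nat.sub_self]
      exact (hI _ _ _).2 ((hI _ _ _).1 h0)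
    · exact (hset _ _ (hset _ _ (Frame.refl F s)).1).2

end Logic

/-! ### Membership tests, counting in base `b`, multiplication -/

section Subroutines

variable {n : ℕ} {A : GraphInput n} {ω : Coins}

/-- Array `a` starts with the list `l`. -/
def Holds (s : MState) (a : ℕ) (l : List ℕ) : Prop :=
  ∀ i (h : i < l.length), s.arr a i = l[i]

theorem Holds.congr {s s' : MState} {a : ℕ} {l : List ℕ} (h : Holds s a l)
    (h' : s'.arr a = s.arr a) : Holds s' a l := fun i hi => by rw [h']; exact h i hi

theorem holds_set (s : MState) (x c a : ℕ) (l : List ℕ) :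
    Holds (s.set x c) a l ↔ Holds s a l := Iff.rfl

theorem Holds.append {s : MState} {a : ℕ} {l : List ℕ} (h : Holds s a l) {x k : ℕ}
    (hk : k = l.length) : Holds (s.setArr a k x) a (l ++ [x]) := by
  subst hk
  intro i hi
  rw [MState.setArr_arr, if_pos rfl]
  by_cases hil : i = l.length
  · subst hil
    simp
  · have : i < l.length := by simp at hi; omega
    rw [if_neg hil, List.getElem_append_left this, h i this]

/-- The labels of a list of vertices. -/
abbrev labels (l : List (Fin n)) : List ℕ := l.map Fin.val

theorem mem_labels {l : List (Fin n)} {w : Fin n} : (w : ℕ) ∈ labels l ↔ w ∈ l := by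
  simp [labels, Fin.val_inj]

/-- Set register `14` to one if register `z` occurs among the first entries of array `a`, whose
number is in register `k`, and to zero otherwise. -/
def Program.mem (a k z : ℕ) : Program :=
  .seq (.const 14 0) (.for 10 11 k (.seq (.read 12 a 10) (.seq (.sub 13 12 z)
    (.seq (.sub 12 z 12) (.seq (.add 12 12 13) (.cond 12 (.const 13 0) (.const 14 1)))))))

theorem Ends.mem {s : MState} {a k z : ℕ} {l : List ℕ} (h5 : s.reg 5 = 0) (h6 : s.reg 6 = 1)
    (hl : Holds s a l) (hk : s.reg k = l.length) (hk' : 14 < k ∨ k < 10) (hz : 14 < z) :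
    Ends A ω (.mem a k z) s (9 * l.length + 4)
      fun s' => s'.reg 14 = if s.reg z ∈ l then 1 else 0 := by
  refine Ends.le (T := (l.length * (6 + 3) + 3) + 1) (Ends.const_seq ?_) (by omega)
  refine (Ends.for (N := l.length) (T := 6)
    (fun j s' => s'.reg 14 = if s.reg z ∈ l.take j then 1 else 0)
    (by simp [MState.set_reg, h5]) (by simp [MState.set_reg, h6])
    (by rw [MState.set_reg, if_neg (by omega), hk]) (by omega) (by omega) (by omega) (by omega)
    (by omega) (by omega) (by rfl) (by rfl) (by rfl) (by rfl) (by simp [MState.set_reg])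
    (by simp [MState.set_reg]) ?_).mono le_rfl ?_
  · intro j hj s' hF hI hi
    have hz' : s'.reg z = s.reg z := by
      rw [hF.reg z (by simp [Program.for, Program.wr]; omega), MState.set_reg, if_neg (by omega)]
    have ha : s'.arr a j = l[j] := by
      rw [hF.arr a (by rfl)]
      exact hl j hj
    have hmem : s.reg z ∈ l.take (j + 1) ↔ s.reg z ∈ l.take j ∨ s.reg z = l[j] := by
      rw [List.take_succ_eq_append_getElem hj, List.mem_append, List.mem_singleton]
    -- Register `12` becomes the sum of the two truncated differences, which vanishes exactly when
    -- the numbers are equal.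
    refine Ends.read_seq (Ends.sub_seq (Ends.sub_seq (Ends.add_seq (Ends.cond (T := 1) ?_ ?_))))
    · intro hne
      refine Ends.const ?_
      have hz12 : z ≠ 12 := by omega
      have hz13 : z ≠ 13 := by omega
      simp only [MState.set_reg, hi, ha, hz', hz12, hz13] at hne ⊢
      simp at hne ⊢
      have : s.reg z ≠ l[j] := by omega
      rw [hI]
      simp only [hmem, this, or_false]
    · intro he
      refine Ends.const ?_
      have hz12 : z ≠ 12 := by omega
      have hz13 : z ≠ 13 := by omega
      simp only [MState.set_reg, hi, ha, hz', hz12, hz13] at he ⊢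
      simp at he ⊢
      have : s.reg z = l[j] := by omega
      exact hmem.2 (.inr this)
  · intro s' _ h
    simpa using h

/-- A test of membership followed by a case distinction. -/
theorem Ends.mem_cond {s : MState} {a k z T T' : ℕ} {l : List ℕ} {P R : Program} {Q : MState → Prop}
    (h5 : s.reg 5 = 0) (h6 : s.reg 6 = 1) (hl : Holds s a l) (hk : s.reg k = l.length)
    (hk' : 14 < k ∨ k < 10) (hz : 14 < z) (hT : 9 * l.length + 5 + T ≤ T')
    (hP : ∀ s', Frame (.mem a k z) s s' → s.reg z ∈ l → Ends A ω P s' T Q)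
    (hR : ∀ s', Frame (.mem a k z) s s' → s.reg z ∉ l → Ends A ω R s' T Q) :
    Ends A ω (.seq (.mem a k z) (.cond 14 P R)) s T' Q := by
  refine Ends.le (T := 9 * l.length + 4 + (T + 1)) ?_ (by omega)
  refine Ends.seq (Ends.mem h5 h6 hl hk hk' hz) fun s' hF hs' => Ends.cond (fun hne => ?_) ?_
  · refine hP s' hF ?_
    by_contra hmem
    exact hne (by rw [hs', if_neg hmem])
  · refine fun he => hR s' hF fun hmem => ?_
    rw [hs', if_pos hmem] at he
    omega

/-- The parameters of the partition are stored in the registers. -/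
structure Setup (b D t N B : ℕ) (s : MState) : Prop where
  zero : s.reg 5 = 0
  one : s.reg 6 = 1
  base : s.reg 7 = b
  ratio : s.reg 8 = D
  len : s.reg 9 = t
  codes : s.reg 15 = N
  bits : s.reg 16 = B

variable {b D t N B : ℕ}

theorem Setup.set {s : MState} (h : Setup b D t N B s) {x c : ℕ} (hx : 17 ≤ x) :
    Setup b D t N B (s.set x c) := by
  obtain ⟨h1, h2, h3, h4, h5, h6, h7⟩ := h
  constructor <;> (rw [MState.set_reg, if_neg (by omega)]; assumption)

theorem Setup.setArr {s : MState} (h : Setup b D t N B s) (a i c : ℕ) :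
    Setup b D t N B (s.setArr a i c) := by
  obtain ⟨h1, h2, h3, h4, h5, h6, h7⟩ := h
  constructor <;> assumption

theorem Setup.frame {P : Program} {s s' : MState} (h : Setup b D t N B s) (hF : Frame P s s')
    (hP : ([5, 6, 7, 8, 9, 15, 16].all fun r => !P.wr r) = true := by rfl) :
    Setup b D t N B s' := by
  obtain ⟨h1, h2, h3, h4, h5, h6, h7⟩ := h
  have hr : ∀ r ∈ [5, 6, 7, 8, 9, 15, 16], s'.reg r = s.reg r := fun r hr =>
    hF.reg r (by simpa using List.all_eq_true.1 hP r hr)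
  constructor <;> (rw [hr _ (by simp)]; assumption)

/-- Fill the first entries of array `1` with zeros. -/
def Program.clear : Program := .for 36 37 9 (.write 1 36 5)

theorem Ends.clear {s : MState} (h : Setup b D t N B s) :
    Ends A ω .clear s (4 * t + 3) fun s' => Holds s' 1 (blockList b t 0) := by
  refine Ends.le (T := t * ((0 + 1) + 3) + 3) ?_ (by omega)
  refine (Ends.for (fun j s' => ∀ i < j, s'.arr 1 i = 0) h.zero h.one h.len (by omega) (by omega)
    (by omega) (by omega) (by omega) (by omega) (by rfl) (by rfl) (by rfl) (by rfl)
    (by simp [MState.set_arr]) (by simp) ?_).mono le_rfl ?_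
  · intro j hj s' hF hI hi
    refine Ends.write fun i hij => ?_
    rw [MState.setArr_arr, if_pos rfl, hi, (h.frame hF).zero]
    split_ifs
    · rfl
    · exact hI i (by omega)
  · intro s' _ hI i hi
    rw [hI i (by simpa [blockList] using hi)]
    simp [blockList]

/-- Schoolbook addition of one: the carry into digit `j` is one exactly when `b ^ j ∣ c + 1`, and it
passes on exactly when the digit overflows. -/
theorem digit_succ (hb : 0 < b) (c j : ℕ) :
    (c + 1) / b ^ j % b = (if c / b ^ j % b + (if b ^ j ∣ c + 1 then 1 else 0) < b then
      c / b ^ j % b + (if b ^ j ∣ c + 1 then 1 else 0) else 0) ∧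
    (b ^ (j + 1) ∣ c + 1 ↔ ¬ c / b ^ j % b + (if b ^ j ∣ c + 1 then 1 else 0) < b) := by
  have hm := Nat.mod_lt (c / b ^ j) hb
  have h1 : (c + 1) / b ^ j = c / b ^ j + if b ^ j ∣ c + 1 then 1 else 0 := Nat.succ_div
  have hp : 0 < b ^ j := by positivity
  have h2 : (b ^ (j + 1) ∣ c + 1) ↔ b ^ j ∣ c + 1 ∧ b ∣ (c + 1) / b ^ j := by
    rw [pow_succ]
    constructor
    · exact fun h => ⟨(Dvd.intro _ rfl).trans h, (Nat.dvd_div_iff_mul_dvd ((Dvd.intro _ rfl).trans h)).2 h⟩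
    · exact fun h => (Nat.dvd_div_iff_mul_dvd h.1).1 h.2
  rw [h2, h1]
  set a := c / b ^ j
  by_cases hd : b ^ j ∣ c + 1
  · simp only [hd, if_true, true_and]
    have h3 : (a + 1) % b = if a % b + 1 < b then a % b + 1 else 0 := by
      split_ifs with h
      · rw [← Nat.mod_eq_of_lt h, Nat.mod_add_mod]
      · rw [← Nat.mod_add_mod, (by omega : a % b + 1 = b), Nat.mod_self]
    refine ⟨h3, ?_⟩
    rw [Nat.dvd_iff_mod_eq_zero, h3]
    split_ifs with h <;> simp [h]
  · simp [hd, hm]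

/-- Add one to the number whose digits are in array `1`. -/
def Program.next : Program :=
  .seq (.const 35 1) (.for 36 37 9 (.seq (.read 38 1 36) (.seq (.add 38 38 35)
    (.seq (.sub 39 7 38) (.cond 39 (.seq (.write 1 36 38) (.const 35 0))
      (.seq (.write 1 36 5) (.const 35 1)))))))

theorem Ends.next {s : MState} (h : Setup b D t N B s) (hb : 0 < b) {c : ℕ}
    (hc : Holds s 1 (blockList b t c)) :
    Ends A ω .next s (9 * t + 4) fun s' => Holds s' 1 (blockList b t (c + 1)) := by
  refine Ends.le (T := (t * (6 + 3) + 3) + 1) (Ends.const_seq ?_) (by omega)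
  refine (Ends.for (N := t) (T := 6)
    (fun j s' => (∀ i < j, s'.arr 1 i = (c + 1) / b ^ i % b) ∧
      (∀ i < t, j ≤ i → s'.arr 1 i = c / b ^ i % b) ∧
      s'.reg 35 = if b ^ j ∣ c + 1 then 1 else 0)
    (h.set (by omega)).zero (h.set (by omega)).one (h.set (by omega)).len (by omega) (by omega)
    (by omega) (by omega) (by omega) (by omega) (by rfl) (by rfl) (by rfl) (by rfl)
    (by simp [MState.set_reg, MState.set_arr]) ?_ ?_).mono le_rfl ?_
  · refine ⟨by simp, fun i hi _ => ?_, by simp [MState.set_reg]⟩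
    have := hc i (by simpa [blockList] using hi)
    simp only [blockList, List.getElem_map, List.getElem_range] at this
    exact this
  · rintro j hj s' hF ⟨h1, h2, h3⟩ hi
    have hs' := (h.set (x := 35) (c := 1) (by omega)).frame hF
    obtain ⟨hd1, hd2⟩ := digit_succ hb c j
    have hj2 := h2 j hj le_rfl
    have hm := Nat.mod_lt (c / b ^ j) hb
    refine Ends.read_seq (Ends.add_seq (Ends.sub_seq (Ends.cond (T := 2) ?_ ?_)))
    · intro hne
      simp only [MState.set_reg, hi, hj2, hs'.base] at hne
      simp only [Nat.reduceEqDiff, if_true, if_false] at hne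
      rw [h3] at hne
      have hlt := Nat.lt_of_sub_ne_zero hne
      rw [if_pos hlt] at hd1
      refine Ends.write_seq (Ends.const ⟨fun i hij => ?_, fun i hit hij => ?_, ?_⟩)
      · simp [MState.set_reg, MState.set_arr, MState.setArr_arr, hi]
        split_ifs with hij'
        · rw [hij', hd1, hj2, h3]
        · exact h1 i (by omega)
      · simp [MState.set_reg, MState.set_arr, MState.setArr_arr, hi]
        rw [if_neg (by omega)]
        exact h2 i hit (by omega)
      · rw [if_neg (by rw [hd2, not_not]; exact hlt)]
        simp [MState.set_reg]
    · intro hne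
      simp only [MState.set_reg, hi, hj2, hs'.base] at hne
      simp only [Nat.reduceEqDiff, if_true, if_false] at hne
      rw [h3] at hne
      have hlt := Nat.not_lt.2 (Nat.sub_eq_zero_iff_le.1 hne)
      rw [if_neg hlt] at hd1
      refine Ends.write_seq (Ends.const ⟨fun i hij => ?_, fun i hit hij => ?_, ?_⟩)
      · simp [MState.set_reg, MState.set_arr, MState.setArr_arr, hi, hs'.zero]
        split_ifs with hij'
        · rw [hij', hd1]
        · exact h1 i (by omega)
      · simp [MState.set_reg, MState.set_arr, MState.setArr_arr, hi]
        rw [if_neg (by omega)]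
        exact h2 i hit (by omega)
      · rw [if_pos (hd2.2 hlt)]
        simp [MState.set_reg]
  · rintro s' _ ⟨hI, -, -⟩ i hi
    rw [hI i (by simpa [blockList] using hi)]
    simp [blockList]

/-- Store in register `z` the product of the registers `x` and `y`. -/
def Program.mul (z x y : ℕ) : Program := .seq (.const z 0) (.for 45 46 x (.add z z y))

theorem Ends.mul {s : MState} {x y z : ℕ} (h5 : s.reg 5 = 0) (h6 : s.reg 6 = 1)
    (hx : x ≠ z ∧ x ≠ 45 ∧ x ≠ 46) (hy : y ≠ z ∧ y ≠ 45 ∧ y ≠ 46)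
    (hz : z ≠ 5 ∧ z ≠ 6 ∧ z ≠ 45 ∧ z ≠ 46) :
    Ends A ω (.mul z x y) s (4 * s.reg x + 4) fun s' => s'.reg z = s.reg x * s.reg y := by
  refine Ends.le (T := (s.reg x * ((0 + 1) + 3) + 3) + 1) (Ends.const_seq ?_) (by omega)
  refine (Ends.for (N := s.reg x) (fun j s' => s'.reg z = j * s.reg y)
    (by rw [MState.set_reg, if_neg (by omega), h5]) (by rw [MState.set_reg, if_neg (by omega), h6])
    (by rw [MState.set_reg, if_neg (by omega)]) (by omega) (by omega)
    (by omega) (by omega) (by omega) (by omega) (by simp [Program.wr]; omega)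
    (by simp [Program.wr]; omega) (by simp [Program.wr]; omega) (by simp [Program.wr]; omega)
    (by simp [MState.set_reg, hz]) (by simp [MState.set_reg]) ?_).mono le_rfl
    fun _ _ h => h
  rintro j hj s' hF hI hi
  refine Ends.add ?_
  have hy' : s'.reg y = s.reg y := by
    rw [hF.reg y (by simp [Program.for, Program.wr]; omega), MState.set_reg, if_neg (by omega)]
  rw [MState.set_reg, if_pos rfl, hI, hy', Nat.succ_mul]

end Subroutines

/-! ### The search program -/

section Searching

variable {n : ℕ} {A : GraphInput n} {ω : Coins}

/-- The recursion consumes the list from the front, while the loop invariant follows its prefixes;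
this identity advances a prefix by one element. -/
theorem addNew_append_singleton (q l : List (Fin n)) (w : Fin n) :
    addNew q (l ++ [w]) = if w ∈ addNew q l then addNew q l else addNew q l ++ [w] := by
  induction l generalizing q with
  | nil => rfl
  | cons x l ih => exact ih _

theorem length_addNew_take_le (q l : List (Fin n)) (j : ℕ) :
    (addNew q (l.take j)).length ≤ (addNew q l).length := by
  induction l generalizing q j with
  | nil => simp
  | cons x l ih =>
    cases j with
    | zero => exact (prefix_addNew q _).length_le
    | succ j => exact ih _ j

theorem labels_append_singleton (l : List (Fin n)) (w : Fin n) :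
    labels (l ++ [w]) = labels l ++ [(w : ℕ)] := by simp

/-- Append to the queue in array `2` the new ones among the neighbours of the vertex in
register `26`. -/
def Program.enqueue : Program :=
  .for 28 29 27 (.seq (.add 30 28 6) (.seq (.nbrQuery 31 26 30) (.seq (.mem 2 21 31)
    (.cond 14 (.const 25 0) (.seq (.write 2 21 31) (.add 21 21 6))))))

theorem Ends.enqueue {s : MState} (h5 : s.reg 5 = 0) (h6 : s.reg 6 = 1) {u : Fin n}
    {q : List (Fin n)} {K : ℕ} (hu : s.reg 26 = u) (hdeg : s.reg 27 = A.degree u)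
    (hq : Holds s 2 (labels q)) (hlen : s.reg 21 = q.length)
    (hK : (addNew q (A.nbrs u)).length ≤ K) :
    Ends A ω .enqueue s (A.degree u * (9 * K + 12) + 3) fun s' =>
      Holds s' 2 (labels (addNew q (A.nbrs u))) ∧
        s'.reg 21 = (addNew q (A.nbrs u)).length := by
  refine (Ends.for (T := 9 * K + 9) (fun j s' =>
      Holds s' 2 (labels (addNew q ((A.nbrs u).take j))) ∧
        s'.reg 21 = (addNew q ((A.nbrs u).take j)).length)
    h5 h6 hdeg (by omega) (by omega)
    (by omega) (by omega) (by omega) (by omega) (by rfl) (by rfl) (by rfl) (by rfl)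
    ?_ ?_ ?_).mono le_rfl ?_
  · exact fun j s x => ⟨fun h => ⟨h.1.congr rfl, by simp [MState.set_reg, h.2]⟩,
      fun h => ⟨h.1.congr rfl, by simp [MState.set_reg, h.2]⟩⟩
  · exact ⟨hq, hlen⟩
  · rintro j hj s' hF ⟨h1, h2⟩ hi
    have hu' : s'.reg 26 = u := (hF.reg 26 rfl).trans hu
    have h5' : s'.reg 5 = 0 := (hF.reg 5 rfl).trans h5
    have h6' : s'.reg 6 = 1 := (hF.reg 6 rfl).trans h6
    rw [List.take_succ_eq_append_getElem hj, addNew_append_singleton]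
    have hle := (length_addNew_take_le q (A.nbrs u) j).trans hK
    set q' := addNew q ((A.nbrs u).take j)
    set w := (A.nbrs u)[j]
    refine Ends.le (T := (9 * q'.length + 7 + 1) + 1) ?_ (by omega)
    refine Ends.add_seq (Ends.nbrQuery_seq (v := u) (by simp [MState.set_reg, hu'])
      (j := j) (by simp [MState.set_reg, hi, h6']) hj ?_)
    refine Ends.mem_cond (l := labels q') (T := 2) (by simp [MState.set_reg, h5'])
      (by simp [MState.set_reg, h6']) (h1.congr rfl) (by simp [MState.set_reg, h2])
      (by omega) (by omega) (by simp) (fun s₁ hF₁ hmem => ?_) fun s₁ hF₁ hmem => ?_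
    all_goals
      rw [MState.set_reg, if_pos rfl, mem_labels] at hmem
      have hw : s₁.reg 31 = w := (hF₁.reg 31 rfl).trans (by simp [MState.set_reg, w])
      have hlen₁ : s₁.reg 21 = q'.length := (hF₁.reg 21 rfl).trans (by simp [MState.set_reg, h2])
      have hone : s₁.reg 6 = 1 := (hF₁.reg 6 rfl).trans (by simp [MState.set_reg, h6'])
      have hq₁ : Holds s₁ 2 (labels q') := h1.congr (hF₁.arr 2 rfl)
    · rw [if_pos hmem]
      exact Ends.const ⟨hq₁.congr rfl, by simp [MState.set_reg, hlen₁]⟩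
    · rw [if_neg hmem]
      refine Ends.write_seq (Ends.add ⟨?_, ?_⟩)
      · rw [labels_append_singleton, ← hw]
        exact (hq₁.append (by simp [hlen₁])).congr rfl
      · simp [MState.set_reg, MState.setArr_reg, hlen₁, hone]
  · rintro s' _ ⟨h1, h2⟩
    have : (A.nbrs u).take (A.degree u) = A.nbrs u := List.take_length
    rw [this] at h1 h2
    exact ⟨h1, h2⟩

/-- The queue and the set of expanded vertices of a search are stored. -/
structure Searched (s : MState) (p : List (Fin n) × List (Fin n)) : Prop where
  queue : Holds s 2 (labels p.1)
  queue_len : s.reg 21 = p.1.length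
  found : Holds s 3 (labels p.2)
  found_len : s.reg 22 = p.2.length

theorem Searched.frame {s s' : MState} {p : List (Fin n) × List (Fin n)} (h : Searched s p)
    {P : Program} (hF : Frame P s s') (h1 : P.wr 21 = false := by rfl)
    (h2 : P.wr 22 = false := by rfl) (h3 : P.wa 2 = false := by rfl)
    (h4 : P.wa 3 = false := by rfl) : Searched s' p :=
  ⟨h.1.congr (hF.arr 2 h3), by rw [hF.reg 21 h1, h.2], h.3.congr (hF.arr 3 h4),
    by rw [hF.reg 22 h2, h.4]⟩

/-- A search from the vertex in register `20`, blocked at the positions in array `1`. -/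
def Program.search : Program :=
  .seq (.const 21 0) (.seq (.write 2 21 20) (.seq (.const 21 1) (.seq (.const 22 0)
    (.for 23 24 7 (.seq (.sub 25 21 23) (.cond 25 (.seq (.mem 1 9 23) (.cond 14 (.const 25 0)
      (.seq (.read 26 2 23) (.seq (.write 3 22 26) (.seq (.add 22 22 6) (.seq (.degQuery 27 26)
        .enqueue)))))) (.const 25 0)))))))

variable {b D t N B : ℕ}

/-- In each of the `b` rounds at most `d` neighbours are looked up in a queue of length at most `1 +
b * d`. The assumption `d * d ≤ b` keeps the total cubic in `b`. -/
theorem Ends.search {s : MState} (h : Setup b D t N B s) {d : ℕ} (hA : ∀ v, A.degree v ≤ d)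
    (hb : 16 ≤ b) (hd : d * d ≤ b) (ht : t ≤ b) {v : Fin n} {c : ℕ} (hv : s.reg 20 = v)
    (hc : Holds s 1 (blockList b t c)) :
    Ends A ω .search s (100 * b ^ 3) fun s' => Searched s' (A.codedSearch b t v c) := by
  have hdb : d ≤ b := (Nat.le_mul_self d).trans hd
  set T := 9 * t + 4 + (d * (9 * (1 + b * d) + 12) + 20) with hT
  have hTle : b * (T + 3) + 3 + 4 ≤ 100 * b ^ 3 := by
    have e1 : d * (b * d) ≤ b * b := by nlinarith
    have e2 : T + 3 ≤ 9 * (b * b) + 40 * b := by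
      have : d * (9 * (1 + b * d) + 12) = 9 * (d * (b * d)) + 21 * d := by ring
      omega
    have e3 : 9 * (b * b) + 40 * b ≤ 90 * (b * b) := by nlinarith
    calc b * (T + 3) + 3 + 4 ≤ b * (90 * (b * b)) + 7 := by nlinarith
      _ ≤ 100 * b ^ 3 := by nlinarith [sq_nonneg b, mul_pos (by omega : 0 < b) (by omega : 0 < b)]
  refine Ends.le (T := b * (T + 3) + 3 + 1 + 1 + 1 + 1) ?_ (by omega)
  refine Ends.const_seq ?_
  refine Ends.write_seq ?_
  refine Ends.const_seq ?_
  refine Ends.const_seq ?_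
  refine (Ends.for (T := T) (fun j s' =>
      Searched s' (A.search (fun i _ => i ∈ blockList b t c) v j))
    (by simp [MState.set_reg, MState.setArr_reg, h.zero])
    (by simp [MState.set_reg, MState.setArr_reg, h.one])
    (by simp [MState.set_reg, MState.setArr_reg, h.base]) (by omega) (by omega)
    (by omega) (by omega) (by omega) (by omega) (by rfl) (by rfl) (by rfl) (by rfl)
    ?_ ?_ ?_).mono le_rfl fun _ _ h => h
  · exact fun j s x => ⟨fun h => ⟨h.1.congr rfl, by simp [MState.set_reg, h.2], h.3.congr rfl,
      by simp [MState.set_reg, h.4]⟩, fun h => ⟨h.1.congr rfl, by simp [MState.set_reg, h.2],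
      h.3.congr rfl, by simp [MState.set_reg, h.4]⟩⟩
  · refine ⟨fun i hi => ?_, by simp [MState.set_reg, GraphInput.search],
      fun i hi => by simp [GraphInput.search] at hi, by simp [MState.set_reg, GraphInput.search]⟩
    simp only [GraphInput.search, labels, List.map_cons, List.map_nil, List.length_singleton,
      Nat.lt_one_iff] at hi
    subst hi
    simp [MState.set_reg, MState.set_arr, MState.setArr_arr, hv, GraphInput.search]
  · rintro j hj s' hF ⟨h1, h2, h3, h4⟩ hi
    have hs' : Setup b D t N B s' := Setup.frame ((((h.set (by omega)).setArr _ _ _).set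
      (by omega)).set (by omega)) hF
    have hc' : Holds s' 1 (blockList b t c) := hc.congr (hF.arr 1 rfl)
    have hle := A.length_search_le (fun i _ => i ∈ blockList b t c) v hA (j + 1)
    rw [GraphInput.search] at hle ⊢
    set p := A.search (fun i _ => i ∈ blockList b t c) v j with hp
    unfold GraphInput.searchStep at hle ⊢
    refine Ends.le (T := 9 * t + 11 + d * (9 * (1 + b * d) + 12) + 1 + 1 + 1) ?_ (by omega)
    refine Ends.sub_seq (Ends.cond (fun hne => ?_) fun he => ?_)
    · simp only [MState.set_reg, if_true, hi, h2] at hne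
      have hjp : j < p.1.length := by omega
      rw [dif_pos hjp]
      rw [dif_pos hjp] at hle
      refine Ends.mem_cond (l := blockList b t c) (T := d * (9 * (1 + b * d) + 12) + 3 + 1 + 1 + 1 + 1)
        (by simp [MState.set_reg, hs'.zero]) (by simp [MState.set_reg, hs'.one]) (hc'.congr rfl)
        (by simp [MState.set_reg, hs'.len, blockList]) (by omega) (by omega)
        (by rw [blockList, List.length_map, List.length_range]; omega) (fun s₁ hF₁ hmem => ?_) fun s₁ hF₁ hmem => ?_
      all_goals
        rw [MState.set_reg, if_neg (by omega), hi] at hmem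
        have hi₁ : s₁.reg 23 = j := (hF₁.reg 23 rfl).trans (by simp [MState.set_reg, hi])
        have hs₁' : Setup b D t N B s₁ := (hs'.set (by omega)).frame hF₁
        have e1 : Holds s₁ 2 (labels p.1) := h1.congr (hF₁.arr 2 rfl)
        have e2 : s₁.reg 21 = p.1.length := (hF₁.reg 21 rfl).trans (by simp [MState.set_reg, h2])
        have e3 : Holds s₁ 3 (labels p.2) := h3.congr (hF₁.arr 3 rfl)
        have e4 : s₁.reg 22 = p.2.length := (hF₁.reg 22 rfl).trans (by simp [MState.set_reg, h4])
      · rw [if_pos hmem]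
        exact Ends.const ⟨e1.congr rfl, by simp [MState.set_reg, e2], e3.congr rfl,
          by simp [MState.set_reg, e4]⟩
      · rw [if_neg hmem]
        rw [if_neg hmem] at hle
        have hu : s₁.arr 2 j = p.1[j] := by
          rw [e1 j (by simpa using hjp)]
          simp
        refine Ends.read_seq ?_
        refine Ends.write_seq ?_
        refine Ends.add_seq ?_
        refine Ends.degQuery_seq (v := p.1[j])
          (by simp [MState.set_reg, MState.setArr_reg, hi₁, hu]) ?_
        refine (Ends.enqueue (K := 1 + b * d) (u := p.1[j]) (q := p.1) ?_ ?_ ?_ ?_ ?_ ?_ ?_).mono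
          ?_ fun s₂ hF₂ hs₂ => ⟨hs₂.1, hs₂.2, ?_, ?_⟩
        · simp [MState.set_reg, MState.setArr_reg, hs₁'.zero]
        · simp [MState.set_reg, MState.setArr_reg, hs₁'.one]
        · simp [MState.set_reg, MState.setArr_reg, hi₁, hu]
        · simp [MState.set_reg]
        · refine e1.congr ?_
          funext i
          simp [MState.set_arr, MState.setArr_arr]
        · simp [MState.set_reg, MState.setArr_reg, e2]
        · exact hle.trans (by gcongr; omega)
        · have := hA p.1[j]
          gcongr
        · refine Holds.congr ?_ (hF₂.arr 3 rfl)
          rw [labels_append_singleton]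
          convert (e3.append (x := p.1[j]) (k := p.2.length) (by simp)) using 0
          simp only [Holds, MState.set_arr, MState.setArr_arr, MState.set_reg, MState.setArr_reg,
            hi₁, hu, e4]
          simp
        · rw [hF₂.reg 22 rfl]
          simp [MState.set_reg, MState.setArr_reg, e4, hs₁'.one]
    · simp only [MState.set_reg, if_true, hi, h2] at he
      have hjp : ¬ j < p.1.length := by omega
      rw [dif_neg hjp]
      exact Ends.const ⟨h1.congr rfl, by simp [MState.set_reg, h2], h3.congr rfl,
        by simp [MState.set_reg, h4]⟩

end Searching

/-! ### Computing isolated sets and candidates -/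

section Isolating

variable {n : ℕ} {A : GraphInput n} {ω : Coins} {b D t N B d : ℕ}

/-- The bounds on the parameters that the running times depend on. -/
structure Bounded (A : GraphInput n) (d b D t N : ℕ) : Prop where
  deg : ∀ v, A.degree v ≤ d
  big : 16 ≤ b
  sq : d * d ≤ b
  len : t ≤ b
  ratio : D ≤ b
  codes : N = b ^ t

theorem Bounded.deg_le (h : Bounded A d b D t N) : d ≤ b := (Nat.le_mul_self d).trans h.sq

/-- Count the edges that leave the set in array `3`. -/
def Program.cut : Program :=
  .seq (.const 32 0) (.for 33 34 22 (.seq (.read 26 3 33) (.seq (.degQuery 27 26)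
    (.for 28 29 27 (.seq (.add 30 28 6) (.seq (.nbrQuery 31 26 30) (.seq (.mem 3 22 31)
      (.cond 14 (.const 25 0) (.add 32 32 6)))))))))

theorem Ends.cut {s : MState} (h : Setup b D t N B s) (hb : Bounded A d b D t N)
    {S : List (Fin n)} (hS : Holds s 3 (labels S)) (hlen : s.reg 22 = S.length)
    (hSb : S.length ≤ b) :
    Ends A ω .cut s (50 * b ^ 3) fun s' => s'.reg 32 = A.cutCount S := by
  have hdb := hb.deg_le
  have hbig := hb.big
  set T := d * (9 * b + 11) + 5 with hT
  have hTle : S.length * (T + 3) + 4 ≤ 50 * b ^ 3 := by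
    have e1 : T + 3 ≤ 40 * (b * b) := by nlinarith
    calc S.length * (T + 3) + 4 ≤ b * (40 * (b * b)) + 4 := by gcongr
      _ ≤ 50 * b ^ 3 := by nlinarith [mul_pos (by omega : 0 < b) (by omega : 0 < b)]
  refine Ends.le (T := S.length * (T + 3) + 3 + 1) ?_ (by omega)
  refine Ends.const_seq ?_
  refine (Ends.for (T := T) (N := S.length) (fun j s' => s'.reg 32 =
      ((S.take j).map fun u => ((A.nbrs u).filter (· ∉ S)).length).sum)
    (by simp [MState.set_reg, h.zero]) (by simp [MState.set_reg, h.one])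
    (by simp [MState.set_reg, hlen]) (by omega) (by omega)
    (by omega) (by omega) (by omega) (by omega) (by rfl) (by rfl) (by rfl) (by rfl)
    (by simp [MState.set_reg]) (by simp [MState.set_reg]) ?_).mono le_rfl fun s' _ hs' => ?_
  · intro j hj s' hF hI hi
    have hs' : Setup b D t N B s' := (h.set (by omega)).frame hF
    have hS' : Holds s' 3 (labels S) := hS.congr (hF.arr 3 rfl)
    have hlen' : s'.reg 22 = S.length := (hF.reg 22 rfl).trans (by simp [MState.set_reg, hlen])
    have hu : s'.arr 3 j = S[j] := by
      rw [hS' j (by simpa using hj)]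
      simp
    refine Ends.le (T := d * (9 * b + 11) + 3 + 1 + 1) ?_ (by omega)
    refine Ends.read_seq ?_
    refine Ends.degQuery_seq (v := S[j]) (by simp [MState.set_reg, hi, hu]) ?_
    refine (Ends.for (T := 9 * b + 8) (N := A.degree S[j]) (fun i s₁ => s₁.reg 32 =
        s'.reg 32 + (((A.nbrs S[j]).take i).filter (· ∉ S)).length)
      (by simp [MState.set_reg, hs'.zero]) (by simp [MState.set_reg, hs'.one])
      (by simp [MState.set_reg]) (by omega) (by omega)
      (by omega) (by omega) (by omega) (by omega) (by rfl) (by rfl) (by rfl) (by rfl)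
      (by simp [MState.set_reg]) (by simp [MState.set_reg]) ?_).mono ?_ fun s₁ _ hs₁ => ?_
    · intro i hij s₁ hF₁ hI₁ hi₁
      have hs₁ : Setup b D t N B s₁ := ((hs'.set (by omega)).set (by omega)).frame hF₁
      have hS₁ : Holds s₁ 3 (labels S) := hS'.congr (hF₁.arr 3 rfl)
      have hlen₁ : s₁.reg 22 = S.length :=
        (hF₁.reg 22 rfl).trans (by simp [MState.set_reg, hlen'])
      have hu₁ : s₁.reg 26 = S[j] := (hF₁.reg 26 rfl).trans (by simp [MState.set_reg, hi, hu])
      rw [List.take_succ_eq_append_getElem hij]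
      refine Ends.le (T := 9 * b + 6 + 1 + 1) ?_ (by omega)
      refine Ends.add_seq ?_
      refine Ends.nbrQuery_seq (v := S[j]) (by simp [MState.set_reg, hu₁]) (j := i)
        (by simp [MState.set_reg, hi₁, hs₁.one]) hij ?_
      refine Ends.mem_cond (l := labels S) (T := 1) (by simp [MState.set_reg, hs₁.zero])
        (by simp [MState.set_reg, hs₁.one]) (hS₁.congr rfl) (by simp [MState.set_reg, hlen₁])
        (by omega) (by omega) (by simp; omega) (fun s₂ hF₂ hmem => ?_) fun s₂ hF₂ hmem => ?_
      all_goals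
        rw [MState.set_reg, if_pos rfl, mem_labels] at hmem
        have hcut : s₂.reg 32 = s₁.reg 32 := (hF₂.reg 32 rfl).trans (by simp [MState.set_reg])
        have hone : s₂.reg 6 = 1 := (hF₂.reg 6 rfl).trans (by simp [MState.set_reg, hs₁.one])
      · refine Ends.const ?_
        simp [MState.set_reg, hcut, hI₁, hmem]
      · refine Ends.add ?_
        simp [MState.set_reg, hcut, hI₁, hmem, hone]
        omega
    · have := hb.deg S[j]
      gcongr
    · have htake : (A.nbrs S[j]).take (A.degree S[j]) = A.nbrs S[j] := List.take_length
      rw [hs₁, htake, hI, List.take_succ_eq_append_getElem hj, List.map_append, List.sum_append,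
        List.map_singleton, List.sum_singleton]
  · rw [hs', List.take_length]
    rfl

/-- Store in array `3` the set assigned to the vertex in register `20`. -/
def Program.find : Program :=
  .seq .clear (.seq (.const 40 0) (.seq (.for 41 42 15 (.cond 40 (.const 43 0)
    (.seq .search (.seq .next (.seq (.sub 43 7 21) (.cond 43
      (.seq .cut (.seq (.mul 44 8 32) (.seq (.sub 43 22 44)
        (.cond 43 (.const 40 1) (.const 43 0)))))
      (.const 43 0))))))) (.cond 40 (.const 43 0)
        (.seq (.const 22 0) (.seq (.write 3 22 20) (.const 22 1))))))

theorem Ends.find {s : MState} (h : Setup b D t N B s) (hb : Bounded A d b D t N)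
    {v : Fin n} (hv : s.reg 20 = v) :
    Ends A ω .find s (250 * (N * b ^ 3)) fun s' => Holds s' 3 (labels (A.findSet D b t v)) ∧
      s'.reg 22 = (A.findSet D b t v).length := by
  have hdb := hb.deg_le
  have hbig := hb.big
  have htb := hb.len
  have hDb := hb.ratio
  have hNpos : 1 ≤ N := by
    rw [hb.codes]
    exact Nat.one_le_pow _ _ (by omega)
  have hcube : 256 * b ≤ b ^ 3 := by nlinarith [mul_pos (by omega : 0 < b) (by omega : 0 < b)]
  obtain ⟨T, hT⟩ : ∃ T, T = 150 * b ^ 3 + 13 * b + 20 := ⟨_, rfl⟩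
  have hTle : 4 * b + (N * (T + 3) + 3) + 20 ≤ 250 * (N * b ^ 3) := by
    have e1 : T + 3 ≤ 151 * b ^ 3 := by omega
    have e2 : b ^ 3 ≤ N * b ^ 3 := Nat.le_mul_of_pos_left _ hNpos
    have e3 : N * (T + 3) ≤ 151 * (N * b ^ 3) := by nlinarith
    omega
  refine Ends.then (Ends.clear h) (T' := N * (T + 3) + 8 + 1) (by omega) fun s₁ hF₁ hs₁ => ?_
  have hsetup := h.frame hF₁
  have hv₁ : s₁.reg 20 = v := (hF₁.reg 20 rfl).trans hv
  clear hF₁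
  refine Ends.const_seq ?_
  -- Register `40` tells whether a set has been accepted. From then on array `3` is left alone and
  -- the code in array `1` no longer matters.
  refine Ends.then (T' := 3 + 1) (Ends.for (T := T) (N := N) (fun j s' =>
      (∃ S, A.findUpTo D b t v j = some S ∧ s'.reg 40 = 1 ∧ Holds s' 3 (labels S) ∧
        s'.reg 22 = S.length) ∨
      (A.findUpTo D b t v j = none ∧ s'.reg 40 = 0 ∧ Holds s' 1 (blockList b t j)))
    (by simp [MState.set_reg, hsetup.zero]) (by simp [MState.set_reg, hsetup.one])
    (by simp [MState.set_reg, hsetup.codes]) (by omega) (by omega)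
    (by omega) (by omega) (by omega) (by omega) (by rfl) (by rfl) (by rfl) (by rfl)
    ?_ ?_ ?_) (by omega) fun s' hF' hs' => ?_
  · exact fun j s x => ⟨fun h => by simpa [MState.set_reg, holds_set] using h,
      fun h => by simpa [MState.set_reg, holds_set] using h⟩
  · exact .inr ⟨rfl, by simp [MState.set_reg], hs₁.congr rfl⟩
  · intro j hj s' hF hI hi
    have hsetup' : Setup b D t N B s' := (hsetup.set (by omega)).frame hF
    have hv' : s'.reg 20 = v := (hF.reg 20 rfl).trans (by simp [MState.set_reg, hv₁])
    refine Ends.le (T := 150 * b ^ 3 + 13 * b + 18 + 1 + 1) ?_ (by omega)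
    rcases hI with ⟨S, hS, h40, h3, h22⟩ | ⟨hS, h40, h1⟩
    · refine Ends.cond (fun _ => Ends.const ?_) fun h => absurd h (by omega)
      refine .inl ⟨S, by simp [GraphInput.findUpTo, hS], by simp [MState.set_reg, h40],
        h3.congr rfl, by simp [MState.set_reg, h22]⟩
    · refine Ends.cond (fun h => absurd h40 h) fun _ => ?_
      refine Ends.then (Ends.search hsetup' hb.deg hb.big hb.sq hb.len hv' h1)
        (T' := 50 * b ^ 3 + 13 * b + 19) (by omega) fun s₂ hF₂ hs₂ => ?_
      refine Ends.then (Ends.next (hsetup'.frame hF₂) (by omega) (h1.congr (hF₂.arr 1 rfl)))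
        (T' := 50 * b ^ 3 + 4 * b + 13 + 1 + 1) (by omega) fun s₃ hF₃ hs₃ => ?_
      have hsetup₃ := (hsetup'.frame hF₂).frame hF₃
      have hsearch := hs₂.frame hF₃
      have h40₃ : s₃.reg 40 = 0 := ((hF₃.reg 40 rfl).trans (hF₂.reg 40 rfl)).trans h40
      clear hF₂ hs₂ hF₃
      have hlen := (A.searchInv (fun i _ => i ∈ blockList b t j) v b).length_snd
      set p := A.codedSearch b t v j with hp
      have hfind : A.findUpTo D b t v (j + 1) = if A.Accepts D b t v j then some p.2 else none := by
        rw [GraphInput.findUpTo, hS]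
      have hAcc : A.Accepts D b t v j ↔ p.1.length < b ∧ D * A.cutCount p.2 < p.2.length := Iff.rfl
      rw [hfind]
      refine Ends.sub_seq ?_
      refine Ends.cond (fun hne => ?_) fun he => ?_
      · simp [MState.set_reg, hsetup₃.base, hsearch.queue_len] at hne
        refine Ends.then (Ends.cut (hsetup₃.set (by omega)) hb (hsearch.found.congr rfl)
          (by simp [MState.set_reg, hsearch.found_len]) hlen) (T' := 4 * b + 13)
          (by omega) fun s₄ hF₄ hs₄ => ?_
        have hsetup₄ : Setup b D t N B s₄ := (hsetup₃.set (by omega)).frame hF₄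
        refine Ends.then (Ends.mul (z := 44) hsetup₄.zero hsetup₄.one (by omega) (by omega)
          (by omega)) (T' := 4 + 1 + 1 + 1) (by rw [hsetup₄.ratio]; omega) fun s₅ hF₅ hs₅ => ?_
        have h22 : s₅.reg 22 = p.2.length := ((hF₅.reg 22 rfl).trans (hF₄.reg 22 rfl)).trans
          (by simp [MState.set_reg, hsearch.found_len])
        have h40₅ : s₅.reg 40 = 0 := ((hF₅.reg 40 rfl).trans (hF₄.reg 40 rfl)).trans
          (by simp [MState.set_reg, h40₃])
        have h3 : Holds s₅ 3 (labels p.2) := hsearch.found.congr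
          ((hF₅.arr 3 rfl).trans (hF₄.arr 3 rfl))
        have h1₅ : Holds s₅ 1 (blockList b t (j + 1)) := hs₃.congr
          ((hF₅.arr 1 rfl).trans (hF₄.arr 1 rfl))
        rw [hsetup₄.ratio, hs₄] at hs₅
        refine Ends.sub_seq ?_
        refine Ends.cond (fun hne' => Ends.const ?_) fun he' => Ends.const ?_
        · simp [MState.set_reg, h22, hs₅] at hne'
          have hacc : A.Accepts D b t v j := hAcc.2 ⟨by omega, by omega⟩
          exact .inl ⟨p.2, by rw [if_pos hacc], by simp [MState.set_reg], h3.congr rfl,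
            by simp [MState.set_reg, h22]⟩
        · simp [MState.set_reg, h22, hs₅] at he'
          have hacc : ¬ A.Accepts D b t v j := fun h => by
            have := (hAcc.1 h).2
            omega
          exact .inr ⟨by rw [if_neg hacc], by simp [MState.set_reg, h40₅], h1₅.congr rfl⟩
      · simp [MState.set_reg, hsetup₃.base, hsearch.queue_len] at he
        have hacc : ¬ A.Accepts D b t v j := fun h => by
          have := (hAcc.1 h).1
          omega
        exact Ends.const (T := 50 * b ^ 3 + 4 * b + 12) <| .inr ⟨by rw [if_neg hacc],
          by simp [MState.set_reg, h40₃], hs₃.congr rfl⟩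
  · have hv' : s'.reg 20 = v := (hF'.reg 20 rfl).trans (by simp [MState.set_reg, hv₁])
    rw [GraphInput.findSet, ← hb.codes]
    rcases hs' with ⟨S, hS, h40, h3, h22⟩ | ⟨hS, h40, h1⟩
    · refine Ends.cond (fun _ => Ends.const (T := 2) ?_) fun h => absurd h (by omega)
      rw [hS]
      exact ⟨h3.congr rfl, by simp [MState.set_reg, h22]⟩
    · refine Ends.cond (fun h => absurd h40 h) fun _ => ?_
      refine Ends.const_seq ?_
      refine Ends.write_seq ?_
      refine Ends.const (T := 0) ?_
      rw [hS]
      refine ⟨fun i hi => ?_, by simp [MState.set_reg]⟩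
      simp only [Option.getD_none, labels, List.map_cons, List.map_nil, List.length_singleton,
        Nat.lt_one_iff] at hi
      subst hi
      simp [MState.set_reg, MState.set_arr, MState.setArr_arr, hv']

/-- Append the queue in array `2` to array `4`. -/
def Program.appendQueue : Program :=
  .for 50 51 21 (.seq (.read 52 2 50) (.seq (.write 4 47 52) (.add 47 47 6)))

theorem Ends.appendQueue {s : MState} (h : Setup b D t N B s) {q l : List (Fin n)}
    (hq : Holds s 2 (labels q)) (hlen : s.reg 21 = q.length) (hl : Holds s 4 (labels l))
    (hlen' : s.reg 47 = l.length) :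
    Ends A ω .appendQueue s (6 * q.length + 3) fun s' =>
      Holds s' 4 (labels (l ++ q)) ∧ s'.reg 47 = (l ++ q).length := by
  refine (Ends.for (T := 3) (N := q.length) (fun j s' =>
      Holds s' 4 (labels (l ++ q.take j)) ∧ s'.reg 47 = (l ++ q.take j).length)
    h.zero h.one hlen (by omega) (by omega)
    (by omega) (by omega) (by omega) (by omega) (by rfl) (by rfl) (by rfl) (by rfl)
    ?_ ?_ ?_).mono (by omega) fun s' _ hs' => ?_
  · exact fun j s x => ⟨fun h => ⟨h.1.congr rfl, by rw [← h.2]; simp [MState.set_reg]⟩,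
      fun h => ⟨h.1.congr rfl, by rw [← h.2]; simp [MState.set_reg]⟩⟩
  · simpa using ⟨hl, hlen'⟩
  · rintro j hj s' hF ⟨h1, h2⟩ hi
    rw [List.take_succ_eq_append_getElem hj, ← List.append_assoc]
    have hu : s'.arr 2 j = q[j] := by
      rw [hF.arr 2 rfl, hq j (by simpa using hj)]
      simp
    refine Ends.read_seq ?_
    refine Ends.write_seq ?_
    refine Ends.add (T := 0) ⟨?_, ?_⟩
    · rw [labels_append_singleton]
      refine Holds.congr (Holds.append (k := s'.reg 47) (x := q[j]) h1 (by simpa using h2)) ?_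
      funext i
      simp [MState.set_arr, MState.setArr_arr, MState.set_reg, hi, hu]
    · rw [List.length_append, ← h2]
      simp [MState.set_reg, MState.setArr_reg, (h.frame hF).one]
  · rwa [List.take_length] at hs'

/-- Store in array `4` the vertices met in the completed searches from the vertex in
register `20`. -/
def Program.collect : Program :=
  .seq .clear (.seq (.const 47 0) (.for 48 49 15 (.seq .search (.seq .next
    (.seq (.sub 52 7 21) (.cond 52 .appendQueue (.const 52 0)))))))

theorem Ends.collect {s : MState} (h : Setup b D t N B s) (hb : Bounded A d b D t N)
    {v : Fin n} (hv : s.reg 20 = v) :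
    Ends A ω .collect s (250 * (N * b ^ 3)) fun s' =>
      Holds s' 4 (labels (A.collectUpTo b t v N)) ∧
        s'.reg 47 = (A.collectUpTo b t v N).length := by
  have hdb := hb.deg_le
  have hbig := hb.big
  have htb := hb.len
  have hNpos : 1 ≤ N := by
    rw [hb.codes]
    exact Nat.one_le_pow _ _ (by omega)
  have hcube : 256 * b ≤ b ^ 3 := by nlinarith [mul_pos (by omega : 0 < b) (by omega : 0 < b)]
  obtain ⟨T, hT⟩ : ∃ T, T = 100 * b ^ 3 + 15 * b + 20 := ⟨_, rfl⟩
  have hTle : 4 * b + (N * (T + 3) + 3) + 20 ≤ 250 * (N * b ^ 3) := by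
    have e1 : T + 3 ≤ 101 * b ^ 3 := by omega
    have e2 : b ^ 3 ≤ N * b ^ 3 := Nat.le_mul_of_pos_left _ hNpos
    have e3 : N * (T + 3) ≤ 101 * (N * b ^ 3) := by nlinarith
    omega
  refine Ends.then (Ends.clear h) (T' := N * (T + 3) + 3 + 1) (by omega) fun s₁ hF₁ hs₁ => ?_
  have hsetup := h.frame hF₁
  have hv₁ : s₁.reg 20 = v := (hF₁.reg 20 rfl).trans hv
  clear hF₁
  refine Ends.const_seq ?_
  refine (Ends.for (T := T) (N := N) (fun j s' =>
      Holds s' 4 (labels (A.collectUpTo b t v j)) ∧ s'.reg 47 = (A.collectUpTo b t v j).length ∧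
        Holds s' 1 (blockList b t j))
    (by simp [MState.set_reg, hsetup.zero]) (by simp [MState.set_reg, hsetup.one])
    (by simp [MState.set_reg, hsetup.codes]) (by omega) (by omega)
    (by omega) (by omega) (by omega) (by omega) (by rfl) (by rfl) (by rfl) (by rfl)
    ?_ ?_ ?_).mono le_rfl fun s' _ hs' => ⟨hs'.1, hs'.2.1⟩
  · exact fun j s x => ⟨fun h => by simpa [MState.set_reg, holds_set] using h,
      fun h => by simpa [MState.set_reg, holds_set] using h⟩
  · exact ⟨fun i hi => by simp [GraphInput.collectUpTo] at hi,
      by simp [MState.set_reg, GraphInput.collectUpTo], hs₁.congr rfl⟩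
  · rintro j hj s' hF ⟨h4, h47, h1⟩ hi
    have hsetup' : Setup b D t N B s' := (hsetup.set (by omega)).frame hF
    have hv' : s'.reg 20 = v := (hF.reg 20 rfl).trans (by simp [MState.set_reg, hv₁])
    refine Ends.then (Ends.search hsetup' hb.deg hb.big hb.sq hb.len hv' h1)
      (T' := 15 * b + 20) (by omega) fun s₂ hF₂ hs₂ => ?_
    refine Ends.then (Ends.next (hsetup'.frame hF₂) (by omega) (h1.congr (hF₂.arr 1 rfl)))
      (T' := 6 * b + 9 + 1 + 1) (by omega) fun s₃ hF₃ hs₃ => ?_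
    have hsetup₃ := (hsetup'.frame hF₂).frame hF₃
    have hsearch := hs₂.frame hF₃
    have h47₃ : s₃.reg 47 = (A.collectUpTo b t v j).length :=
      ((hF₃.reg 47 rfl).trans (hF₂.reg 47 rfl)).trans h47
    have h4₃ : Holds s₃ 4 (labels (A.collectUpTo b t v j)) :=
      h4.congr ((hF₃.arr 4 rfl).trans (hF₂.arr 4 rfl))
    clear hF₂ hs₂ hF₃
    set p := A.codedSearch b t v j with hp
    have hcol : A.collectUpTo b t v (j + 1) = A.collectUpTo b t v j ++
      if p.1.length < b then p.1 else [] := rfl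
    rw [hcol]
    refine Ends.sub_seq ?_
    refine Ends.cond (fun hne => ?_) fun he => ?_
    · simp [MState.set_reg, hsetup₃.base, hsearch.queue_len] at hne
      rw [if_pos (by omega)]
      refine (Ends.appendQueue (q := p.1) (hsetup₃.set (by omega)) (hsearch.queue.congr rfl)
        (by simp [MState.set_reg, hsearch.queue_len]) (h4₃.congr rfl)
        (by simp [MState.set_reg, h47₃])).mono (by omega) fun s₄ hF₄ hs₄ =>
        ⟨hs₄.1, hs₄.2, hs₃.congr (hF₄.arr 1 rfl)⟩
    · simp [MState.set_reg, hsetup₃.base, hsearch.queue_len] at he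
      rw [if_neg (by omega), List.append_nil]
      exact Ends.const (T := 6 * b + 8) ⟨h4₃.congr rfl, by simp [MState.set_reg, h47₃],
        hs₃.congr rfl⟩

end Isolating

/-! ### Keys on demand and the computation of winners -/

section Drawing

variable {n : ℕ} {A : GraphInput n} {ω : Coins} {b D t N B d : ℕ}

/-- The keys drawn so far are stored in array `6` and marked in array `5`, and no coin has been
tossed under any other number. -/
def Memo (ω : Coins) (B : ℕ) (s : MState) : Prop :=
  ∀ y, (s.arr 5 y = 0 ∧ s.tossed y = 0) ∨ (s.arr 5 y ≠ 0 ∧ s.arr 6 y = coinKey ω y B)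

theorem Memo.frame {s s' : MState} (h : Memo ω B s) {P : Program} (hF : Frame P s s')
    (h1 : P.wa 5 = false := by rfl) (h2 : P.wa 6 = false := by rfl)
    (h3 : P.wt = false := by rfl) : Memo ω B s' := by
  unfold Memo
  rw [hF.arr 5 h1, hF.arr 6 h2, hF.tossed h3]
  exact h

theorem memo_set (s : MState) (x c : ℕ) : Memo ω B (s.set x c) ↔ Memo ω B s := Iff.rfl

/-- Provide the key of the number in register `53`. -/
def Program.draw : Program :=
  .seq (.read 58 5 53) (.cond 58 (.const 58 1) (.seq (.const 54 0) (.seq (.for 55 56 16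
    (.seq (.toss 57 53) (.seq (.add 54 54 54) (.add 54 54 57))))
    (.seq (.write 6 53 54) (.write 5 53 6)))))

/-- The key of `y` consists of the first `B` bits filed under `y`, whenever it is drawn, and
afterwards it is read from memory. This makes the keys, and with them the partition, independent of
the order of the queries. -/
theorem Ends.draw {s : MState} (h : Setup b D t N B s) (hM : Memo ω B s) {y : ℕ}
    (hy : s.reg 53 = y) :
    Ends A ω .draw s (6 * B + 8) fun s' => Memo ω B s' ∧ s'.arr 6 y = coinKey ω y B := by
  refine Ends.le (T := 6 * B + 5 + 1 + 1 + 1) ?_ (by omega)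
  refine Ends.read_seq ?_
  refine Ends.cond (fun hne => ?_) fun he => ?_
  · simp [MState.set_reg, hy] at hne
    refine Ends.const (T := 6 * B + 5) ⟨hM, ?_⟩
    exact ((hM y).resolve_left fun h => hne h.1).2
  · simp [MState.set_reg, hy] at he
    -- No coin has been tossed under an unmarked number, so the tosses that follow return its bits
    -- `0`, …, `B - 1`.
    have hz : s.tossed y = 0 := ((hM y).resolve_right fun h => h.1 he).2
    refine Ends.const_seq ?_
    refine Ends.then (T' := 1 + 1) (Ends.for (T := 3) (N := B) (fun j s' =>
        s'.reg 54 = coinKey ω y j ∧ ∀ z, s'.tossed z = if z = y then j else s.tossed z)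
      (by simp [MState.set_reg, h.zero]) (by simp [MState.set_reg, h.one])
      (by simp [MState.set_reg, h.bits]) (by omega) (by omega)
      (by omega) (by omega) (by omega) (by omega) (by rfl) (by rfl) (by rfl) (by rfl)
      (by simp [MState.set_reg, MState.set_tossed]) ?_ ?_) (by omega) fun s' hF' hs' => ?_
    · refine ⟨by simp [MState.set_reg, coinKey], fun z => ?_⟩
      simp only [MState.set_tossed]
      split_ifs with hzy
      · rw [hzy, hz]
      · rfl
    · rintro j hj s' hF ⟨h1, h2⟩ hi
      have hy' : s'.reg 53 = y := (hF.reg 53 rfl).trans (by simp [MState.set_reg, hy])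
      refine Ends.toss_seq ?_
      refine Ends.add_seq ?_
      refine Ends.add (T := 0) ⟨?_, fun z => ?_⟩
      · simp [MState.set_reg, MState.tick_reg, hy', h1, h2, coinKey]
      · simp only [MState.set_tossed, MState.tick_tossed, hy', h2, if_true]
        split_ifs <;> rfl
    · have hy' : s'.reg 53 = y := (hF'.reg 53 rfl).trans (by simp [MState.set_reg, hy])
      have hone : s'.reg 6 = 1 := (hF'.reg 6 rfl).trans (by simp [MState.set_reg, h.one])
      refine Ends.write_seq ?_
      refine Ends.write (T := 0) ⟨fun z => ?_, ?_⟩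
      · simp only [MState.setArr_arr, MState.setArr_reg, MState.setArr_tossed, hy', hone, hs'.1,
          hs'.2, hF'.arr 5 rfl, hF'.arr 6 rfl, MState.set_arr]
        by_cases hzy : z = y
        · simp [hzy]
        · simpa [hzy] using hM z
      · simp [MState.setArr_arr, MState.setArr_reg, hy', hs'.1]

theorem GraphInput.best_append_singleton (x z y : Fin n) (l : List (Fin n)) :
    A.best D b t ω B x z (l ++ [y]) =
      if x ∈ A.findSet D b t y ∧ Beats ω B y (A.best D b t ω B x z l) then y
      else A.best D b t ω B x z l := by
  induction l generalizing z with
  | nil => rfl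
  | cons u l ih => exact ih _

/-- Replace the vertex in register `60` by the one in register `20` if that has a higher
priority. -/
def Program.contest : Program :=
  .seq (.add 53 20 5) (.seq .draw (.seq (.read 54 6 20) (.seq (.sub 65 61 54)
    (.cond 65 (.seq (.add 60 20 5) (.add 61 54 5)) (.seq (.sub 66 54 61) (.cond 66 (.const 65 0)
      (.seq (.sub 65 60 20) (.cond 65 (.seq (.add 60 20 5) (.add 61 54 5)) (.const 65 0)))))))))

theorem Ends.contest {s : MState} (h : Setup b D t N B s) (hM : Memo ω B s) {y z : Fin n}
    (hy : s.reg 20 = y) (hz : s.reg 60 = z) (hkey : s.reg 61 = coinKey ω z B) :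
    Ends A ω .contest s (6 * B + 20) fun s' => Memo ω B s' ∧
      s'.reg 60 = (if Beats ω B y z then y else z : Fin n) ∧
      s'.reg 61 = coinKey ω (if Beats ω B y z then y else z : Fin n) B := by
  refine Ends.le (T := 6 * B + 19 + 1) ?_ (by omega)
  refine Ends.add_seq ?_
  refine Ends.then (Ends.draw (h.set (by omega)) ((memo_set _ _ _).2 hM) (y := y)
    (by simp [MState.set_reg, hy, h.zero])) (T' := 4 + 1 + 1 + 1 + 1 + 1 + 1) (by omega)
    fun s' hF hs' => ?_
  have hy' : s'.reg 20 = y := (hF.reg 20 rfl).trans (by simp [MState.set_reg, hy])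
  have hz' : s'.reg 60 = z := (hF.reg 60 rfl).trans (by simp [MState.set_reg, hz])
  have hkey' : s'.reg 61 = coinKey ω z B := (hF.reg 61 rfl).trans (by simp [MState.set_reg, hkey])
  have h5 : s'.reg 5 = 0 := (hF.reg 5 rfl).trans (by simp [MState.set_reg, h.zero])
  have hBeats : Beats ω B y z ↔ coinKey ω y B < coinKey ω z B ∨
    (coinKey ω y B = coinKey ω z B ∧ (y : ℕ) < z) := Iff.rfl
  refine Ends.read_seq ?_
  refine Ends.sub_seq ?_
  refine Ends.cond (fun hne => ?_) fun he => ?_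
  · simp [MState.set_reg, hy', hkey', hs'.2] at hne
    rw [if_pos (hBeats.2 (.inl (by omega)))]
    refine Ends.add_seq ?_
    exact Ends.add ⟨hs'.1, by simp [MState.set_reg, hy', h5],
      by simp [MState.set_reg, hy', h5, hs'.2]⟩
  · simp [MState.set_reg, hy', hkey', hs'.2] at he
    refine Ends.sub_seq ?_
    refine Ends.cond (fun hne => ?_) fun he' => ?_
    · simp [MState.set_reg, hy', hkey', hs'.2] at hne
      rw [if_neg fun h => by have := hBeats.1 h; omega]
      exact Ends.const ⟨hs'.1, by simp [MState.set_reg, hz'], by simp [MState.set_reg, hkey']⟩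
    · simp [MState.set_reg, hy', hkey', hs'.2] at he'
      refine Ends.le (T := 0 + 1 + 1 + 1 + 1) ?_ (by omega)
      refine Ends.sub_seq ?_
      refine Ends.cond (fun hne => ?_) fun he'' => ?_
      · simp [MState.set_reg, hy', hz'] at hne
        rw [if_pos (hBeats.2 (.inr ⟨by omega, by omega⟩))]
        refine Ends.add_seq ?_
        exact Ends.add ⟨hs'.1, by simp [MState.set_reg, hy', h5],
          by simp [MState.set_reg, hy', h5, hs'.2]⟩
      · simp [MState.set_reg, hy', hz'] at he''
        rw [if_neg fun h => by have := hBeats.1 h; omega]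
        exact Ends.const ⟨hs'.1, by simp [MState.set_reg, hz'], by simp [MState.set_reg, hkey']⟩

/-- Store in register `60` the vertex of the highest priority among those whose set contains the
vertex in register `59`. -/
def Program.win : Program :=
  .seq (.add 53 59 5) (.seq .draw (.seq (.read 61 6 59) (.seq (.add 60 59 5)
    (.seq (.add 20 59 5) (.seq .collect (.for 62 63 47 (.seq (.read 20 4 62) (.seq .find
      (.seq (.mem 3 22 59) (.cond 14 .contest (.const 65 0)))))))))))

/-- There are at most `N * b` candidates, and for each of them a set is computed in time of order `N
* b ^ 3`. -/
theorem Ends.win {s : MState} (h : Setup b D t N B s) (hb : Bounded A d b D t N)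
    (hB : B ≤ b * b) (hM : Memo ω B s) {x : Fin n} (hx : s.reg 59 = x) :
    Ends A ω .win s (300 * (N * N * b ^ 4)) fun s' => Memo ω B s' ∧
      s'.reg 60 = A.winner D b t ω B x := by
  have hbig := hb.big
  have hNpos : 1 ≤ N := by
    rw [hb.codes]
    exact Nat.one_le_pow _ _ (by omega)
  have hcube : 256 * b ≤ b ^ 3 := by nlinarith [mul_pos (by omega : 0 < b) (by omega : 0 < b)]
  have hcube' : 16 * (b * b) ≤ b ^ 3 := by nlinarith [mul_pos (by omega : 0 < b) (by omega : 0 < b)]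
  have hN3 : b ^ 3 ≤ N * b ^ 3 := Nat.le_mul_of_pos_left _ hNpos
  obtain ⟨M, hM'⟩ : ∃ M, M = N * b ^ 3 := ⟨_, rfl⟩
  have hfind := fun {s' : MState} (h' : Setup b D t N B s') {v : Fin n} (hv : s'.reg 20 = v) =>
    Ends.find (ω := ω) h' hb hv
  have hcollect := fun {s' : MState} (h' : Setup b D t N B s') {v : Fin n} (hv : s'.reg 20 = v) =>
    Ends.collect (ω := ω) h' hb hv
  rw [← hM'] at hfind hcollect hN3
  have hTle : N * b * (260 * M + 3) + 250 * M + 6 * B + 20 ≤ 300 * (N * N * b ^ 4) := by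
    have e1 : N * N * b ^ 4 = N * b * M := by rw [hM']; ring
    have e2 : 16 ≤ N * b := by nlinarith
    have e3 : 16 * M ≤ N * b * M := Nat.mul_le_mul_right _ e2
    have e4 : N * b * (260 * M + 3) = 260 * (N * b * M) + 3 * (N * b) := by ring
    have e5 : N * b ≤ M := by
      rw [hM']
      exact Nat.mul_le_mul_left _ (Nat.le_self_pow (by omega) b)
    omega
  refine Ends.le (T := N * b * (260 * M + 3) + 250 * M + 6 * B + 19 + 1) ?_ hTle
  refine Ends.add_seq ?_
  refine Ends.then (Ends.draw (h.set (by omega)) ((memo_set _ _ _).2 hM) (y := x)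
    (by simp [MState.set_reg, hx, h.zero])) (T' := N * b * (260 * M + 3) + 250 * M + 5 + 1 + 1 + 1)
    (by omega) fun s₁ hF₁ hs₁ => ?_
  have hsetup₁ : Setup b D t N B s₁ := (h.set (by omega)).frame hF₁
  have hx₁ : s₁.reg 59 = x := (hF₁.reg 59 rfl).trans (by simp [MState.set_reg, hx])
  clear hF₁
  refine Ends.read_seq ?_
  refine Ends.add_seq ?_
  refine Ends.add_seq ?_
  refine Ends.then (hcollect (v := x) (((hsetup₁.set (by omega)).set (by omega)).set (by omega))
    (by simp [MState.set_reg, hx₁, hsetup₁.zero])) (T' := N * b * (260 * M + 3) + 3)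
    (by omega) fun s₂ hF₂ hs₂ => ?_
  have hsetup₂ : Setup b D t N B s₂ :=
    Setup.frame (((hsetup₁.set (by omega)).set (by omega)).set (by omega)) hF₂
  have hx₂ : s₂.reg 59 = x := (hF₂.reg 59 rfl).trans (by simp [MState.set_reg, hx₁])
  have h60 : s₂.reg 60 = x :=
    (hF₂.reg 60 rfl).trans (by simp [MState.set_reg, hx₁, hsetup₁.zero])
  have h61 : s₂.reg 61 = coinKey ω x B :=
    (hF₂.reg 61 rfl).trans (by simp [MState.set_reg, hx₁, hs₁.2])
  have hM₂ : Memo ω B s₂ := Memo.frame (s := ((s₁.set _ _).set _ _).set _ _) hs₁.1 hF₂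
  clear hF₂
  have hlen := A.length_collectUpTo_le b t x N
  obtain ⟨h4, h47⟩ := hs₂
  have hwin : A.winner D b t ω B x = A.best D b t ω B x x (A.collectUpTo b t x N) := by
    rw [GraphInput.winner, hb.codes]
  rw [hwin]
  set l := A.collectUpTo b t x N
  refine (Ends.for (T := 260 * M) (N := l.length) (fun j s' => Memo ω B s' ∧
      s'.reg 60 = A.best D b t ω B x x (l.take j) ∧
      s'.reg 61 = coinKey ω (A.best D b t ω B x x (l.take j)) B)
    hsetup₂.zero hsetup₂.one h47 (by omega) (by omega)
    (by omega) (by omega) (by omega) (by omega) (by rfl) (by rfl) (by rfl) (by rfl)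
    (by simp [MState.set_reg, memo_set]) ⟨hM₂, h60, h61⟩ ?_).mono (by gcongr)
    fun s' _ hs' => ?_
  · rintro j hj s' hF ⟨h1, h2, h3⟩ hi
    have hsetup' := hsetup₂.frame hF
    have hx' : s'.reg 59 = x := (hF.reg 59 rfl).trans hx₂
    have hy : s'.arr 4 j = l[j] := by
      rw [hF.arr 4 rfl, h4 j (by simpa using hj)]
      simp
    rw [List.take_succ_eq_append_getElem hj, GraphInput.best_append_singleton]
    set z := A.best D b t ω B x x (l.take j)
    refine Ends.le (T := 259 * M + 1) ?_ (by omega)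
    refine Ends.read_seq ?_
    refine Ends.then (hfind (v := l[j]) (hsetup'.set (by omega)) (by simp [MState.set_reg, hi, hy]))
      (T' := 9 * b + 6 * B + 30) (by omega) fun s₃ hF₃ hs₃ => ?_
    have hsetup₃ : Setup b D t N B s₃ := (hsetup'.set (by omega)).frame hF₃
    have hx₃ : s₃.reg 59 = x := (hF₃.reg 59 rfl).trans (by simp [MState.set_reg, hx'])
    have hy₃ : s₃.reg 20 = l[j] := (hF₃.reg 20 rfl).trans (by simp [MState.set_reg, hi, hy])
    have h2₃ : s₃.reg 60 = z := (hF₃.reg 60 rfl).trans (by simp [MState.set_reg, h2])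
    have h3₃ : s₃.reg 61 = coinKey ω z B := (hF₃.reg 61 rfl).trans (by simp [MState.set_reg, h3])
    have hM₃ : Memo ω B s₃ := Memo.frame (s := s'.set _ _) h1 hF₃
    clear hF₃
    refine Ends.mem_cond (T := 6 * B + 19 + 1) hsetup₃.zero hsetup₃.one hs₃.1
      (by simp [hs₃.2]) (by omega) (by omega) ?_ (fun s₄ hF₄ hmem => ?_) fun s₄ hF₄ hmem => ?_
    · have := A.length_findSet_le (D := D) (t := t) (by omega : 0 < b) l[j]
      simp only [labels, List.length_map]
      omega
    · rw [hx₃, mem_labels] at hmem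
      simp only [hmem, true_and]
      exact Ends.contest (hsetup₃.frame hF₄) (hM₃.frame hF₄) ((hF₄.reg 20 rfl).trans hy₃)
        ((hF₄.reg 60 rfl).trans h2₃) ((hF₄.reg 61 rfl).trans h3₃)
    · rw [hx₃, mem_labels] at hmem
      simp only [hmem, false_and, if_false]
      have hM₄ := hM₃.frame hF₄
      exact Ends.const ⟨hM₄, by simp [MState.set_reg, hF₄.reg 60 rfl, h2₃],
        by simp [MState.set_reg, hF₄.reg 61 rfl, h3₃]⟩
  · rw [List.take_length] at hs'
    exact ⟨hs'.1, hs'.2.1⟩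

end Drawing

/-! ### Listing the part of a vertex -/

section Answering

variable {n : ℕ} {A : GraphInput n} {ω : Coins} {b D t N B d : ℕ}

/-- Copy the list in array `3` to array `7`. -/
def Program.save : Program :=
  .seq (.add 72 22 5) (.for 74 75 72 (.seq (.read 76 3 74) (.write 7 74 76)))

theorem Ends.save {s : MState} (h : Setup b D t N B s) {l : List (Fin n)}
    (hl : Holds s 3 (labels l)) (hlen : s.reg 22 = l.length) :
    Ends A ω .save s (5 * l.length + 4) fun s' =>
      Holds s' 7 (labels l) ∧ s'.reg 72 = l.length := by
  refine Ends.le (T := l.length * (2 + 3) + 3 + 1) ?_ (by omega)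
  refine Ends.add_seq ?_
  refine (Ends.for (T := 2) (N := l.length) (fun j s' =>
      (∀ i (hi : i < l.length), i < j → s'.arr 7 i = l[i]) ∧ s'.reg 72 = l.length)
    (by simp [MState.set_reg, h.zero]) (by simp [MState.set_reg, h.one])
    (by simp [MState.set_reg, hlen, h.zero]) (by omega) (by omega)
    (by omega) (by omega) (by omega) (by omega) (by rfl) (by rfl) (by rfl) (by rfl)
    (by simp [MState.set_reg, MState.set_arr])
    ⟨by simp, by simp [MState.set_reg, hlen, h.zero]⟩ ?_).mono le_rfl fun s' _ hs' => ?_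
  · rintro j hj s' hF ⟨h1, h2⟩ hi
    have hu : s'.arr 3 j = l[j] := by
      rw [hF.arr 3 rfl, MState.set_arr, hl j (by simpa using hj)]
      simp
    refine Ends.read_seq ?_
    refine Ends.write (T := 0) ⟨fun i hil hij => ?_, by simp [MState.setArr_reg, MState.set_reg, h2]⟩
    simp only [MState.setArr_arr, MState.set_reg, MState.set_arr, if_true, hi]
    rcases Nat.lt_succ_iff_lt_or_eq.1 hij with hij | rfl
    · simp [hij.ne, h1 i hil hij]
    · simp [hu]
  · refine ⟨fun i hi => ?_, hs'.2⟩
    rw [labels, List.length_map] at hi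
    rw [hs'.1 i hi hi]
    simp

/-- Answer the query about the vertex in register `70`. -/
def Program.answer : Program :=
  .seq (.add 59 70 5) (.seq .win (.seq (.add 71 60 5) (.seq (.add 20 60 5) (.seq .find
    (.seq .save (.seq (.const 73 0) (.seq (.for 74 75 72 (.seq (.read 59 7 74) (.seq .win
      (.seq (.sub 76 60 71) (.seq (.sub 77 71 60) (.seq (.add 76 76 77) (.cond 76 (.const 77 0)
        (.seq (.write 0 73 59) (.add 73 73 6))))))))) (.add 0 73 5))))))))

/-- The set of the winner is copied to array `7` first, because computing further winners overwrites
array `3`. Each of its at most `b` members then costs one computation of a winner. -/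
theorem Ends.answer {s : MState} (h : Setup b D t N B s) (hb : Bounded A d b D t N)
    (hB : B ≤ b * b) (hM : Memo ω B s) {v : Fin n} (hv : s.reg 70 = v) :
    Ends A ω .answer s (400 * (N * N * b ^ 5)) fun s' => Memo ω B s' ∧
      Holds s' 0 (labels (A.partList D b t ω B v)) ∧
      s'.reg 0 = (A.partList D b t ω B v).length := by
  have hbig := hb.big
  have hNpos : 1 ≤ N := by
    rw [hb.codes]
    exact Nat.one_le_pow _ _ (by omega)
  obtain ⟨M, hMdef⟩ : ∃ M, M = N * N * b ^ 4 := ⟨_, rfl⟩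
  have hbM : b ≤ M := by
    rw [hMdef]
    calc b ≤ b ^ 4 := Nat.le_self_pow (by omega) b
      _ ≤ N * N * b ^ 4 := Nat.le_mul_of_pos_left _ (by positivity)
  have hfindM : 250 * (N * b ^ 3) ≤ 250 * M := by
    rw [hMdef]
    gcongr 250 * ?_
    calc N * b ^ 3 ≤ N * b ^ 4 := by gcongr <;> omega
      _ ≤ N * N * b ^ 4 := Nat.mul_le_mul_right _ (Nat.le_mul_of_pos_left _ hNpos)
  have hT5 : N * N * b ^ 5 = b * M := by rw [hMdef]; ring
  have h16 : 16 * M ≤ b * M := Nat.mul_le_mul_right _ hbig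
  have hwin := fun {s' : MState} (h' : Setup b D t N B s') (hM' : Memo ω B s') {x : Fin n}
    (hx : s'.reg 59 = x) => Ends.win h' hb hB hM' hx
  rw [← hMdef] at hwin
  have hfind := fun {s' : MState} (h' : Setup b D t N B s') {v : Fin n} (hv : s'.reg 20 = v) =>
    (Ends.find (ω := ω) h' hb hv).le hfindM
  have hTle : b * (301 * M + 3) + 550 * M + 5 * b + 20 ≤ 400 * (N * N * b ^ 5) := by
    have e : b * (301 * M + 3) = 301 * (b * M) + 3 * b := by ring
    omega
  refine Ends.le (T := b * (301 * M + 3) + 550 * M + 5 * b + 19 + 1) ?_ hTle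
  refine Ends.add_seq ?_
  refine Ends.then (hwin (x := v) (h.set (by omega)) ((memo_set _ _ _).2 hM)
    (by simp [MState.set_reg, hv, h.zero]))
    (T' := b * (301 * M + 3) + 250 * M + 5 * b + 16 + 1 + 1) (by omega) fun s₁ hF₁ hs₁ => ?_
  have hsetup₁ : Setup b D t N B s₁ := (h.set (by omega)).frame hF₁
  clear hF₁
  obtain ⟨hM₁, h60⟩ := hs₁
  set u := A.winner D b t ω B v with hu
  refine Ends.add_seq ?_
  refine Ends.add_seq ?_
  refine Ends.then (hfind (v := u) ((hsetup₁.set (by omega)).set (by omega))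
    (by simp [MState.set_reg, h60, hsetup₁.zero]))
    (T' := b * (301 * M + 3) + 5 * b + 16) (by omega) fun s₂ hF₂ hs₂ => ?_
  have hsetup₂ : Setup b D t N B s₂ := Setup.frame ((hsetup₁.set (by omega)).set (by omega)) hF₂
  have h71₂ : s₂.reg 71 = u :=
    (hF₂.reg 71 rfl).trans (by simp [MState.set_reg, h60, hsetup₁.zero])
  have hM₂ : Memo ω B s₂ := Memo.frame (s := (s₁.set _ _).set _ _) hM₁ hF₂
  clear hF₂
  have hlen := A.length_findSet_le (D := D) (t := t) (by omega : 0 < b) u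
  have hpart : A.partList D b t ω B v = (A.findSet D b t u).filter
    fun x => A.winner D b t ω B x = u := rfl
  rw [hpart]
  set l := A.findSet D b t u
  refine Ends.then (Ends.save hsetup₂ hs₂.1 hs₂.2)
    (T' := b * (301 * M + 3) + 11 + 1) (by omega) fun s₃ hF₃ hs₃ => ?_
  have hsetup₃ := hsetup₂.frame hF₃
  have h71₃ : s₃.reg 71 = u := (hF₃.reg 71 rfl).trans h71₂
  have hM₃ := hM₂.frame hF₃
  clear hF₃
  refine Ends.const_seq ?_
  refine Ends.then (T' := 0 + 1) (Ends.for (T := 301 * M) (N := l.length) (fun j s' =>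
      Memo ω B s' ∧ Holds s' 0 (labels ((l.take j).filter fun x => A.winner D b t ω B x = u)) ∧
      s'.reg 73 = ((l.take j).filter fun x => A.winner D b t ω B x = u).length)
    (by simp [MState.set_reg, hsetup₃.zero]) (by simp [MState.set_reg, hsetup₃.one])
    (by simp [MState.set_reg, hs₃.2]) (by omega) (by omega)
    (by omega) (by omega) (by omega) (by omega) (by rfl) (by rfl) (by rfl) (by rfl)
    (by simp [MState.set_reg, memo_set, holds_set])
    ⟨hM₃, fun i hi => by simp at hi, by simp [MState.set_reg]⟩ ?_) ?_ fun s' hF' hs' => ?_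
  · rintro j hj s' hF ⟨h1, h2, h3⟩ hi
    have hsetup' : Setup b D t N B s' := (hsetup₃.set (by omega)).frame hF
    have h71' : s'.reg 71 = u := (hF.reg 71 rfl).trans (by simp [MState.set_reg, h71₃])
    have hx : s'.arr 7 j = l[j] := by
      rw [hF.arr 7 rfl, MState.set_arr, hs₃.1 j (by simpa using hj)]
      simp
    clear hF
    rw [List.take_succ_eq_append_getElem hj, List.filter_append]
    refine Ends.le (T := 301 * M - 1 + 1) ?_ (by omega)
    refine Ends.read_seq ?_
    refine Ends.then (hwin (x := l[j]) (hsetup'.set (by omega)) ((memo_set _ _ _).2 h1)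
      (by simp [MState.set_reg, hi, hx])) (T' := 2 + 1 + 1 + 1 + 1) (by omega) fun s₄ hF₄ hs₄ => ?_
    have hsetup₄ : Setup b D t N B s₄ := (hsetup'.set (by omega)).frame hF₄
    have h71₄ : s₄.reg 71 = u := (hF₄.reg 71 rfl).trans (by simp [MState.set_reg, h71'])
    have hx₄ : s₄.reg 59 = l[j] := (hF₄.reg 59 rfl).trans (by simp [MState.set_reg, hi, hx])
    have h2₄ := Holds.congr (s := s'.set _ _) h2 (hF₄.arr 0 rfl)
    have h3₄ : s₄.reg 73 = ((l.take j).filter fun x => A.winner D b t ω B x = u).length :=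
      (hF₄.reg 73 rfl).trans (by simp [MState.set_reg, h3])
    clear hF₄
    set r := (l.take j).filter fun x => A.winner D b t ω B x = u
    obtain ⟨hM₄, h60₄⟩ := hs₄
    refine Ends.sub_seq ?_
    refine Ends.sub_seq ?_
    refine Ends.add_seq ?_
    refine Ends.cond (fun hne => ?_) fun he => ?_
    · simp [MState.set_reg, h71₄, h60₄] at hne
      have hw : A.winner D b t ω B l[j] ≠ u := by
        intro h
        rw [h] at hne
        omega
      have hfilter : [l[j]].filter (fun x => A.winner D b t ω B x = u) = [] := by simp [hw]
      rw [hfilter, List.append_nil]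
      exact Ends.const (T := 1) ⟨hM₄, h2₄, by simp [MState.set_reg, h3₄]⟩
    · simp [MState.set_reg, h71₄, h60₄] at he
      have hw : A.winner D b t ω B l[j] = u := Fin.ext (by omega)
      have hfilter : [l[j]].filter (fun x => A.winner D b t ω B x = u) = [l[j]] := by simp [hw]
      rw [hfilter]
      refine Ends.write_seq ?_
      refine Ends.add (T := 0) ⟨?_, ?_, ?_⟩
      · exact fun y => by simpa [MState.set_arr, MState.set_tossed, MState.setArr_arr,
          MState.setArr_tossed] using hM₄ y
      · rw [labels_append_singleton]
        refine Holds.congr (Holds.append (k := s₄.reg 73) (x := l[j]) h2₄ (by simpa using h3₄)) ?_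
        funext i
        simp [MState.set_arr, MState.setArr_arr, MState.set_reg, hx₄]
      · rw [List.length_append, ← h3₄]
        simp [MState.set_reg, MState.setArr_reg, hsetup₄.one]
  · have : l.length * (301 * M + 3) ≤ b * (301 * M + 3) := Nat.mul_le_mul_right _ hlen
    omega
  · rw [List.take_length] at hs'
    have h5 : s'.reg 5 = 0 := (hF'.reg 5 rfl).trans (by simp [MState.set_reg, hsetup₃.zero])
    exact Ends.add ⟨hs'.1, hs'.2.1, by simp [MState.set_reg, hs'.2.2, h5]⟩

end Answering

/-! ### Computing the parameters -/

section Preparation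

variable {n : ℕ} {A : GraphInput n} {ω : Coins}

theorem Ends.mul_of {s : MState} {x y z a c : ℕ} (h5 : s.reg 5 = 0) (h6 : s.reg 6 = 1)
    (ha : s.reg x = a) (hc : s.reg y = c)
    (hx : x ≠ z ∧ x ≠ 45 ∧ x ≠ 46) (hy : y ≠ z ∧ y ≠ 45 ∧ y ≠ 46)
    (hz : z ≠ 5 ∧ z ≠ 6 ∧ z ≠ 45 ∧ z ≠ 46) :
    Ends A ω (.mul z x y) s (4 * a + 4) fun s' => s'.reg z = a * c := by
  subst ha hc
  exact Ends.mul h5 h6 hx hy hz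

/-- Divide register `4` by register `3`, rounding up. -/
def Program.divide : Program :=
  .seq (.const 80 0) (.seq (.add 81 4 5) (.loop 81 (.seq (.add 80 80 6) (.sub 81 81 3))))

/-- The two inequalities say that `m` is the quotient `q / p` rounded up, which is the number of
truncated subtractions of `p` that bring `q` to zero. -/
theorem Ends.divide {s : MState} {p q m : ℕ} (h5 : s.reg 5 = 0) (h6 : s.reg 6 = 1)
    (hp : s.reg 3 = p) (hq : s.reg 4 = q) (hlt : (m - 1) * p < q) (hle : q ≤ m * p) :
    Ends A ω .divide s (3 * m + 3) fun s' => s'.reg 80 = m := by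
  refine Ends.le (T := m * (2 + 1) + 1 + 1 + 1) ?_ (by omega)
  refine Ends.const_seq ?_
  refine Ends.add_seq ?_
  refine (Ends.loop (T := 2) (fun r s' => r ≤ m ∧ s'.reg 80 = m - r ∧
    s'.reg 81 = q - (m - r) * p ∧ s'.reg 3 = p ∧ s'.reg 6 = 1) ?_ ?_ m _ ?_).mono le_rfl
    fun s' _ h => h.2.1
  · rintro r s' ⟨h1, h2, h3, h4⟩
    rw [h3]
    constructor
    · intro h
      by_contra hr
      have : (m - r) * p ≤ (m - 1) * p := Nat.mul_le_mul_right _ (by omega)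
      omega
    · rintro rfl
      exact Nat.sub_eq_zero_of_le hle
  · rintro r s' ⟨h1, h2, h3, h4, h5⟩
    refine Ends.add_seq ?_
    refine Ends.sub (T := 0) ⟨by omega, ?_, ?_, ?_, ?_⟩
    · simp [MState.set_reg, h2, h5]
      omega
    · have e : m - r = m - (r + 1) + 1 := by omega
      simp [MState.set_reg, h3, h4]
      rw [e, Nat.succ_mul]
      omega
    · simp [MState.set_reg, h4]
    · simp [MState.set_reg, h5]
  · simp [MState.set_reg, h5, h6, hp, hq]

/-- Store in register `83` the logarithmic parameter of register `82`. -/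
def Program.log : Program :=
  .seq (.const 83 1) (.seq (.const 84 1) (.seq (.sub 85 82 84)
    (.loop 85 (.seq (.add 83 83 6) (.seq (.add 84 84 84) (.sub 85 82 84))))))

theorem Ends.log {s : MState} {x : ℕ} (h6 : s.reg 6 = 1) (hx : s.reg 82 = x) :
    Ends A ω .log s (4 * logParam x) fun s' => s'.reg 83 = logParam x := by
  unfold logParam
  obtain ⟨c, hc⟩ : ∃ c, c = Nat.clog 2 x := ⟨_, rfl⟩
  rw [← hc]
  refine Ends.le (T := c * (3 + 1) + 1 + 1 + 1 + 1) ?_ (by omega)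
  refine Ends.const_seq ?_
  refine Ends.const_seq ?_
  refine Ends.sub_seq ?_
  refine (Ends.loop (T := 3) (fun r s' => r ≤ c ∧ s'.reg 83 = c - r + 1 ∧
    s'.reg 84 = 2 ^ (c - r) ∧ s'.reg 85 = x - 2 ^ (c - r) ∧ s'.reg 82 = x ∧ s'.reg 6 = 1)
    ?_ ?_ c _ ?_).mono le_rfl fun s' _ h => h.2.1
  · rintro r s' ⟨h1, -, -, h2, -⟩
    rw [h2, Nat.sub_eq_zero_iff_le, ← Nat.clog_le_iff_le_pow (by omega), ← hc]
    omega
  · rintro r s' ⟨h1, h2, h3, h4, h5, h6⟩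
    refine Ends.add_seq ?_
    refine Ends.add_seq ?_
    have e : c - r = c - (r + 1) + 1 := by omega
    have e' : 2 ^ (c - (r + 1)) + 2 ^ (c - (r + 1)) = 2 ^ (c - r) := by rw [e, pow_succ]; omega
    refine Ends.sub (T := 0) ⟨by omega, ?_, ?_, ?_, ?_, ?_⟩
    · simp [MState.set_reg, h2, h6]
      omega
    · simp [MState.set_reg, h3, e']
    · simp [MState.set_reg, h3, h5, e']
    · simp [MState.set_reg, h5]
    · simp [MState.set_reg, h6]
  · simp [MState.set_reg, h6, hx]

/-- Store in register `86` the power of two with exponent `c` times register `87`. -/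
def Program.twoPow (c : ℕ) : Program :=
  .seq (.const 86 1) (.seq (.const 89 c) (.seq (.mul 88 89 87) (.for 90 91 88 (.add 86 86 86))))

theorem Ends.twoPow {s : MState} {c x : ℕ} (h5 : s.reg 5 = 0) (h6 : s.reg 6 = 1)
    (hx : s.reg 87 = x) :
    Ends A ω (.twoPow c) s (4 * c + 4 * (c * x) + 9) fun s' => s'.reg 86 = 2 ^ (c * x) := by
  refine Ends.le (T := 4 * c + 4 + (c * x * (1 + 3) + 3) + 1 + 1) ?_ (by omega)
  refine Ends.const_seq ?_
  refine Ends.const_seq ?_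
  refine Ends.seq (Ends.mul_of (a := c) (c := x) (by simp [MState.set_reg, h5])
    (by simp [MState.set_reg, h6]) (by simp [MState.set_reg]) (by simp [MState.set_reg, hx])
    (by omega) (by omega) (by omega)) fun s₁ hF₁ hs₁ => ?_
  have h86 : s₁.reg 86 = 1 := (hF₁.reg 86 rfl).trans (by simp [MState.set_reg])
  refine (Ends.for (T := 1) (N := c * x) (fun j s' => s'.reg 86 = 2 ^ j)
    ((hF₁.reg 5 rfl).trans (by simp [MState.set_reg, h5]))
    ((hF₁.reg 6 rfl).trans (by simp [MState.set_reg, h6])) hs₁ (by omega) (by omega)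
    (by omega) (by omega) (by omega) (by omega) (by rfl) (by rfl) (by rfl) (by rfl)
    (by simp [MState.set_reg]) (by simpa using h86) ?_).mono le_rfl fun s' _ hs' => hs'
  intro j hj s' hF hI hi
  refine Ends.add (T := 0) ?_
  simp [MState.set_reg, hI, pow_succ]
  omega

/-- The quantities from which the parameters of the partition are computed. -/
structure Given (d h m L : ℕ) (s : MState) : Prop where
  zero : s.reg 5 = 0
  one : s.reg 6 = 1
  deg : s.reg 1 = d
  width : s.reg 87 = h + 1
  inv : s.reg 80 = m
  log : s.reg 83 = L
  len : s.reg 9 = 2 * h + 2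

theorem Given.frame {d h m L : ℕ} {P : Program} {s s' : MState} (hs : Given d h m L s)
    (hF : Frame P s s')
    (hP : ([1, 5, 6, 9, 80, 83, 87].all fun r => !P.wr r) = true := by rfl) :
    Given d h m L s' := by
  obtain ⟨h1, h2, h3, h4, h5, h6, h7⟩ := hs
  have hr : ∀ r ∈ [1, 5, 6, 9, 80, 83, 87], s'.reg r = s.reg r := fun r hr =>
    hF.reg r (by simpa using List.all_eq_true.1 hP r hr)
  constructor <;> (rw [hr _ (by simp)]; assumption)

/-- Compute the quantities from which the parameters of the partition are computed. -/
def Program.given : Program :=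
  .seq (.const 5 0) (.seq (.const 6 1) (.seq (.add 87 2 6) (.seq (.add 9 87 87) (.seq .divide
    (.seq (.mul 82 1 80) .log)))))

theorem Ends.given {s : MState} {d h p q m : ℕ} (hd : s.reg 1 = d) (hh : s.reg 2 = h)
    (hp : s.reg 3 = p) (hq : s.reg 4 = q) (hlt : (m - 1) * p < q) (hle : q ≤ m * p) :
    Ends A ω .given s (3 * m + 4 * d + 4 * logParam (d * m) + 11)
      fun s' => Given d h m (logParam (d * m)) s' := by
  refine Ends.le (T := 3 * m + 3 + (4 * d + 4 + 4 * logParam (d * m)) + 1 + 1 + 1 + 1) ?_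
    (by omega)
  refine Ends.const_seq ?_
  refine Ends.const_seq ?_
  refine Ends.add_seq ?_
  refine Ends.add_seq ?_
  refine Ends.seq (Ends.divide (p := p) (q := q) (m := m) (by simp [MState.set_reg])
    (by simp [MState.set_reg]) (by simp [MState.set_reg, hp]) (by simp [MState.set_reg, hq])
    hlt hle) fun s₁ hF₁ hs₁ => ?_
  have h5 : s₁.reg 5 = 0 := (hF₁.reg 5 rfl).trans (by simp [MState.set_reg])
  have h6 : s₁.reg 6 = 1 := (hF₁.reg 6 rfl).trans (by simp [MState.set_reg])
  have h1 : s₁.reg 1 = d := (hF₁.reg 1 rfl).trans (by simp [MState.set_reg, hd])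
  have h87 : s₁.reg 87 = h + 1 := (hF₁.reg 87 rfl).trans (by simp [MState.set_reg, hh])
  have h9 : s₁.reg 9 = 2 * h + 2 :=
    (hF₁.reg 9 rfl).trans (by simp [MState.set_reg, hh]; omega)
  clear hF₁
  refine Ends.seq (Ends.mul_of h5 h6 h1 hs₁ (by omega) (by omega) (by omega))
    fun s₂ hF₂ hs₂ => ?_
  refine (Ends.log ((hF₂.reg 6 rfl).trans h6) hs₂).mono le_rfl fun s₃ hF₃ hs₃ => ?_
  have hr : ∀ r ∈ [1, 5, 6, 9, 80, 87], s₃.reg r = s₁.reg r := by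
    intro r hr
    refine (hF₃.reg r ?_).trans (hF₂.reg r ?_) <;> revert r <;> decide
  exact ⟨(hr 5 (by simp)).trans h5, (hr 6 (by simp)).trans h6, (hr 1 (by simp)).trans h1,
    (hr 87 (by simp)).trans h87, (hr 80 (by simp)).trans hs₁, hs₃, (hr 9 (by simp)).trans h9⟩

/-- Compute the parameters of the partition. -/
def Program.prepare : Program :=
  .seq .given (.seq (.twoPow 25) (.seq (.mul 92 83 86) (.seq (.mul 8 80 92) (.seq (.twoPow 40)
    (.seq (.mul 92 83 86) (.seq (.mul 7 1 92) (.seq (.mul 92 1 7) (.seq (.mul 7 80 92)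
    (.seq (.mul 92 80 7) (.seq (.add 7 92 5) (.seq (.mul 16 7 7) (.seq (.const 15 1)
    (.for 90 91 9 (.seq (.mul 92 7 15) (.add 15 92 5)))))))))))))))

/-- Multiplication is repeated addition, at a cost linear in the first factor. The products are
therefore nested so that the first factor is always the logarithm, `d`, `m`, `b` or a small multiple
of `h + 1`. -/
theorem Ends.prepare {s : MState} {d h p q m : ℕ} (hd : s.reg 1 = d) (hh : s.reg 2 = h)
    (hp : s.reg 3 = p) (hq : s.reg 4 = q) (hlt : (m - 1) * p < q) (hle : q ≤ m * p)
    (hd1 : 1 ≤ d) (hm : 0 < m) :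
    Ends A ω .prepare s (sizeParam d h m ^ 3) fun s' => Setup (sizeParam d h m)
      (cutParam d h m) (2 * h + 2) (sizeParam d h m ^ (2 * h + 2))
      (sizeParam d h m * sizeParam d h m) s' := by
  have hbound := mul_le_sizeParam (h := h) hd1 hm
  have hle_size : d ≤ sizeParam d h m ∧ m ≤ sizeParam d h m ∧ logParam (d * m) ≤ sizeParam d h m := by
    have hL := one_le_logParam (d * m)
    have hP : 1 ≤ 2 ^ (40 * (h + 1)) := Nat.one_le_two_pow
    have hm1 : 1 ≤ m := hm
    unfold sizeParam
    refine ⟨?_, ?_, ?_⟩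
    · calc d = 1 * 1 * d * 1 * 1 * 1 := by ring
        _ ≤ _ := by gcongr
    · calc m = 1 * 1 * 1 * 1 * m * 1 := by ring
        _ ≤ _ := by gcongr
    · calc logParam (d * m) = 1 * logParam (d * m) * 1 * 1 * 1 * 1 := by ring
        _ ≤ _ := by gcongr
  obtain ⟨b, hb⟩ : ∃ b, b = sizeParam d h m := ⟨_, rfl⟩
  rw [← hb] at hbound hle_size ⊢
  have hbval : m * (m * (d * (d * (logParam (d * m) * 2 ^ (40 * (h + 1)))))) = b := by
    rw [hb, sizeParam]
    ring
  have hDval : m * (logParam (d * m) * 2 ^ (25 * (h + 1))) = cutParam d h m := by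
    rw [cutParam]
    ring
  obtain ⟨L, hL⟩ : ∃ L, L = logParam (d * m) := ⟨_, rfl⟩
  rw [← hL] at hle_size hbval hDval
  obtain ⟨h1, h2, h3⟩ := hle_size
  have hcube : 2 ^ 30 * b ≤ b ^ 3 := by
    have e : 2 ^ 30 ≤ b := by omega
    calc 2 ^ 30 * b ≤ b * b := Nat.mul_le_mul_right _ e
      _ ≤ b * b * b := Nat.le_mul_of_pos_right _ (by omega)
      _ = b ^ 3 := by ring
  have hloop : 2 ^ 20 * ((2 * h + 2) * (4 * b + 8)) ≤ b ^ 3 := by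
    have e1 : 2 ^ 29 * (2 * h + 2) ≤ b := by omega
    calc 2 ^ 20 * ((2 * h + 2) * (4 * b + 8)) ≤ (2 ^ 29 * (2 * h + 2)) * (b * b) := by nlinarith
      _ ≤ b * (b * b) := Nat.mul_le_mul_right _ e1
      _ = b ^ 3 := by ring
  -- The decreasing budgets leave each stage at least `2 ^ 20 * b` units; `hcube` guarantees that
  -- the subtractions are not truncated.
  refine Ends.then (Ends.given hd hh hp hq hlt hle) (T' := b ^ 3 - 2 ^ 20 * b) (by omega)
    fun s₁ hF₁ hs₁ => ?_
  rw [← hL] at hs₁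
  clear hF₁
  refine Ends.then (Ends.twoPow hs₁.zero hs₁.one hs₁.width) (T' := b ^ 3 - 2 ^ 21 * b) (by omega)
    fun s₂ hF₂ hs₂ => ?_
  replace hs₁ := hs₁.frame hF₂
  refine Ends.then (Ends.mul_of hs₁.zero hs₁.one hs₁.log hs₂ (by omega) (by omega) (by omega))
    (T' := b ^ 3 - 2 ^ 22 * b) (by omega) fun s₃ hF₃ hs₃ => ?_
  replace hs₁ := hs₁.frame hF₃
  refine Ends.then (Ends.mul_of hs₁.zero hs₁.one hs₁.inv hs₃ (by omega) (by omega) (by omega))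
    (T' := b ^ 3 - 2 ^ 23 * b) (by omega) fun s₄ hF₄ hs₄ => ?_
  replace hs₁ := hs₁.frame hF₄
  rw [hDval] at hs₄
  refine Ends.then (Ends.twoPow hs₁.zero hs₁.one hs₁.width) (T' := b ^ 3 - 2 ^ 24 * b) (by omega)
    fun s₅ hF₅ hs₅ => ?_
  replace hs₁ := hs₁.frame hF₅
  replace hs₄ := (hF₅.reg 8 rfl).trans hs₄
  refine Ends.then (Ends.mul_of hs₁.zero hs₁.one hs₁.log hs₅ (by omega) (by omega) (by omega))
    (T' := b ^ 3 - 2 ^ 25 * b) (by omega) fun s₆ hF₆ hs₆ => ?_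
  replace hs₁ := hs₁.frame hF₆
  replace hs₄ := (hF₆.reg 8 rfl).trans hs₄
  refine Ends.then (Ends.mul_of hs₁.zero hs₁.one hs₁.deg hs₆ (by omega) (by omega) (by omega))
    (T' := b ^ 3 - 2 ^ 26 * b) (by omega) fun s₇ hF₇ hs₇ => ?_
  replace hs₁ := hs₁.frame hF₇
  replace hs₄ := (hF₇.reg 8 rfl).trans hs₄
  refine Ends.then (Ends.mul_of hs₁.zero hs₁.one hs₁.deg hs₇ (by omega) (by omega) (by omega))
    (T' := b ^ 3 - 2 ^ 27 * b) (by omega) fun s₈ hF₈ hs₈ => ?_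
  replace hs₁ := hs₁.frame hF₈
  replace hs₄ := (hF₈.reg 8 rfl).trans hs₄
  refine Ends.then (Ends.mul_of hs₁.zero hs₁.one hs₁.inv hs₈ (by omega) (by omega) (by omega))
    (T' := b ^ 3 - 2 ^ 28 * b) (by omega) fun s₉ hF₉ hs₉ => ?_
  replace hs₁ := hs₁.frame hF₉
  replace hs₄ := (hF₉.reg 8 rfl).trans hs₄
  refine Ends.then (Ends.mul_of hs₁.zero hs₁.one hs₁.inv hs₉ (by omega) (by omega) (by omega))
    (T' := 20 * b + (2 * h + 2) * (4 * b + 8) + 1) (by omega) fun s₁₀ hF₁₀ hs₁₀ => ?_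
  replace hs₁ := hs₁.frame hF₁₀
  replace hs₄ := (hF₁₀.reg 8 rfl).trans hs₄
  rw [hbval] at hs₁₀
  clear hF₂ hF₃ hF₄ hF₅ hF₆ hF₇ hF₈ hF₉ hF₁₀ hs₂ hs₃ hs₅ hs₆ hs₇ hs₈ hs₉
  refine Ends.add_seq ?_
  refine Ends.then (Ends.mul_of (a := b) (c := b) (by simp [MState.set_reg, hs₁.zero])
    (by simp [MState.set_reg, hs₁.one]) (by simp [MState.set_reg, hs₁.zero, hs₁₀])
    (by simp [MState.set_reg, hs₁.zero, hs₁₀]) (by omega) (by omega) (by omega))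
    (T' := (2 * h + 2) * (4 * b + 8) + 3 + 1) (by omega) fun s' hF' hs' => ?_
  have hr : ∀ r, (Program.mul 16 7 7).wr r = false → r ≠ 7 → s'.reg r = s₁₀.reg r :=
    fun r hr hr' => (hF'.reg r hr).trans (by rw [MState.set_reg, if_neg hr'])
  have hs7 : s'.reg 7 = b := (hF'.reg 7 rfl).trans (by simp [MState.set_reg, hs₁₀, hs₁.zero])
  have hs5 := (hr 5 rfl (by omega)).trans hs₁.zero
  have hs6 := (hr 6 rfl (by omega)).trans hs₁.one
  have hs9 := (hr 9 rfl (by omega)).trans hs₁.len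
  have hs8 := (hr 8 rfl (by omega)).trans hs₄
  clear hr hF' hs₁ hs₄ hs₁₀
  refine Ends.const_seq ?_
  -- The growing power is the second factor, so every multiplication costs only `4 * b + 4`.
  refine (Ends.for (T := 4 * b + 5) (N := 2 * h + 2) (fun j s₂ => s₂.reg 15 = b ^ j)
    (by simp [MState.set_reg, hs5]) (by simp [MState.set_reg, hs6])
    (by simp [MState.set_reg, hs9]) (by omega) (by omega)
    (by omega) (by omega) (by omega) (by omega) (by rfl) (by rfl) (by rfl) (by rfl)
    (by simp [MState.set_reg]) (by simp [MState.set_reg]) ?_).mono le_rfl fun s₂ hF₂ hs₂ => ?_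
  · intro j hj s₂ hF₂ hI hi
    have h5 : s₂.reg 5 = 0 := (hF₂.reg 5 rfl).trans (by simp [MState.set_reg, hs5])
    refine Ends.then (T' := 0 + 1) (Ends.mul_of (a := b) (c := b ^ j) h5
      ((hF₂.reg 6 rfl).trans (by simp [MState.set_reg, hs6]))
      ((hF₂.reg 7 rfl).trans (by simp [MState.set_reg, hs7])) hI (by omega) (by omega) (by omega))
      (by omega) fun s₃ hF₃ hs₃ => ?_
    refine Ends.add ?_
    rw [MState.set_reg, if_pos rfl, hs₃, hF₃.reg 5 rfl, h5, pow_succ]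
    ring
  · exact ⟨(hF₂.reg 5 rfl).trans (by simp [MState.set_reg, hs5]),
      (hF₂.reg 6 rfl).trans (by simp [MState.set_reg, hs6]),
      (hF₂.reg 7 rfl).trans (by simp [MState.set_reg, hs7]),
      (hF₂.reg 8 rfl).trans (by simp [MState.set_reg, hs8]),
      (hF₂.reg 9 rfl).trans (by simp [MState.set_reg, hs9]), hs₂,
      (hF₂.reg 16 rfl).trans (by simp [MState.set_reg, hs'])⟩

end Preparation

/-! ### The oracle and its memory -/

section Oracle

variable {n : ℕ} {A : GraphInput n} {ω : Coins} {d h p q m B : ℕ}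

/-- The oracle. -/
def Program.oracle : Program :=
  .seq (.const 5 0) (.seq (.add 70 0 5) (.seq .prepare .answer))

/-- The state of the oracle between two queries. -/
structure Ready (ω : Coins) (d h p q B : ℕ) (s : MState) : Prop where
  deg : s.reg 1 = d
  width : s.reg 2 = h
  num : s.reg 3 = p
  den : s.reg 4 = q
  memo : Memo ω B s

theorem ready_startState : Ready ω d h p q B (startState d h p q) :=
  ⟨rfl, rfl, rfl, rfl, fun _ => .inl ⟨rfl, rfl⟩⟩

theorem bounded_params (hA : ∀ v, A.degree v ≤ d) (hd : 1 ≤ d) (hm : 1 ≤ m) :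
    Bounded A d (sizeParam d h m) (cutParam d h m) (2 * h + 2)
      (sizeParam d h m ^ (2 * h + 2)) := by
  have hbound := mul_le_sizeParam (h := h) hd hm
  have hL := one_le_logParam (d * m)
  have hP : 1 ≤ 2 ^ (40 * (h + 1)) := Nat.one_le_two_pow
  refine ⟨hA, by omega, ?_, by omega, ?_, rfl⟩
  · unfold sizeParam
    calc d * d = 1 * 1 * d * d * 1 * 1 := by ring
      _ ≤ _ := by gcongr
  · have hpow : 2 ^ (25 * (h + 1)) ≤ 2 ^ (40 * (h + 1)) :=
      Nat.pow_le_pow_right (by norm_num) (by omega)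
    unfold sizeParam cutParam
    generalize 2 ^ (25 * (h + 1)) = x at *
    generalize 2 ^ (40 * (h + 1)) = y at *
    calc x * logParam (d * m) * m = x * logParam (d * m) * 1 * 1 * 1 * m := by ring
      _ ≤ y * logParam (d * m) * d * d * m * m := by gcongr

/-- With `N = b ^ (2 * h + 2)`, the bound for answering has order `N * N * b ^ 5 = b ^ (4 * h + 9)`;
one more factor `b` absorbs the constants and the preparation. The parameters are recomputed at
every query, so only the inputs and the stored keys have to survive between queries. -/
theorem Ends.oracle {s : MState} (hA : ∀ v, A.degree v ≤ d) (hd : 1 ≤ d) (hm : 1 ≤ m)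
    (hlt : (m - 1) * p < q) (hle : q ≤ m * p)
    (hs : Ready ω d h p q (sizeParam d h m * sizeParam d h m) s) (v : Fin n) :
    Ends A ω .oracle (s.set 0 v) (sizeParam d h m ^ (4 * h + 10)) fun s' =>
      Ready ω d h p q (sizeParam d h m * sizeParam d h m) s' ∧
      Holds s' 0 (labels (A.partList (cutParam d h m) (sizeParam d h m) (2 * h + 2) ω
        (sizeParam d h m * sizeParam d h m) v)) ∧
      s'.reg 0 = (A.partList (cutParam d h m) (sizeParam d h m) (2 * h + 2) ω
        (sizeParam d h m * sizeParam d h m) v).length := by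
  have hb := bounded_params (h := h) hA hd hm
  have hbound := mul_le_sizeParam (h := h) hd hm
  have hprep := fun {s' : MState} (h1 : s'.reg 1 = d) (h2 : s'.reg 2 = h) (h3 : s'.reg 3 = p)
    (h4 : s'.reg 4 = q) => Ends.prepare (A := A) (ω := ω) h1 h2 h3 h4 hlt hle hd hm
  generalize sizeParam d h m = b at *
  generalize cutParam d h m = D at *
  have e : b ^ (2 * h + 2) * b ^ (2 * h + 2) * b ^ 5 = b ^ (4 * h + 9) := by
    rw [← pow_add, ← pow_add]
    congr 1
    ring
  have e' : 1000 * b ^ (4 * h + 9) ≤ b ^ (4 * h + 10) := by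
    rw [pow_succ b (4 * h + 9), mul_comm]
    exact Nat.mul_le_mul_left _ (by omega)
  have e'' : b ^ 3 ≤ b ^ (4 * h + 9) := Nat.pow_le_pow_right (by omega) (by omega)
  have e3 : 1 ≤ b ^ 3 := Nat.one_le_pow _ _ (by omega)
  have key : Ends A ω .oracle (s.set 0 v) (b ^ (4 * h + 10)) fun s' =>
      Memo ω (b * b) s' ∧
      Holds s' 0 (labels (A.partList D b (2 * h + 2) ω (b * b) v)) ∧
      s'.reg 0 = (A.partList D b (2 * h + 2) ω (b * b) v).length := by
    refine Ends.le (T := b ^ 3 + 400 * b ^ (4 * h + 9) + 1 + 1) ?_ (by omega)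
    refine Ends.const_seq ?_
    refine Ends.add_seq ?_
    refine Ends.seq (hprep (by simp [MState.set_reg, hs.deg]) (by simp [MState.set_reg, hs.width])
      (by simp [MState.set_reg, hs.num]) (by simp [MState.set_reg, hs.den])) fun s' hF hs' => ?_
    rw [← e]
    refine Ends.answer hs' hb le_rfl ?_ ((hF.reg 70 rfl).trans (by simp [MState.set_reg]))
    exact Memo.frame (s := ((s.set _ _).set _ _).set _ _) hs.memo hF
  refine key.mono le_rfl fun s' hF hs' => ⟨⟨?_, ?_, ?_, ?_, hs'.1⟩, hs'.2⟩
  · exact (hF.reg 1 rfl).trans (by simp [MState.set_reg, hs.deg])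
  · exact (hF.reg 2 rfl).trans (by simp [MState.set_reg, hs.width])
  · exact (hF.reg 3 rfl).trans (by simp [MState.set_reg, hs.num])
  · exact (hF.reg 4 rfl).trans (by simp [MState.set_reg, hs.den])

/-- By determinism the given run of each earlier query coincides with the one constructed in
`Ends.oracle`, which restores the invariant. -/
theorem ready_of_after {s : MState} {vs : List (Fin n)} (hA : ∀ v, A.degree v ≤ d) (hd : 1 ≤ d)
    (hm : 1 ≤ m) (hlt : (m - 1) * p < q) (hle : q ≤ m * p)
    (h' : After A ω .oracle (startState d h p q) vs s) :
    Ready ω d h p q (sizeParam d h m * sizeParam d h m) s := by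
  induction h' with
  | start => exact ready_startState
  | ask _ v hrun ih =>
    obtain ⟨t, c, s', hrun', -, hs'⟩ := Ends.oracle hA hd hm hlt hle ih v
    rw [hrun.unique hrun']
    exact hs'.1

theorem MState.answers_toFinset {s : MState} {l : List (Fin n)} (hl : l.Nodup)
    (h : Holds s 0 (labels l)) (hlen : s.reg 0 = l.length) : s.Answers l.toFinset := by
  refine ⟨by rw [hlen, List.toFinset_card_of_nodup hl], fun v => ?_⟩
  rw [List.mem_toFinset, List.mem_iff_getElem, hlen]
  have hget : ∀ i (hi : i < l.length), s.arr 0 i = l[i] := fun i hi => by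
    rw [h i (by simpa using hi)]
    simp
  constructor
  · rintro ⟨i, hi, rfl⟩
    exact ⟨i, hi, hget i hi⟩
  · rintro ⟨i, hi, hv⟩
    exact ⟨i, hi, Fin.ext ((hget i hi).symm.trans hv)⟩

end Oracle

/-! ### The bounds on `k` and on the time in terms of `k` -/

section Bounds

/-- The bound on the size of a part. -/
def partBound (d h m : ℕ) : ℕ := 2 ^ (60 * (h + 1)) * d ^ 5 * m ^ 3 * logParam (d * m)

/-- The bound `k` must depend on `ε` alone and is taken at `⌈2 / ε⌉₊`, while the oracle works with
`q / p` rounded up, which can be smaller. -/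
theorem sizeParam_mono {d h m m' : ℕ} (hm : m ≤ m') : sizeParam d h m ≤ sizeParam d h m' := by
  unfold sizeParam logParam
  have := Nat.clog_mono_right 2 (Nat.mul_le_mul_left d hm)
  gcongr

theorem logParam_cube_le {x : ℕ} (hx : 1 ≤ x) : logParam x ^ 3 ≤ 128 * x := by
  have h1 : ∀ c : ℕ, (c + 4) ^ 3 ≤ 64 * 2 ^ c := by
    intro c
    induction c with
    | zero => norm_num
    | succ c ih =>
      have : 2 * (c + 4) ^ 3 = (c + 1 + 4) ^ 3 + (c ^ 3 + 9 * c ^ 2 + 21 * c + 3) := by ring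
      rw [pow_succ 2 c]
      omega
  have h2 : 2 ^ Nat.clog 2 x ≤ 2 * x := by
    rcases Nat.eq_or_lt_of_le hx with rfl | hx
    · simp
    · have := Nat.pow_pred_clog_lt_self (by norm_num : 1 < 2) hx
      have hc : 0 < Nat.clog 2 x := Nat.clog_pos (by norm_num) hx
      obtain ⟨c, hc⟩ : ∃ c, Nat.clog 2 x = c + 1 := ⟨_, (Nat.succ_pred_eq_of_pos hc).symm⟩
      rw [hc] at this ⊢
      rw [pow_succ]
      simp only [Nat.pred_succ] at this
      omega
  calc logParam x ^ 3 ≤ (Nat.clog 2 x + 4) ^ 3 := by unfold logParam; gcongr; omega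
    _ ≤ 64 * 2 ^ Nat.clog 2 x := h1 _
    _ ≤ 128 * x := by omega

/-- Write `k` as `sizeParam d h m` times a slack `2 ^ (20 * (h + 1)) * d ^ 3 * m`. The seventh power
of the slack exceeds the cube of `sizeParam d h m`, by `logParam_cube_le`, and `7 ≤ 4 * h + 7`. This
trades the exponent `4 * h + 10` for `4 * h + 7`. -/
theorem sizeParam_pow_le {d h m : ℕ} (hd : 1 ≤ d) (hm : 1 ≤ m) :
    sizeParam d h m ^ (4 * h + 10) ≤ partBound d h m ^ (4 * h + 7) := by
  have hk : partBound d h m = sizeParam d h m * (2 ^ (20 * (h + 1)) * d ^ 3 * m) := by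
    have : 2 ^ (60 * (h + 1)) = 2 ^ (40 * (h + 1)) * 2 ^ (20 * (h + 1)) := by
      rw [← pow_add]
      congr 1
      ring
    rw [partBound, sizeParam, this]
    ring
  have hg : sizeParam d h m ^ 3 ≤ (2 ^ (20 * (h + 1)) * d ^ 3 * m) ^ 7 := by
    have hL := logParam_cube_le (Nat.mul_pos hd hm)
    have e1 : (2 ^ (20 * (h + 1))) ^ 7 = 2 ^ (20 * (h + 1)) * (2 ^ (40 * (h + 1))) ^ 3 := by
      rw [← pow_mul, ← pow_mul, ← pow_add]
      congr 1
      ring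
    have e2 : 128 ≤ 2 ^ (20 * (h + 1)) := by
      calc 128 = 2 ^ 7 := by norm_num
        _ ≤ _ := Nat.pow_le_pow_right (by norm_num) (by omega)
    calc sizeParam d h m ^ 3
        = (2 ^ (40 * (h + 1))) ^ 3 * logParam (d * m) ^ 3 * d ^ 6 * m ^ 6 := by
          rw [sizeParam]; ring
      _ ≤ (2 ^ (40 * (h + 1))) ^ 3 * (128 * (d * m)) * d ^ 6 * m ^ 6 := by gcongr
      _ = 128 * (2 ^ (40 * (h + 1))) ^ 3 * d ^ 7 * m ^ 7 := by ring
      _ ≤ 2 ^ (20 * (h + 1)) * (2 ^ (40 * (h + 1))) ^ 3 * d ^ 21 * m ^ 7 := by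
          gcongr
          norm_num
      _ = _ := by rw [mul_pow, mul_pow, e1]; ring
  have hg1 : 1 ≤ 2 ^ (20 * (h + 1)) * d ^ 3 * m :=
    Nat.mul_pos (Nat.mul_pos (by positivity) (by positivity)) hm
  rw [hk, mul_pow]
  calc sizeParam d h m ^ (4 * h + 10) = sizeParam d h m ^ (4 * h + 7) * sizeParam d h m ^ 3 := by
        rw [← pow_add]
    _ ≤ sizeParam d h m ^ (4 * h + 7) * (2 ^ (20 * (h + 1)) * d ^ 3 * m) ^ 7 := by gcongr
    _ ≤ _ := by gcongr; omega

theorem sizeParam_le_partBound {d h m : ℕ} (hd : 1 ≤ d) (hm : 1 ≤ m) :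
    sizeParam d h m ≤ partBound d h m := by
  unfold sizeParam partBound
  calc 2 ^ (40 * (h + 1)) * logParam (d * m) * d * d * m * m
      = 2 ^ (40 * (h + 1)) * d ^ 2 * m ^ 2 * logParam (d * m) := by ring
    _ ≤ _ := by gcongr <;> omega

/-- For `h ≤ 1` the power of `h` is one and the constant `2 ^ 120` does all the work; from `h = 2`
on, `h ^ (C * h)` is at least `2 ^ (60 * h)`. -/
theorem two_pow_le_mul_pow {C : ℕ} (hC : 60 ≤ C) (h : ℕ) :
    2 ^ (60 * (h + 1)) ≤ 2 ^ 120 * h ^ (C * h) := by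
  rcases h with _ | _ | h
  · simp
  · simp
  · calc 2 ^ (60 * (h + 2 + 1)) = 2 ^ 60 * 2 ^ (60 * (h + 2)) := by rw [← pow_add]; congr 1; ring
      _ ≤ 2 ^ 120 * (h + 2) ^ (C * (h + 2)) := by
        refine Nat.mul_le_mul (by norm_num) ?_
        calc 2 ^ (60 * (h + 2)) ≤ 2 ^ (C * (h + 2)) :=
              Nat.pow_le_pow_right (by norm_num) (Nat.mul_le_mul_right _ hC)
          _ ≤ _ := Nat.pow_le_pow_left (by omega) _

theorem log_two_gt_half : (1 : ℝ) / 2 < Real.log 2 := by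
  have := Real.log_two_gt_d9
  linarith

/-- From `2 ^ Nat.clog 2 x ≤ 2 * x ≤ 2 ^ 3 * y` the ceiling logarithm times `Real.log 2` is at most
`4 * Real.log y`, hence it is at most `8 * Real.log y`; the final one is at most `2 * Real.log y`.
-/
theorem logParam_le {x : ℕ} {y : ℝ} (hx : 1 ≤ x) (hy : 2 ≤ y) (hxy : (x : ℝ) ≤ 3 * y) :
    (logParam x : ℝ) ≤ 10 * Real.log y := by
  have h2 := log_two_gt_half
  have hlog : Real.log 2 ≤ Real.log y := Real.log_le_log (by norm_num) hy
  have h1 : (2 : ℝ) ^ Nat.clog 2 x ≤ 2 ^ 3 * y := by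
    have : 2 ^ Nat.clog 2 x ≤ 2 * x := by
      rcases Nat.eq_or_lt_of_le hx with rfl | hx
      · simp
      · have := Nat.pow_pred_clog_lt_self (by norm_num : 1 < 2) hx
        have hc : 0 < Nat.clog 2 x := Nat.clog_pos (by norm_num) hx
        obtain ⟨c, hc⟩ : ∃ c, Nat.clog 2 x = c + 1 := ⟨_, (Nat.succ_pred_eq_of_pos hc).symm⟩
        rw [hc] at this ⊢
        rw [pow_succ]
        simp only [Nat.pred_succ] at this
        omega
    have h3 : (2 : ℝ) ^ Nat.clog 2 x ≤ 2 * x := by exact_mod_cast this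
    linarith
  have h3 := Real.log_le_log (by positivity) h1
  rw [Real.log_pow, Real.log_mul (by norm_num) (by linarith), Real.log_pow] at h3
  unfold logParam
  push_cast at h3 ⊢
  nlinarith

/-- The factor `270` is `3 ^ 3` from `m ≤ 3 / ε` times `10` from `logParam_le`. -/
theorem partBound_le {C : ℕ} (hC : 2 ^ 120 * 270 ≤ C) {d h m : ℕ} {ε : ℝ} (hd : 1 ≤ d) (hm : 1 ≤ m)
    (hε : 0 < ε) (hε' : ε < 1 / 2) (hmε : (m : ℝ) ≤ 3 / ε) :
    (partBound d h m : ℝ) ≤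
      C * ((d : ℝ) ^ 5 * (h : ℝ) ^ (C * h) * Real.log (d / ε) / ε ^ 3) := by
  have hd' : (1 : ℝ) ≤ d := by exact_mod_cast hd
  have hy : 2 ≤ (d : ℝ) / ε := by
    rw [le_div_iff₀ hε]
    linarith
  have hlogpos : 0 ≤ Real.log (d / ε) := Real.log_nonneg (by linarith)
  have hL : (logParam (d * m) : ℝ) ≤ 10 * Real.log (d / ε) := by
    refine logParam_le (Nat.mul_pos hd hm) hy ?_
    push_cast
    calc (d : ℝ) * m ≤ d * (3 / ε) := by gcongr
      _ = 3 * (d / ε) := by ring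
  have h60 : 60 ≤ C := le_trans (by norm_num) hC
  have hP : (2 : ℝ) ^ (60 * (h + 1)) ≤ 2 ^ 120 * (h : ℝ) ^ (C * h) := by
    exact_mod_cast two_pow_le_mul_pow h60 h
  have hC' : (2 : ℝ) ^ 120 * 270 ≤ C := by exact_mod_cast hC
  have hx : (0 : ℝ) ≤ 2 ^ (60 * (h + 1)) := by positivity
  have hz : (0 : ℝ) < 2 ^ 120 := by positivity
  unfold partBound
  push_cast
  generalize (2 : ℝ) ^ (60 * (h + 1)) = x at *
  generalize (2 : ℝ) ^ 120 = z at *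
  calc x * d ^ 5 * m ^ 3 * logParam (d * m)
      ≤ (z * (h : ℝ) ^ (C * h)) * d ^ 5 * (3 / ε) ^ 3 * (10 * Real.log (d / ε)) := by gcongr
    _ = z * 270 * ((d : ℝ) ^ 5 * (h : ℝ) ^ (C * h) * Real.log (d / ε) / ε ^ 3) := by
        field_simp
        ring
    _ ≤ C * ((d : ℝ) ^ 5 * (h : ℝ) ^ (C * h) * Real.log (d / ε) / ε ^ 3) := by
        gcongr

end Bounds
-- The main theorem
theorem theorem1 :
    ∃ (C : ℕ) (P : Program),
      ∀ (d h : ℕ) (ε : ℝ), 1 ≤ d → 0 < ε → ε < 1 / 2 →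
      ∃ k : ℕ, 0 < k ∧
        (k : ℝ) ≤ C * ((d : ℝ) ^ 5 * (h : ℝ) ^ (C * h) * Real.log (d / ε) / ε ^ 3) ∧
        ∀ p q : ℕ, ε / 2 ≤ (p : ℝ) / q → (p : ℝ) / q ≤ ε →
        ∀ (n : ℕ) (A : GraphInput n), (∀ v, A.degree v ≤ d) →
        ∃ f : Coins → Fin n → Finset (Fin n),
          -- the values of `f ω` form a partition into small parts
          (∀ ω v, v ∈ f ω v) ∧
          (∀ ω v, ∀ w ∈ f ω v, f ω v = f ω w) ∧
          (∀ ω v, (f ω v).card ≤ k) ∧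
          -- few edges are cut
          (treewidth A.graph ≤ h →
            9 / 10 ≤ coinMeasure {ω | ((A.cutEdges (f ω)).ncard : ℝ) ≤ ε * n}) ∧
          -- after any queries, the oracle answers according to the same `f ω`, within the bounds
          (∀ (ω : Coins) (vs : List (Fin n)) (s : MState),
            After A ω P (startState d h p q) vs s →
            ∀ v : Fin n, ∃ (t c : ℕ) (s' : MState),
              Run A ω P (s.set 0 v) t c s' ∧
              s'.Answers (f ω v) ∧
              (c : ℝ) ≤ C * (d * (k : ℝ) ^ (4 * h + 7)) ∧
              (t : ℝ) ≤ C * ((k : ℝ) ^ (4 * h + C) * Real.log (vs.length + 2))) := by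
  refine ⟨2 ^ 120 * 270, .oracle, fun d h ε hd hε hε' => ?_⟩
  obtain ⟨C, hC⟩ : ∃ C, C = 2 ^ 120 * 270 := ⟨_, rfl⟩
  rw [← hC]
  have hC10 : 10 ≤ C := by rw [hC]; norm_num
  have hM : 1 ≤ ⌈2 / ε⌉₊ := Nat.one_le_ceil_iff.2 (by positivity)
  have hMε : (⌈2 / ε⌉₊ : ℝ) ≤ 3 / ε := by
    have h1 := (Nat.ceil_lt_add_one (by positivity : 0 ≤ 2 / ε)).le
    have h2 : 1 ≤ 1 / ε := by
      rw [le_div_iff₀ hε]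
      linarith
    calc (⌈2 / ε⌉₊ : ℝ) ≤ 2 / ε + 1 / ε := by linarith
      _ = 3 / ε := by ring
  have hkb := sizeParam_pow_le (h := h) hd hM
  have hbk := sizeParam_le_partBound (h := h) hd hM
  have hk := partBound_le (h := h) hC.ge hd hM hε hε' hMε
  have hmono := fun m (hm : m ≤ ⌈2 / ε⌉₊) => sizeParam_mono (d := d) (h := h) hm
  have hb0 := mul_le_sizeParam (h := h) hd hM
  generalize partBound d h ⌈2 / ε⌉₊ = k at *
  have hk1 : 1 ≤ k := by omega
  refine ⟨k, hk1, hk, fun p q hpq hpq' n A hA => ?_⟩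
  have hpos : 0 < (p : ℝ) / q := lt_of_lt_of_le (by positivity) hpq
  have hq : 0 < q := by
    rcases Nat.eq_zero_or_pos q with rfl | hq
    · simp at hpos
    · exact hq
  have hp : 0 < p := by
    rcases Nat.eq_zero_or_pos p with rfl | hp
    · simp at hpos
    · exact hp
  have hp' : (0 : ℝ) < p := by exact_mod_cast hp
  have hq' : (0 : ℝ) < q := by exact_mod_cast hq
  -- This `m` is `q / p` rounded up. The oracle can compute it, and `1 / m ≤ p / q ≤ ε`.
  obtain ⟨m, hm, hlt, hle⟩ : ∃ m, 1 ≤ m ∧ (m - 1) * p < q ∧ q ≤ m * p := by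
    refine ⟨(q - 1) / p + 1, Nat.le_add_left _ _, ?_, ?_⟩
    · have := Nat.div_mul_le_self (q - 1) p
      rw [Nat.add_sub_cancel]
      omega
    · have := Nat.lt_div_mul_add hp (a := q - 1)
      rw [Nat.succ_mul]
      omega
  have hm' : (0 : ℝ) < m := by exact_mod_cast hm
  -- `m - 1 < q / p ≤ 2 / ε`: here the lower bound on the given fraction is used.
  have hmM : m ≤ ⌈2 / ε⌉₊ := by
    have h1 : ((m - 1 : ℕ) : ℝ) < 2 / ε := by
      have h2 : ((m - 1 : ℕ) : ℝ) * p < q := by exact_mod_cast hlt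
      rw [div_le_div_iff₀ (by norm_num) hq'] at hpq
      rw [lt_div_iff₀ hε]
      have h3 : ((m - 1 : ℕ) : ℝ) * p * 2 < q * 2 := by linarith
      have h4 : ((m - 1 : ℕ) : ℝ) * (ε * q) ≤ ((m - 1 : ℕ) : ℝ) * (p * 2) := by gcongr
      by_contra hcon
      nlinarith
    have := Nat.lt_ceil.2 h1
    omega
  have hmε : 1 / (m : ℝ) ≤ ε := by
    refine le_trans ?_ hpq'
    rw [div_le_div_iff₀ hm' hq']
    have : (q : ℝ) ≤ m * p := by exact_mod_cast hle
    linarith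
  have hb := mul_le_sizeParam (h := h) hd hm
  have hbk' := (hmono m hmM).trans hbk
  have hcut := fun hw => A.le_coinMeasure_cutEdges_partList (h := h) hd hm hmε hA hw
  have hbpow : sizeParam d h m ^ (4 * h + 10) ≤ k ^ (4 * h + 7) :=
    (Nat.pow_le_pow_left (hmono m hmM) _).trans hkb
  have hready := fun {ω : Coins} {s : MState} {vs : List (Fin n)} =>
    ready_of_after (ω := ω) (s := s) (vs := vs) (h := h) hA hd hm hlt hle
  have horacle := fun {ω : Coins} {s : MState} => Ends.oracle (ω := ω) (s := s) (h := h)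
    hA hd hm hlt hle
  generalize sizeParam d h m = b at *
  generalize cutParam d h m = D at *
  have hmem := fun ω (v x : Fin n) => GraphInput.mem_partList (A := A) (D := D) (ω := ω)
    (B := b * b) (by omega : 1 < b) (by omega : 0 < 2 * h + 2) (v := v) (x := x)
  have hnd := fun ω (v : Fin n) => (A.nodup_findSet (D := D) (b := b) (t := 2 * h + 2)
    (A.winner D b (2 * h + 2) ω (b * b) v)).filter
    fun x => A.winner D b (2 * h + 2) ω (b * b) x = A.winner D b (2 * h + 2) ω (b * b) v
  refine ⟨fun ω v => (A.partList D b (2 * h + 2) ω (b * b) v).toFinset, fun ω v => ?_,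
    fun ω v w hw => ?_, fun ω v => ?_, hcut, fun ω vs s hs v => ?_⟩
  · rw [List.mem_toFinset, hmem]
  · rw [List.mem_toFinset, hmem] at hw
    ext x
    rw [List.mem_toFinset, List.mem_toFinset, hmem, hmem, hw]
  · refine ((List.toFinset_card_le _).trans (List.length_filter_le _ _)).trans ?_
    exact (A.length_findSet_le (by omega) _).trans hbk'
  · obtain ⟨t, c, s', hrun, ht, -, h0, hlen⟩ := horacle (hready hs) v
    have hd' : (1 : ℝ) ≤ d := by exact_mod_cast hd
    have hk' : (1 : ℝ) ≤ k := by exact_mod_cast hk1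
    have hC' : (10 : ℝ) ≤ C := by exact_mod_cast hC10
    have htk : (t : ℝ) ≤ (k : ℝ) ^ (4 * h + 7) := by exact_mod_cast ht.trans hbpow
    have hct : (c : ℝ) ≤ t := by exact_mod_cast hrun.queries_le
    refine ⟨t, c, s', hrun, MState.answers_toFinset (hnd ω v) h0 hlen, ?_, ?_⟩
    · calc (c : ℝ) ≤ 1 * (1 * (k : ℝ) ^ (4 * h + 7)) := by linarith
        _ ≤ C * (d * (k : ℝ) ^ (4 * h + 7)) := by gcongr; linarith
    -- The time bound obtained does not grow with the number of previous queries; the logarithm is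
    -- only needed to be at least `1 / 2`.
    · have hlog : 1 / 2 ≤ Real.log (vs.length + 2) :=
        log_two_gt_half.le.trans (Real.log_le_log (by norm_num) (by
          have : (0 : ℝ) ≤ vs.length := by positivity
          linarith))
      calc (t : ℝ) ≤ 2 * ((k : ℝ) ^ (4 * h + 7) * (1 / 2)) := by linarith
        _ ≤ C * ((k : ℝ) ^ (4 * h + C) * Real.log (vs.length + 2)) := by
          gcongr
          · linarith
          · omega
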